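/- Let $d\ge 1$ and let $\mathcal R,\mathcal B$ be independent homogeneous Poisson processes of intensity $1$ on $\mathbb R^d$ (the sets of red and of blue points). A partial matching $m$ between the red and the blue points (a set of red–blue pairs in which every point occurs at most once) is called stable if there are no red point $x$ and blue point $y$ with $|x-y|<\min\{|x-m(x)|,|y-m(y)|\}$, where $m(x)$ denotes the partner of $x$ and $|x-m(x)|:=\infty$ if $x$ is unmatched. Almost surely there is exactly one stable partial matching $\mathcal M$ between the red and the blue points; it is almost surely a perfect matching, and it is a point process of pairs (a measurable matching scheme). Let $X\in[0,\infty]$ be the typical distance from a red point to its partner under $\mathcal M$, i.e. the random variable, governed by a probability measure $\mathbb P^*$ with expectation $\mathbb E^*$, whose distribution function is $$\mathbb P^*(X\le r)=\mathbb E\,\#\{x\in\mathcal R\cap[0,1)^d:\ |x-\mathcal M(x)|\le r\},\qquad r\in[0,\infty].$$ Then (i) $\mathbb E^* X^d=\infty$; (ii) $\mathbb P^*(X>r)\le C\,r^{-s}$ for all $r>0$, where $s=s(d)\in(0,1)$ and $C=C(d)\in(0,\infty)$ depend only on $d$, and $s(1)=1/2$. -/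

import Mathlib

open MeasureTheory ProbabilityTheory Set
open scoped ENNReal

namespace StableMatching

noncomputable section

/-- Euclidean space of dimension `d`. -/
abbrev Space (d : ℕ) : Type := EuclideanSpace ℝ (Fin d)

/-- The unit cube `[0,1)^d`. -/
def unitCube (d : ℕ) : Set (Space d) := {x | ∀ i, x i ∈ Ico (0 : ℝ) 1}

/-- The support `[π] = {x : π({x}) = 1}` of a (simple) counting measure. -/
def support {d : ℕ} (π : Measure (Space d)) : Set (Space d) := {x | π {x} = 1}

/-- A simple point process: a random measure that is almost surely the counting measure of a
locally finite set. -/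
structure IsSimplePointProcess {Ω : Type*} [MeasurableSpace Ω] (P : Measure Ω) {d : ℕ}
    (R : Ω → Measure (Space d)) : Prop where
  measurable : Measurable R
  counting : ∀ᵐ ω ∂P, ∃ S : Set (Space d),
    (∀ K : Set (Space d), IsCompact K → (S ∩ K).Finite) ∧ R ω = Measure.count.restrict S

/-- A homogeneous Poisson process of intensity `1`: the number of points in a Borel set of finite
volume is Poisson with mean the volume, and the numbers of points in finitely many pairwise
disjoint Borel sets are independent. -/
structure IsUnitPoissonProcess {Ω : Type*} [MeasurableSpace Ω] (P : Measure Ω) {d : ℕ}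
    (R : Ω → Measure (Space d)) : Prop where
  simple : IsSimplePointProcess P R
  law : ∀ A : Set (Space d), MeasurableSet A → volume A ≠ ∞ →
    P.map (fun ω => R ω A) =
      (poissonMeasure (volume A).toNNReal).map (fun n : ℕ => (n : ℝ≥0∞))
  indep : ∀ (n : ℕ) (A : Fin n → Set (Space d)), (∀ i, MeasurableSet (A i)) →
    Pairwise (fun i j => Disjoint (A i) (A j)) → iIndepFun (fun i ω => R ω (A i)) P

/-- A partial bipartite matching between `U` and `V`; the pair `(x, y)` in `m` stands for the edge
between the red point `x` and the blue point `y`. -/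
structure IsPartialMatching {d : ℕ} (U V : Set (Space d)) (m : Set (Space d × Space d)) :
    Prop where
  subset : m ⊆ U ×ˢ V
  red_unique : ∀ x y y', (x, y) ∈ m → (x, y') ∈ m → y = y'
  blue_unique : ∀ x x' y, (x, y) ∈ m → (x', y) ∈ m → x = x'

/-- A perfect bipartite matching: a partial matching that leaves no point unmatched. -/
structure IsPerfectMatching {d : ℕ} (U V : Set (Space d)) (m : Set (Space d × Space d)) :
    Prop where
  partialMatching : IsPartialMatching U V m
  red_matched : ∀ x ∈ U, ∃ y, (x, y) ∈ m
  blue_matched : ∀ y ∈ V, ∃ x, (x, y) ∈ m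

/-- The distance from the red point `x` to its partner; it is `∞` if `x` is unmatched. -/
def redDist {d : ℕ} (m : Set (Space d × Space d)) (x : Space d) : ℝ≥0∞ :=
  ⨅ (y : Space d) (_ : (x, y) ∈ m), edist x y

/-- The distance from the blue point `y` to its partner; it is `∞` if `y` is unmatched. -/
def blueDist {d : ℕ} (m : Set (Space d × Space d)) (y : Space d) : ℝ≥0∞ :=
  ⨅ (x : Space d) (_ : (x, y) ∈ m), edist x y

/-- A stable partial matching between `U` and `V`: there is no unstable pair, that is, no red `x`
and blue `y` that are both closer to each other than to their partners. -/
structure IsStableMatching {d : ℕ} (U V : Set (Space d)) (m : Set (Space d × Space d)) :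
    Prop where
  partialMatching : IsPartialMatching U V m
  stable : ∀ x ∈ U, ∀ y ∈ V, ¬ edist x y < min (redDist m x) (blueDist m y)

/-- A two-color matching scheme between `R` and `B`: a point process of pairs (its numbers of pairs
in Borel sets are random variables) that is almost surely a perfect matching between the red and
the blue points. -/
structure IsMatchingScheme {Ω : Type*} [MeasurableSpace Ω] (P : Measure Ω) {d : ℕ}
    (R B : Ω → Measure (Space d)) (M : Ω → Set (Space d × Space d)) : Prop where
  measurable : ∀ S : Set (Space d × Space d), MeasurableSet S →
    AEMeasurable (fun ω => (M ω ∩ S).encard) P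
  perfect : ∀ᵐ ω ∂P, IsPerfectMatching (support (R ω)) (support (B ω)) (M ω)

/-- `F(r)`: the expected number of red points in the unit cube whose partner is at distance at
most `r`. -/
def expectedCount {Ω : Type*} [MeasurableSpace Ω] (P : Measure Ω) {d : ℕ}
    (R : Ω → Measure (Space d)) (M : Ω → Set (Space d × Space d)) (r : ℝ≥0∞) : ℝ≥0∞ :=
  ∫⁻ ω, (({x | x ∈ support (R ω) ∩ unitCube d ∧ redDist (M ω) x ≤ r}.encard : ℕ∞) : ℝ≥0∞) ∂P

/-- `ν` is the law, on `[0,∞]`, of the typical matching distance `X`: the probability measure with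
distribution function `F`. (There is at most one such `ν`.) -/
structure IsTypicalDistanceLaw {Ω : Type*} [MeasurableSpace Ω] (P : Measure Ω) {d : ℕ}
    (R : Ω → Measure (Space d)) (M : Ω → Set (Space d × Space d)) (ν : Measure ℝ≥0∞) :
    Prop where
  prob : IsProbabilityMeasure ν
  cdf : ∀ r : ℝ≥0∞, ν (Iic r) = expectedCount P R M r

end

end StableMatching

/-! Say that a red–blue pair is beaten by a shorter pair sharing an endpoint with it. Without ties
between distances, a matching is stable exactly if it consists of the pairs that none of its members
beats. If there is also no infinite descending alternating path, every nonempty set of pairs has an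
unbeaten member (`exists_unbeaten`); this recursion then has exactly one solution, reached by
selecting pairs in rounds. Poisson points satisfy both conditions almost surely: cutting space into
cells bounds the chance of an alternating path with all edge lengths in a narrow window, each two
further edges costing the square of a thin shell's volume (`measure_hasPath_le`).

The selection is a measurable function of the configuration and commutes with translations. Hence
the mean measure of the red points marked with their matching distance is Lebesgue measure times a
probability measure `ν`, the law of `X` (`exists_typicalLaw`); unmatched points carry the mark `∞`.
The blue points give a law `ν'` in the same way, and the tail argument is run for the sum of the
two.

Tail. In a cube of side `L` two points are at distance at most `d * L`, so by stability the points
matched farther than some `r ≥ d * L` have one color. Their number is at most the discrepancy of the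
two point counts, of mean order `L ^ (d / 2)`, plus the number of points of the other color matched
at distance in `(ρ, r]` or matched across the boundary at distance at most `ρ`, the latter of mean
order `L ^ (d - 1)` times the truncated first moment (`lintegral_far_le`). The mass in `(ρ, r]` is a
difference of two tails, so twice the tail at `r` is at most the tail at `ρ` plus small terms. Along
the scales `(16 * d ^ 2) ^ j` this forces decay by `3 / 4` per scale (`MassTransport.geometric`); in
particular no mass sits at `∞` and the matching is perfect.

On the line the far red points of `[0, L)` span an interval that no short edge leaves, so their
number is at most the red surplus there (`IsStableMatching.exists_interval`). This is controlled by
the running maxima of two centered random walks, of mean order `√L`, whence the exponent `1 / 2`.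

Moment. If the moment of order `d` were finite, only finitely many red points would be matched so
far that they might prefer a new blue point in the unit ball. Enclose these, their partners and the
ball in a region and resample the points inside it. With positive probability the new sample there
is a single blue point in the ball; the old edges outside still form a stable matching, but leave
this point unmatched (`exists_not_isPerfectMatching`). This contradicts perfectness, since the
resampled pair is again a pair of independent Poisson processes. -/

namespace StableMatching

/-! ### Stable matchings of locally finite sets -/

/-- Every compact set contains finitely many points. -/
def LocFinite {d : ℕ} (U : Set (Space d)) : Prop := ∀ K : Set (Space d), IsCompact K → (U ∩ K).Finite

/-- No point of one color has two distinct points of the other color at the same distance. -/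
structure NoTies {d : ℕ} (U V : Set (Space d)) : Prop where
  red : ∀ x ∈ U, ∀ y ∈ V, ∀ y' ∈ V, dist x y = dist x y' → y = y'
  blue : ∀ y ∈ V, ∀ x ∈ U, ∀ x' ∈ U, dist x y = dist x' y → x = x'

/-- There is no infinite alternating self-avoiding path with strictly decreasing edge lengths. -/
def NoChain {d : ℕ} (U V : Set (Space d)) : Prop :=
  ¬ ∃ x y : ℕ → Space d, (∀ i, x i ∈ U) ∧ (∀ i, y i ∈ V) ∧ x.Injective ∧ y.Injective ∧
    (∀ i, dist (x (i + 1)) (y i) < dist (x i) (y i)) ∧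
    ∀ i, dist (x (i + 1)) (y (i + 1)) < dist (x (i + 1)) (y i)

/-- The edge `f` shares an endpoint with `e` and is shorter. -/
def Beats {d : ℕ} (f e : Space d × Space d) : Prop :=
  dist f.1 f.2 < dist e.1 e.2 ∧ (f.1 = e.1 ∨ f.2 = e.2)

/-- An edge between the two colors belongs to `m` exactly if no edge of `m` beats it. -/
structure IsBeatKernel {d : ℕ} (U V : Set (Space d)) (m : Set (Space d × Space d)) : Prop where
  subset : m ⊆ U ×ˢ V
  mem_iff : ∀ e ∈ U ×ˢ V, e ∈ m ↔ ∀ f ∈ m, ¬ Beats f e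

section Deterministic

variable {d : ℕ} {U V : Set (Space d)} {m : Set (Space d × Space d)}

lemma edist_le_edist_iff {x y z w : Space d} : edist x y ≤ edist z w ↔ dist x y ≤ dist z w := by
  rw [edist_dist, edist_dist, ENNReal.ofReal_le_ofReal_iff dist_nonneg]

lemma edist_lt_edist_iff {x y z w : Space d} : edist x y < edist z w ↔ dist x y < dist z w := by
  rw [← not_le, edist_le_edist_iff, not_le]

lemma IsPartialMatching.redDist_eq (h : IsPartialMatching U V m) {x y : Space d}
    (hxy : (x, y) ∈ m) : redDist m x = edist x y := by
  refine le_antisymm (iInf₂_le y hxy) (le_iInf₂ fun y' hy' => ?_)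
  rw [h.red_unique x y y' hxy hy']

lemma IsPartialMatching.blueDist_eq (h : IsPartialMatching U V m) {x y : Space d}
    (hxy : (x, y) ∈ m) : blueDist m y = edist x y := by
  refine le_antisymm (iInf₂_le x hxy) (le_iInf₂ fun x' hx' => ?_)
  rw [h.blue_unique x x' y hxy hx']

lemma redDist_eq_top {x : Space d} (h : ∀ y, (x, y) ∉ m) : redDist m x = ∞ := by
  simp [redDist, h]

lemma IsPartialMatching.exists_of_redDist_lt (h : IsPartialMatching U V m) {x : Space d} {r : ℝ≥0∞}
    (hx : redDist m x < r) : ∃ y, (x, y) ∈ m ∧ redDist m x = edist x y := by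
  by_contra! hc
  have : ∀ y, (x, y) ∉ m := fun y hy => hc y hy (h.redDist_eq hy)
  rw [redDist_eq_top this] at hx
  exact not_top_lt hx

lemma IsPartialMatching.swap (h : IsPartialMatching U V m) :
    IsPartialMatching V U (Prod.swap ⁻¹' m) :=
  ⟨fun _ hp => ⟨(h.subset hp).2, (h.subset hp).1⟩,
   fun x y y' h1 h2 => h.blue_unique y y' x h1 h2,
   fun x x' y h1 h2 => h.red_unique y x x' h1 h2⟩

lemma redDist_swap (x : Space d) : redDist (Prod.swap ⁻¹' m) x = blueDist m x := by
  simp [redDist, blueDist, edist_comm]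

lemma blueDist_swap (x : Space d) : blueDist (Prod.swap ⁻¹' m) x = redDist m x := by
  simp [redDist, blueDist, edist_comm]

lemma IsStableMatching.swap (h : IsStableMatching U V m) :
    IsStableMatching V U (Prod.swap ⁻¹' m) :=
  ⟨h.partialMatching.swap, fun x hx y hy => by
    rw [redDist_swap, blueDist_swap, edist_comm, min_comm]; exact h.stable y hy x hx⟩

lemma IsPartialMatching.exists_of_blueDist_lt (h : IsPartialMatching U V m) {y : Space d}
    {r : ℝ≥0∞} (hy : blueDist m y < r) : ∃ x, (x, y) ∈ m ∧ blueDist m y = edist x y := by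
  rw [← redDist_swap] at hy
  obtain ⟨x, hx, _⟩ := h.swap.exists_of_redDist_lt hy
  exact ⟨x, hx, h.blueDist_eq hx⟩

/-- Stability gives an unbeaten pair an endpoint whose partner is at most as far as the other
endpoint, being unbeaten gives the reverse inequality, and the absence of ties identifies the two.
Conversely, two members with a common endpoint do not beat each other, so they have equal length and
coincide. -/
lemma isStableMatching_iff (hT : NoTies U V) : IsStableMatching U V m ↔ IsBeatKernel U V m := by
  constructor
  · intro h
    refine ⟨h.partialMatching.subset, ?_⟩
    rintro ⟨x, y⟩ ⟨hx, hy⟩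
    constructor
    · rintro hm ⟨x', y'⟩ hf ⟨hlt, rfl | rfl⟩
      · have := h.partialMatching.red_unique _ _ _ hf hm
        subst this; exact lt_irrefl _ hlt
      · have := h.partialMatching.blue_unique _ _ _ hf hm
        subst this; exact lt_irrefl _ hlt
    · intro hb
      have hs := h.stable x hx y hy
      rw [lt_min_iff, not_and_or, not_lt, not_lt] at hs
      rcases hs with hs | hs
      · obtain ⟨y', hm, he⟩ := h.partialMatching.exists_of_redDist_lt
          (hs.trans_lt (edist_lt_top x y))
        rw [he, edist_le_edist_iff] at hs
        have h2 : ¬ dist x y' < dist x y := fun hlt => hb _ hm ⟨hlt, Or.inl rfl⟩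
        have := hT.red x hx y hy y' (h.partialMatching.subset hm).2 (le_antisymm (not_lt.1 h2) hs)
        rwa [this]
      · obtain ⟨x', hm, he⟩ := h.partialMatching.exists_of_blueDist_lt
          (hs.trans_lt (edist_lt_top x y))
        rw [he, edist_le_edist_iff] at hs
        have h2 : ¬ dist x' y < dist x y := fun hlt => hb _ hm ⟨hlt, Or.inr rfl⟩
        have := hT.blue y hy x hx x' (h.partialMatching.subset hm).1 (le_antisymm (not_lt.1 h2) hs)
        rwa [this]
  · intro h
    have hp : IsPartialMatching U V m := by
      refine ⟨h.subset, fun x y y' h1 h2 => ?_, fun x x' y h1 h2 => ?_⟩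
      · have a1 := (h.mem_iff _ (h.subset h1)).1 h1 _ h2
        have a2 := (h.mem_iff _ (h.subset h2)).1 h2 _ h1
        simp only [Beats, true_or, and_true, not_lt] at a1 a2
        exact hT.red x (h.subset h1).1 y (h.subset h1).2 y' (h.subset h2).2 (le_antisymm a1 a2)
      · have a1 := (h.mem_iff _ (h.subset h1)).1 h1 _ h2
        have a2 := (h.mem_iff _ (h.subset h2)).1 h2 _ h1
        simp only [Beats, or_true, and_true, not_lt] at a1 a2
        exact hT.blue y (h.subset h1).2 x (h.subset h1).1 x' (h.subset h2).1 (le_antisymm a1 a2)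
    refine ⟨hp, fun x hx y hy hlt => ?_⟩
    rw [lt_min_iff] at hlt
    have hn : (x, y) ∉ m := fun hm => by rw [hp.redDist_eq hm] at hlt; exact lt_irrefl _ hlt.1
    rw [h.mem_iff (x, y) ⟨hx, hy⟩] at hn
    push Not at hn
    obtain ⟨⟨x', y'⟩, hf, hd, rfl | rfl⟩ := hn
    · have := hlt.1
      rw [hp.redDist_eq hf, edist_lt_edist_iff] at this
      exact lt_asymm this hd
    · have := hlt.2
      rw [hp.blueDist_eq hf, edist_lt_edist_iff] at this
      exact lt_asymm this hd

lemma LocFinite.finite_dist_le (hV : LocFinite V) (x : Space d) (r : ℝ) :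
    {y | y ∈ V ∧ dist x y ≤ r}.Finite := by
  refine (hV _ (isCompact_closedBall x r)).subset fun y hy => ⟨hy.1, ?_⟩
  rw [Metric.mem_closedBall, dist_comm]; exact hy.2

lemma LocFinite.exists_argmin (hV : LocFinite V) {T : Set (Space d)} (hT : T ⊆ V)
    (hne : T.Nonempty) (x : Space d) : ∃ y ∈ T, ∀ y' ∈ T, dist x y ≤ dist x y' := by
  obtain ⟨y0, hy0⟩ := hne
  have hfin : (T ∩ {y | dist x y ≤ dist x y0}).Finite :=
    (hV.finite_dist_le x (dist x y0)).subset fun y hy => ⟨hT hy.1, hy.2⟩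
  obtain ⟨y, hy, hmin⟩ := hfin.exists_minimalFor (dist x) _ ⟨y0, hy0, le_refl (dist x y0)⟩
  refine ⟨y, hy.1, fun y' hy' => ?_⟩
  by_contra! hlt
  exact absurd (hmin ⟨hy', hlt.le.trans hy.2⟩ hlt.le) (not_le.2 hlt)

/-- The induction principle for `Beats`. If every pair of `S` were beaten within `S`, moving
alternately to the nearest neighbor in `S` would produce a forbidden descending path. -/
lemma exists_unbeaten (hU : LocFinite U) (hV : LocFinite V) (hC : NoChain U V)
    {S : Set (Space d × Space d)} (hS : S ⊆ U ×ˢ V) (hne : S.Nonempty) :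
    ∃ e ∈ S, ∀ f ∈ S, ¬ Beats f e := by
  by_contra! hb
  have hY : ∀ x, ∃ y, (∃ y', (x, y') ∈ S) → (x, y) ∈ S ∧ ∀ y', (x, y') ∈ S → dist x y ≤ dist x y' := by
    intro x
    by_cases h : ∃ y', (x, y') ∈ S
    · obtain ⟨y, hy, hm⟩ := hV.exists_argmin (T := {y | (x, y) ∈ S}) (fun y hy => (hS hy).2) h x
      exact ⟨y, fun _ => ⟨hy, hm⟩⟩
    -- Arbitrary value at points without an edge in `S`.
    · exact ⟨0, fun h' => absurd h' h⟩
  have hX : ∀ y, ∃ x, (∃ x', (x', y) ∈ S) → (x, y) ∈ S ∧ ∀ x', (x', y) ∈ S → dist x y ≤ dist x' y := by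
    intro y
    by_cases h : ∃ x', (x', y) ∈ S
    · obtain ⟨x, hx, hm⟩ := hU.exists_argmin (T := {x | (x, y) ∈ S}) (fun x hx => (hS hx).1) h y
      exact ⟨x, fun _ => ⟨hx, fun x' hx' => by rw [dist_comm, dist_comm x']; exact hm x' hx'⟩⟩
    · exact ⟨0, fun h' => absurd h' h⟩
  choose Y hY using hY
  choose X hX using hX
  obtain ⟨⟨x0, y0⟩, h0⟩ := hne
  let x : ℕ → Space d := fun n => (fun z => X (Y z))^[n] x0
  have hxs : ∀ n, x (n + 1) = X (Y (x n)) := fun n => Function.iterate_succ_apply' _ _ _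
  have hS0 : ∀ n, (x n, Y (x n)) ∈ S := by
    intro n
    induction n with
    | zero => exact (hY x0 ⟨y0, h0⟩).1
    | succ n ih =>
      have := (hX (Y (x n)) ⟨_, ih⟩).1
      rw [← hxs] at this
      exact (hY _ ⟨_, this⟩).1
  have hS1 : ∀ n, (x (n + 1), Y (x n)) ∈ S := fun n => by
    rw [hxs]; exact (hX (Y (x n)) ⟨_, hS0 n⟩).1
  have hl1 : ∀ n, dist (x (n + 1)) (Y (x n)) < dist (x n) (Y (x n)) := by
    intro n
    -- The edge to `Y (x n)` is a shortest one at its red end, so only an edge at its blue end can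
    -- beat it; for the return edge the roles are exchanged.
    obtain ⟨⟨x', y'⟩, hf, hd, rfl | rfl⟩ := hb _ (hS0 n)
    · exact absurd ((hY _ ⟨_, hS0 n⟩).2 _ hf) (not_le.2 hd)
    · rw [hxs]
      exact ((hX _ ⟨_, hS0 n⟩).2 _ hf).trans_lt hd
  have hl2 : ∀ n, dist (x (n + 1)) (Y (x (n + 1))) < dist (x (n + 1)) (Y (x n)) := by
    intro n
    obtain ⟨⟨x', y'⟩, hf, hd, rfl | rfl⟩ := hb _ (hS1 n)
    · exact ((hY _ ⟨_, hS1 n⟩).2 _ hf).trans_lt hd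
    · refine absurd ((hX _ ⟨_, hS0 n⟩).2 _ hf) (not_le.2 ?_)
      rwa [← hxs]
  have hanti : StrictAnti fun n => dist (x n) (Y (x n)) :=
    strictAnti_nat_of_succ_lt fun n => (hl2 n).trans (hl1 n)
  -- The red point determines the length of its outgoing edge, and these lengths strictly decrease.
  have hxi : x.Injective := fun i j hij => hanti.injective (by simp only [hij])
  refine hC ⟨x, fun n => Y (x n), fun i => (hS (hS0 i)).1, fun i => (hS (hS0 i)).2, hxi, ?_, hl1, hl2⟩
  intro i j hij
  have : x (i + 1) = x (j + 1) := by rw [hxs, hxs]; exact congrArg X hij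
  exact Nat.succ_injective (hxi this)

/-- At an unbeaten pair among those where the two kernels differ, all pairs beating it are treated
alike by both, and these decide its membership. -/
lemma IsBeatKernel.unique (hU : LocFinite U) (hV : LocFinite V) (hC : NoChain U V)
    {m m' : Set (Space d × Space d)} (h : IsBeatKernel U V m) (h' : IsBeatKernel U V m') :
    m = m' := by
  by_contra hne
  obtain ⟨e, he, hmin⟩ := exists_unbeaten hU hV hC (S := {e ∈ U ×ˢ V | ¬ (e ∈ m ↔ e ∈ m')})
    (fun e he => he.1) (by
      by_contra hemp
      rw [not_nonempty_iff_eq_empty] at hemp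
      refine hne (Set.ext fun e => ?_)
      by_contra hx
      have : e ∈ {e ∈ U ×ˢ V | ¬ (e ∈ m ↔ e ∈ m')} := by
        refine ⟨?_, hx⟩
        by_cases h1 : e ∈ m
        · exact h.subset h1
        · by_cases h2 : e ∈ m'
          · exact h'.subset h2
          · exact absurd (iff_of_false h1 h2) hx
      rw [hemp] at this
      exact this)
  refine he.2 ?_
  rw [h.mem_iff e he.1, h'.mem_iff e he.1]
  constructor
  · intro hf f hfm hb
    refine hmin f ⟨h'.subset hfm, fun hiff => hf f (hiff.2 hfm) hb⟩ hb
  · intro hf f hfm hb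
    refine hmin f ⟨h.subset hfm, fun hiff => hf f (hiff.1 hfm) hb⟩ hb

/-- The edges beaten by an edge of `A`, in terms of counting measures `π` and `ρ` of the red and the
blue points. -/
def beatenBy (π ρ : Measure (Space d)) (A : Set (Space d × Space d)) : Set (Space d × Space d) :=
  {e | ρ {y | dist e.1 y < dist e.1 e.2 ∧ (e.1, y) ∈ A} ≠ 0 ∨
    π {x | dist x e.2 < dist e.1 e.2 ∧ (x, e.2) ∈ A} ≠ 0}

/-- The edges selected in the first `n` rounds: an edge is selected once all edges that beat it are
beaten by edges selected before. -/
def selected (π ρ : Measure (Space d)) : ℕ → Set (Space d × Space d)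
  | 0 => ∅
  | n + 1 => (beatenBy π ρ (beatenBy π ρ (selected π ρ n))ᶜ)ᶜ

variable {π ρ : Measure (Space d)}

/-- Translates between points and non-null sets. Phrasing `beatenBy` by null sets is what later
makes the selection measurable in the configuration. -/
lemma mem_beatenBy_iff (hπ : ∀ p : Space d → Prop, π {x | p x} = 0 ↔ ∀ x ∈ U, ¬ p x)
    (hρ : ∀ p : Space d → Prop, ρ {x | p x} = 0 ↔ ∀ x ∈ V, ¬ p x)
    {A : Set (Space d × Space d)} {e : Space d × Space d} (he : e ∈ U ×ˢ V) :
    e ∈ beatenBy π ρ A ↔ ∃ f ∈ U ×ˢ V, f ∈ A ∧ Beats f e := by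
  obtain ⟨x, y⟩ := e
  simp only [beatenBy, mem_ofPred_eq, Ne, hπ, hρ]
  push Not
  constructor
  · rintro (⟨y', hy', hd, hA⟩ | ⟨x', hx', hd, hA⟩)
    · exact ⟨(x, y'), ⟨he.1, hy'⟩, hA, hd, Or.inl rfl⟩
    · exact ⟨(x', y), ⟨hx', he.2⟩, hA, hd, Or.inr rfl⟩
  · rintro ⟨⟨x', y'⟩, hf, hA, hd, rfl | rfl⟩
    · exact Or.inl ⟨y', hf.2, hd, hA⟩
    · exact Or.inr ⟨x', hf.1, hd, hA⟩

lemma beatenBy_mono {A A' : Set (Space d × Space d)} (h : A ⊆ A') :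
    beatenBy π ρ A ⊆ beatenBy π ρ A' := by
  rintro e (he | he)
  · exact Or.inl fun h0 => he (measure_mono_null (by gcongr) h0)
  · exact Or.inr fun h0 => he (measure_mono_null (by gcongr) h0)

/-- Each round applies the order-reversing map `A ↦ (beatenBy π ρ A)ᶜ` twice, starting from the
empty set. -/
lemma selected_mono : Monotone (selected π ρ) := by
  refine monotone_nat_of_le_succ fun n => ?_
  induction n with
  | zero => exact empty_subset _
  | succ n ih =>
    exact compl_subset_compl.2 (beatenBy_mono (compl_subset_compl.2 (beatenBy_mono ih)))

lemma finite_beats (hU : LocFinite U) (hV : LocFinite V) (e : Space d × Space d) :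
    {f | f ∈ U ×ˢ V ∧ Beats f e}.Finite := by
  refine (((finite_singleton e.1).prod (hV.finite_dist_le e.1 (dist e.1 e.2))).union
    ((hU.finite_dist_le e.2 (dist e.1 e.2)).prod (finite_singleton e.2))).subset ?_
  rintro ⟨x, y⟩ ⟨⟨hx, hy⟩, hd, h | h⟩
  · simp only at h hd
    subst h
    exact Or.inl ⟨rfl, hy, hd.le⟩
  · simp only at h hd
    subst h
    exact Or.inr ⟨⟨hx, by rw [dist_comm]; exact hd.le⟩, rfl⟩

/-- By induction along `Beats`, every pair is eventually either selected or beaten by a selected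
pair, and never both. This dichotomy is the kernel property. -/
lemma isBeatKernel_selected (hU : LocFinite U) (hV : LocFinite V) (hC : NoChain U V)
    (hπ : ∀ p : Space d → Prop, π {x | p x} = 0 ↔ ∀ x ∈ U, ¬ p x)
    (hρ : ∀ p : Space d → Prop, ρ {x | p x} = 0 ↔ ∀ x ∈ V, ¬ p x) :
    IsBeatKernel U V {e ∈ U ×ˢ V | ∃ n, e ∈ selected π ρ n} := by
  have hsel : ∀ n, ∀ e ∈ U ×ˢ V, e ∈ selected π ρ (n + 1) →
      ∀ f ∈ U ×ˢ V, Beats f e → f ∈ beatenBy π ρ (selected π ρ n) := by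
    intro n e he h f hf hb
    by_contra hc
    exact h ((mem_beatenBy_iff hπ hρ he).2 ⟨f, hf, hc, hb⟩)
  -- If a selected `e` is beaten by a selected `f`, then the selection of `e` requires `f` to be
  -- beaten by a selected pair as well; so `f` is a counterexample that beats `e`.
  have hdisj : ∀ e ∈ U ×ˢ V, ∀ n k, e ∈ selected π ρ n → e ∉ beatenBy π ρ (selected π ρ k) := by
    by_contra! hcon
    obtain ⟨e0, he0, n0, k0, h1, h2⟩ := hcon
    obtain ⟨e, ⟨he, n, k, hn, hk⟩, hmin⟩ := exists_unbeaten hU hV hC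
      (S := {e | e ∈ U ×ˢ V ∧ ∃ n k, e ∈ selected π ρ n ∧ e ∈ beatenBy π ρ (selected π ρ k)})
      (fun e he => he.1) ⟨e0, he0, n0, k0, h1, h2⟩
    obtain ⟨f, hf, hfs, hb⟩ := (mem_beatenBy_iff hπ hρ he).1 hk
    cases n with
    | zero => exact hn
    | succ n => exact hmin f ⟨hf, k, n, hfs, hsel n e he hn f hf hb⟩ hb
  -- For an unbeaten undecided pair, all pairs beating it are decided, and none of them is selected.
  have hdec : ∀ e ∈ U ×ˢ V, (∃ n, e ∈ selected π ρ n) ∨ ∃ n, e ∈ beatenBy π ρ (selected π ρ n) := by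
    by_contra! hcon
    obtain ⟨e0, he0, h0⟩ := hcon
    obtain ⟨e, ⟨he, hn1, hn2⟩, hmin⟩ := exists_unbeaten hU hV hC
      (S := {e | e ∈ U ×ˢ V ∧ (∀ n, e ∉ selected π ρ n) ∧ ∀ n, e ∉ beatenBy π ρ (selected π ρ n)})
      (fun e he => he.1) ⟨e0, he0, h0⟩
    have hall : ∀ f ∈ {f | f ∈ U ×ˢ V ∧ Beats f e}, ∃ n, f ∈ beatenBy π ρ (selected π ρ n) := by
      rintro f ⟨hf, hb⟩
      by_contra! hc
      refine hmin f ⟨hf, fun n hn => ?_, hc⟩ hb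
      exact hn2 n ((mem_beatenBy_iff hπ hρ he).2 ⟨f, hf, hn, hb⟩)
    -- Only finitely many pairs beat `e`, so one round `B` has excluded all of them and `e` is
    -- selected in the next one.
    choose! N hN using hall
    obtain ⟨B, hB⟩ := ((finite_beats hU hV e).image N).bddAbove
    refine hn1 (B + 1) fun hmem => ?_
    obtain ⟨f, hf, hfc, hb⟩ := (mem_beatenBy_iff hπ hρ he).1 hmem
    exact hfc (beatenBy_mono (selected_mono (hB ⟨f, ⟨hf, hb⟩, rfl⟩)) (hN f ⟨hf, hb⟩))
  refine ⟨fun e he => he.1, fun e he => ⟨?_, ?_⟩⟩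
  · rintro ⟨_, n, hn⟩ f ⟨hf, k, hk⟩ hb
    exact hdisj e he n k hn ((mem_beatenBy_iff hπ hρ he).2 ⟨f, hf, hk, hb⟩)
  · intro h
    refine ⟨he, (hdec e he).resolve_right ?_⟩
    rintro ⟨n, hn⟩
    obtain ⟨f, hf, hfs, hb⟩ := (mem_beatenBy_iff hπ hρ he).1 hn
    exact h f ⟨hf, n, hfs⟩ hb

/-- The stable matching of two locally finite sets in general position. -/
theorem isStableMatching_iff_eq_selected (hU : LocFinite U) (hV : LocFinite V) (hT : NoTies U V)
    (hC : NoChain U V) (hπ : ∀ p : Space d → Prop, π {x | p x} = 0 ↔ ∀ x ∈ U, ¬ p x)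
    (hρ : ∀ p : Space d → Prop, ρ {x | p x} = 0 ↔ ∀ x ∈ V, ¬ p x) :
    IsStableMatching U V m ↔ m = {e ∈ U ×ˢ V | ∃ n, e ∈ selected π ρ n} := by
  have hk := isBeatKernel_selected hU hV hC hπ hρ
  rw [isStableMatching_iff hT]
  exact ⟨fun h => h.unique hU hV hC hk, fun h => h ▸ hk⟩

end Deterministic


/-! ### Counting measures -/

section Counting

variable {d : ℕ}

lemma LocFinite.inter_closedBall {S : Set (Space d)} (h : LocFinite S) (n : ℝ) :
    (S ∩ Metric.closedBall 0 n).Finite := h _ (isCompact_closedBall 0 n)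

lemma LocFinite.countable {S : Set (Space d)} (h : LocFinite S) : S.Countable := by
  have : S = ⋃ n : ℕ, S ∩ Metric.closedBall 0 n := by
    rw [← inter_iUnion, Metric.iUnion_closedBall_nat, inter_univ]
  rw [this]
  exact countable_iUnion fun n => (h.inter_closedBall n).countable

lemma LocFinite.mono {S T : Set (Space d)} (h : LocFinite S) (hTS : T ⊆ S) : LocFinite T :=
  fun K hK => (h K hK).subset (by gcongr)

lemma LocFinite.union {S T : Set (Space d)} (h : LocFinite S) (h' : LocFinite T) :
    LocFinite (S ∪ T) := fun K hK => by
  rw [union_inter_distrib_right]; exact (h K hK).union (h' K hK)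

/-- `π` is the counting measure of a locally finite set. -/
def IsCounting (π : Measure (Space d)) : Prop :=
  ∃ S : Set (Space d), LocFinite S ∧ π = Measure.count.restrict S

/-- No measurability of `A` is needed, because `S ∩ A` is countable. -/
lemma LocFinite.count_restrict_apply {S : Set (Space d)} (h : LocFinite S) (A : Set (Space d)) :
    Measure.count.restrict S A = ((S ∩ A).encard : ℝ≥0∞) := by
  rw [Measure.restrict_apply' h.countable.measurableSet, inter_comm,
    Measure.count_apply (h.countable.mono inter_subset_left).measurableSet]

lemma LocFinite.support_eq {S : Set (Space d)} (h : LocFinite S) :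
    support (Measure.count.restrict S) = S := by
  ext x
  simp only [support, mem_ofPred_eq, h.count_restrict_apply]
  by_cases hx : x ∈ S
  · rw [inter_eq_right.2 (singleton_subset_iff.2 hx)]; simp [hx]
  · rw [inter_singleton_eq_empty.2 hx]; simp [hx]

variable {π : Measure (Space d)}

lemma IsCounting.locFinite (h : IsCounting π) : LocFinite (support π) := by
  obtain ⟨S, hS, rfl⟩ := h; rwa [hS.support_eq]

lemma IsCounting.eq (h : IsCounting π) : π = Measure.count.restrict (support π) := by
  obtain ⟨S, hS, rfl⟩ := h; rw [hS.support_eq]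

lemma IsCounting.apply (h : IsCounting π) (A : Set (Space d)) :
    π A = ((support π ∩ A).encard : ℝ≥0∞) := by
  conv_lhs => rw [h.eq]
  exact h.locFinite.count_restrict_apply A

lemma IsCounting.null_iff (h : IsCounting π) (p : Space d → Prop) :
    π {x | p x} = 0 ↔ ∀ x ∈ support π, ¬ p x := by
  rw [h.apply]
  simp [eq_empty_iff_forall_notMem]

lemma IsCounting.restrict (h : IsCounting π) {C : Set (Space d)} (hC : MeasurableSet C) :
    IsCounting (π.restrict C) ∧ support (π.restrict C) = support π ∩ C := by
  have hl := h.locFinite.mono (inter_subset_left (t := C))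
  have : π.restrict C = Measure.count.restrict (support π ∩ C) := by
    conv_lhs => rw [h.eq]
    rw [Measure.restrict_restrict hC, inter_comm]
  exact ⟨⟨_, hl, this⟩, by rw [this, hl.support_eq]⟩

lemma IsCounting.add {π' : Measure (Space d)} (h : IsCounting π) (h' : IsCounting π')
    (hd : Disjoint (support π) (support π')) :
    IsCounting (π + π') ∧ support (π + π') = support π ∪ support π' := by
  have hl := h.locFinite.union h'.locFinite
  have : π + π' = Measure.count.restrict (support π ∪ support π') := by
    conv_lhs => rw [h.eq, h'.eq]
    rw [Measure.restrict_union hd h'.locFinite.countable.measurableSet]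
  exact ⟨⟨_, hl, this⟩, by rw [this, hl.support_eq]⟩

lemma IsCounting.map_add (h : IsCounting π) (t : Space d) :
    IsCounting (π.map (· + t)) ∧ support (π.map (· + t)) = (· + t) '' support π := by
  have hl : LocFinite ((· + t) '' support π) := by
    intro K hK
    have h1 := (h.locFinite ((Homeomorph.addRight t) ⁻¹' K)
      ((Homeomorph.addRight t).isCompact_preimage.2 hK)).image (· + t)
    refine h1.subset ?_
    rintro _ ⟨⟨x, hx, rfl⟩, hxK⟩
    exact ⟨x, ⟨hx, hxK⟩, rfl⟩
  have : π.map (· + t) = Measure.count.restrict ((· + t) '' support π) := by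
    ext A hA
    rw [Measure.map_apply (measurable_add_const t) hA, h.apply, hl.count_restrict_apply,
      image_inter_preimage _ _ _ |>.symm, (add_left_injective t).encard_image]
  exact ⟨⟨_, hl, this⟩, by rw [this, hl.support_eq]⟩

end Counting

/-! ### Random measures are determined by their values on sets of finite volume -/

/-- Borel sets of finite volume. -/
abbrev FinVol (d : ℕ) : Type := {A : Set (Space d) // MeasurableSet A ∧ volume A ≠ ∞}

/-- The values of a measure on the sets of finite volume. -/
def evals {d : ℕ} (π : Measure (Space d)) : FinVol d → ℝ≥0∞ := fun A => π A.1

section Evals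

variable {d : ℕ}

lemma measurable_evals : Measurable (evals (d := d)) :=
  measurable_pi_lambda _ fun A => Measure.measurable_coe A.2.1

/-- The value at any Borel set is the sum of the values at its intersections with disjoint bounded
shells. This bridges to the definition of the Poisson process, which fixes one-set laws only for
finite volume. -/
lemma comap_evals : MeasurableSpace.comap (evals (d := d)) inferInstance =
    (Measure.instMeasurableSpace : MeasurableSpace (Measure (Space d))) := by
  refine le_antisymm measurable_evals.comap_le ?_
  have : Measurable[MeasurableSpace.comap (evals (d := d)) inferInstance]
      (id : Measure (Space d) → Measure (Space d)) := by
    let _ := MeasurableSpace.comap (evals (d := d)) inferInstance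
    refine @Measure.measurable_of_measurable_coe _ _ _ (_) _ fun A hA => ?_
    let B : ℕ → Set (Space d) := disjointed fun n : ℕ => Metric.ball (0 : Space d) n
    have hB : ∀ n, MeasurableSet (B n) := MeasurableSet.disjointed fun n => measurableSet_ball
    have hU : ⋃ n, B n = univ := by rw [iUnion_disjointed, Metric.iUnion_ball_nat]
    have : (fun π : Measure (Space d) => id π A) = fun π => ∑' n, π (A ∩ B n) := by
      funext π
      rw [← measure_iUnion (fun i j hij => ((disjoint_disjointed _ hij).mono
        inter_subset_right inter_subset_right)) (fun n => hA.inter (hB n)), ← inter_iUnion, hU,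
        inter_univ, id]
    rw [this]
    refine Measurable.tsum fun n => ?_
    have hv : volume (A ∩ B n) ≠ ∞ := ((measure_mono (inter_subset_right.trans
      (disjointed_subset _ n))).trans_lt measure_ball_lt_top).ne
    exact (measurable_pi_apply (⟨A ∩ B n, hA.inter (hB n), hv⟩ : FinVol d)).comp
      (comap_measurable evals)
  intro s hs
  exact this hs

lemma ext_of_map_evals {μ μ' : Measure (Measure (Space d))}
    (h : μ.map evals = μ'.map evals) : μ = μ' := by
  ext s hs
  have hs' : MeasurableSet[MeasurableSpace.comap (evals (d := d)) inferInstance] s := by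
    rw [comap_evals]; exact hs
  obtain ⟨t, ht, rfl⟩ := hs'
  rw [← Measure.map_apply measurable_evals ht, h, Measure.map_apply measurable_evals ht]

lemma indepFun_of_evals {Ω : Type*} [MeasurableSpace Ω] {P : Measure Ω}
    {X Y : Ω → Measure (Space d)}
    (h : IndepFun (fun ω => evals (X ω)) (fun ω => evals (Y ω)) P) : IndepFun X Y P := by
  rw [IndepFun_iff_Indep] at h ⊢
  rw [← comap_evals, MeasurableSpace.comap_comp, MeasurableSpace.comap_comp]
  exact h

/-- The atom of the algebra generated by the sets `A i` that contains the points with membership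
pattern `b`. -/
def atomOf {ι : Type*} (A : ι → Set (Space d)) (b : ι → Prop) : Set (Space d) :=
  {x | ∀ i, x ∈ A i ↔ b i}

lemma measurableSet_atomOf {ι : Type*} [Countable ι] {A : ι → Set (Space d)}
    (hA : ∀ i, MeasurableSet (A i)) (b : ι → Prop) : MeasurableSet (atomOf A b) := by
  have : atomOf A b = ⋂ i, {x | x ∈ A i ↔ b i} := by ext; simp [atomOf]
  rw [this]
  refine MeasurableSet.iInter fun i => ?_
  by_cases hb : b i
  · simpa [hb] using hA i
  · simp only [hb, iff_false]; exact (hA i).compl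

lemma disjoint_atomOf {ι : Type*} {A : ι → Set (Space d)} {b b' : ι → Prop} (h : b ≠ b') :
    Disjoint (atomOf A b) (atomOf A b') := by
  rw [Set.disjoint_left]
  intro x hx hx'
  exact h (funext fun i => propext ((hx i).symm.trans (hx' i)))

-- Values at overlapping sets are linear functions of values at disjoint atoms, the only ones for
-- which the Poisson axioms give joint laws.
open Classical in
lemma measure_eq_sum_atomOf {ι : Type*} [Fintype ι] {A : ι → Set (Space d)}
    (hA : ∀ i, MeasurableSet (A i)) {E : Set (Space d)} (hE : MeasurableSet E)
    (π : Measure (Space d)) (i : ι) :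
    π (A i ∩ E) = ∑ b : ι → Prop, if b i then π (atomOf A b ∩ E) else 0 := by
  have : A i ∩ E = ⋃ b ∈ Finset.univ.filter (fun b : ι → Prop => b i), atomOf A b ∩ E := by
    ext x
    simp only [mem_inter_iff, Finset.mem_filter, Finset.mem_univ, true_and, mem_iUnion,
      exists_prop]
    constructor
    · rintro ⟨h1, h2⟩
      exact ⟨fun j => x ∈ A j, h1, fun j => Iff.rfl, h2⟩
    · rintro ⟨b, hb, h1, h2⟩
      exact ⟨(h1 i).2 hb, h2⟩
  rw [this, measure_biUnion_finset, Finset.sum_filter]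
  · intro b _ b' _ hbb
    exact (disjoint_atomOf hbb).mono inter_subset_left inter_subset_left
  · exact fun b _ => (measurableSet_atomOf hA b).inter hE

end Evals

/-! ### Poisson processes -/

section Poisson

variable {d : ℕ} {Ω : Type*} [MeasurableSpace Ω] {P : Measure Ω} {R B : Ω → Measure (Space d)}

lemma IsUnitPoissonProcess.measurable (h : IsUnitPoissonProcess P R) : Measurable R :=
  h.simple.measurable

lemma IsUnitPoissonProcess.measurable_apply (h : IsUnitPoissonProcess P R) {A : Set (Space d)}
    (hA : MeasurableSet A) : Measurable fun ω => R ω A :=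
  (Measure.measurable_coe hA).comp h.measurable

lemma IsUnitPoissonProcess.ae_isCounting (h : IsUnitPoissonProcess P R) :
    ∀ᵐ ω ∂P, IsCounting (R ω) := h.simple.counting

lemma IsUnitPoissonProcess.iIndepFun_of_fintype (h : IsUnitPoissonProcess P R) {ι : Type*}
    [Fintype ι] {A : ι → Set (Space d)} (hA : ∀ i, MeasurableSet (A i))
    (hd : Pairwise fun i j => Disjoint (A i) (A j)) : iIndepFun (fun i ω => R ω (A i)) P := by
  let e := Fintype.equivFin ι
  have := h.indep (Fintype.card ι) (fun k => A (e.symm k)) (fun k => hA _)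
    (fun i j hij => hd (e.symm.injective.ne hij))
  have h2 := this.precomp (g := e) e.injective
  simpa using h2

lemma IsUnitPoissonProcess.map_pi_eq [IsProbabilityMeasure P] (h : IsUnitPoissonProcess P R)
    {ι : Type*} [Fintype ι] {A : ι → Set (Space d)} (hA : ∀ i, MeasurableSet (A i))
    (hd : Pairwise fun i j => Disjoint (A i) (A j)) (hv : ∀ i, volume (A i) ≠ ∞) :
    P.map (fun ω i => R ω (A i)) = Measure.pi fun i =>
      (poissonMeasure (volume (A i)).toNNReal).map (fun n : ℕ => (n : ℝ≥0∞)) := by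
  rw [(iIndepFun_iff_map_fun_eq_pi_map fun i => (h.measurable_apply (hA i)).aemeasurable).1
    (h.iIndepFun_of_fintype hA hd)]
  congr 1
  funext i
  exact h.law _ (hA i) (hv i)

/-- Two unit Poisson processes have the same law. -/
theorem IsUnitPoissonProcess.map_eq [IsProbabilityMeasure P] (h : IsUnitPoissonProcess P R)
    {Ω' : Type*} [MeasurableSpace Ω'] {P' : Measure Ω'} [IsProbabilityMeasure P']
    {R' : Ω' → Measure (Space d)} (h' : IsUnitPoissonProcess P' R') : P.map R = P'.map R' := by
  classical
  refine ext_of_map_evals ?_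
  have key : ∀ I : Finset (FinVol d),
      P.map (fun ω (i : I) => R ω i.1.1) = P'.map (fun ω (i : I) => R' ω i.1.1) := by
    intro I
    let A : I → Set (Space d) := fun i => i.1.1
    have hA : ∀ i, MeasurableSet (A i) := fun i => i.1.2.1
    let E : Set (Space d) := ⋃ i, A i
    have hE : MeasurableSet E := MeasurableSet.iUnion hA
    have hvE : volume E ≠ ∞ := by
      refine ((measure_iUnion_le _).trans_lt ?_).ne
      rw [tsum_fintype]
      exact ENNReal.sum_lt_top.2 fun i _ => i.1.2.2.lt_top
    let T : (I → Prop) → Set (Space d) := fun b => atomOf A b ∩ E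
    have hT : ∀ b, MeasurableSet (T b) := fun b => (measurableSet_atomOf hA b).inter hE
    have hTd : Pairwise fun b b' => Disjoint (T b) (T b') := fun b b' hb =>
      (disjoint_atomOf hb).mono inter_subset_left inter_subset_left
    have hTv : ∀ b, volume (T b) ≠ ∞ := fun b =>
      ((measure_mono inter_subset_right).trans_lt hvE.lt_top).ne
    -- The linear map that recovers the values at the sets of `I` from those at the atoms.
    let g : ((I → Prop) → ℝ≥0∞) → I → ℝ≥0∞ := fun v i => ∑ b, if b i then v b else 0
    have hg : Measurable g := by
      refine measurable_pi_lambda _ fun i => Finset.measurable_sum _ fun b _ => ?_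
      by_cases hb : b i
      · simpa [hb] using measurable_pi_apply b
      · simp [hb]
    have hgπ : ∀ π : Measure (Space d), (fun i : I => π i.1.1) = g fun b => π (T b) := by
      intro π
      funext i
      have := measure_eq_sum_atomOf hA hE π i
      rw [inter_eq_left.2 (subset_iUnion A i)] at this
      convert! this
    have w1 : (fun ω (i : I) => R ω i.1.1) = fun ω => g fun b => R ω (T b) :=
      funext fun ω => hgπ (R ω)
    have w2 : (fun ω (i : I) => R' ω i.1.1) = fun ω => g fun b => R' ω (T b) :=
      funext fun ω => hgπ (R' ω)
    rw [w1, w2]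
    have e1 := Measure.map_map (μ := P) hg
      (measurable_pi_lambda _ fun b => h.measurable_apply (hT b))
    have e2 := Measure.map_map (μ := P') hg
      (measurable_pi_lambda _ fun b => h'.measurable_apply (hT b))
    simp only [Function.comp_def] at e1 e2
    rw [← e1, ← e2, h.map_pi_eq hT hTd hTv, h'.map_pi_eq hT hTd hTv]
  have hfin : ∀ I : Finset (FinVol d), IsFiniteMeasure (P.map fun ω (i : I) => R ω i.1.1) :=
    fun I => inferInstance
  have c1 : ∀ {Ω' : Type _} [MeasurableSpace Ω'] (P' : Measure Ω') {R' : Ω' → Measure (Space d)},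
      Measurable R' → ∀ I : Finset (FinVol d), ((P'.map R').map evals).map I.restrict =
        P'.map fun ω (i : I) => R' ω i.1.1 := by
    intro Ω' _ P' R' hR' I
    rw [Measure.map_map measurable_evals hR',
      Measure.map_map (Finset.measurable_restrict I) (measurable_evals.comp hR')]
    rfl
  -- Equal finite-dimensional distributions determine the law on the full product.
  refine IsProjectiveLimit.unique (P := fun I : Finset (FinVol d) =>
    P.map fun ω (i : I) => R ω i.1.1) (fun I => c1 P h.measurable I) (fun I => ?_)
  rw [Measure.map_map measurable_evals h'.measurable,
      Measure.map_map (Finset.measurable_restrict I) (measurable_evals.comp h'.measurable)]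
  exact (key I).symm

/-- A random counting measure with the law of a unit Poisson process is a unit Poisson process. -/
theorem IsUnitPoissonProcess.of_map_eq [IsProbabilityMeasure P] (h : IsUnitPoissonProcess P R)
    {Ω' : Type*} [MeasurableSpace Ω'] {P' : Measure Ω'} [IsProbabilityMeasure P']
    {R' : Ω' → Measure (Space d)} (hm : Measurable R') (hc : ∀ᵐ ω ∂P', IsCounting (R' ω))
    (he : P'.map R' = P.map R) : IsUnitPoissonProcess P' R' := by
  refine ⟨⟨hm, hc⟩, fun A hA hv => ?_, fun n A hA hd => ?_⟩
  · rw [← h.law A hA hv]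
    have e1 := Measure.map_map (μ := P') (Measure.measurable_coe hA) hm
    have e2 := Measure.map_map (μ := P) (Measure.measurable_coe hA) h.measurable
    rw [he] at e1
    exact e1.symm.trans e2
  · have hme : Measurable fun (π : Measure (Space d)) (i : Fin n) => π (A i) :=
      measurable_pi_lambda _ fun i => Measure.measurable_coe (hA i)
    have e1 := Measure.map_map (μ := P') hme hm
    have e2 := Measure.map_map (μ := P) hme h.measurable
    have e3 : ∀ i, P'.map (fun ω => R' ω (A i)) = P.map fun ω => R ω (A i) := by
      intro i
      have e1 := Measure.map_map (μ := P') (Measure.measurable_coe (hA i)) hm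
      have e2 := Measure.map_map (μ := P) (Measure.measurable_coe (hA i)) h.measurable
      rw [he] at e1
      exact e1.symm.trans e2
    have hm' : ∀ i, Measurable fun ω => R' ω (A i) := fun i =>
      (Measure.measurable_coe (hA i)).comp hm
    rw [iIndepFun_iff_map_fun_eq_pi_map fun i => (hm' i).aemeasurable]
    simp_rw [e3]
    rw [← (iIndepFun_iff_map_fun_eq_pi_map fun i => (h.measurable_apply (hA i)).aemeasurable).1
      (h.indep n A hA hd)]
    rw [he] at e1
    exact e1.symm.trans e2

lemma measurable_map_add (t : Space d) :
    Measurable fun π : Measure (Space d) => π.map (· + t) :=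
  Measure.measurable_map _ (measurable_add_const t)

lemma IsUnitPoissonProcess.map_add (h : IsUnitPoissonProcess P R) (t : Space d) :
    IsUnitPoissonProcess P fun ω => (R ω).map (· + t) := by
  have hm := measurable_add_const t
  refine ⟨⟨(measurable_map_add t).comp h.measurable, ?_⟩, fun A hA hv => ?_, fun n A hA hd => ?_⟩
  · filter_upwards [h.ae_isCounting] with ω hω using (hω.map_add t).1
  · simp_rw [Measure.map_apply hm hA]
    have hv' : volume ((· + t) ⁻¹' A) = volume A := measure_preimage_add_right _ _ _
    rw [← hv'] at hv ⊢
    exact h.law _ (hm hA) hv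
  · simp_rw [fun i ω => Measure.map_apply (μ := R ω) hm (hA i)]
    exact h.indep n _ (fun i => hm (hA i)) fun i j hij => (hd hij).preimage _

lemma measurable_restrict {C : Set (Space d)} (hC : MeasurableSet C) :
    Measurable fun π : Measure (Space d) => π.restrict C := by
  refine Measure.measurable_of_measurable_coe _ fun A hA => ?_
  simp_rw [Measure.restrict_apply hA]
  exact Measure.measurable_coe (hA.inter hC)

/-- The restrictions of a Poisson process to disjoint sets are independent. -/
theorem IsUnitPoissonProcess.indepFun_restrict [IsProbabilityMeasure P]
    (h : IsUnitPoissonProcess P R) {C D : Set (Space d)} (hC : MeasurableSet C)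
    (hD : MeasurableSet D) (hCD : Disjoint C D) :
    IndepFun (fun ω => (R ω).restrict C) (fun ω => (R ω).restrict D) P := by
  classical
  refine indepFun_of_evals ?_
  have hmC : ∀ A : FinVol d, Measurable fun ω => (R ω).restrict C A.1 := fun A =>
    (Measure.measurable_coe A.2.1).comp ((measurable_restrict hC).comp h.measurable)
  have hmD : ∀ A : FinVol d, Measurable fun ω => (R ω).restrict D A.1 := fun A =>
    (Measure.measurable_coe A.2.1).comp ((measurable_restrict hD).comp h.measurable)
  refine IndepFun.process_indepFun_process (X := fun (A : FinVol d) ω => (R ω).restrict C A.1)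
    (Y := fun (A : FinVol d) ω => (R ω).restrict D A.1) hmC hmD fun I J => ?_
  let A : I → Set (Space d) := fun i => i.1.1
  let A' : J → Set (Space d) := fun i => i.1.1
  have hA : ∀ i, MeasurableSet (A i) := fun i => i.1.2.1
  have hA' : ∀ i, MeasurableSet (A' i) := fun i => i.1.2.1
  -- Atoms inside `C` and atoms inside `D` form one disjoint family, so the two groups of counts are
  -- independent.
  let T : (I → Prop) ⊕ (J → Prop) → Set (Space d) :=
    Sum.elim (fun b => atomOf A b ∩ C) fun b => atomOf A' b ∩ D
  have hT : ∀ b, MeasurableSet (T b) := by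
    rintro (b | b)
    · exact (measurableSet_atomOf hA b).inter hC
    · exact (measurableSet_atomOf hA' b).inter hD
  have hTd : Pairwise fun b b' => Disjoint (T b) (T b') := by
    rintro (b | b) (b' | b') hb
    · exact (disjoint_atomOf fun e => hb (by rw [e])).mono inter_subset_left inter_subset_left
    · exact hCD.mono inter_subset_right inter_subset_right
    · exact hCD.symm.mono inter_subset_right inter_subset_right
    · exact (disjoint_atomOf fun e => hb (by rw [e])).mono inter_subset_left inter_subset_left
  let S1 : Finset ((I → Prop) ⊕ (J → Prop)) := Finset.univ.image Sum.inl
  let S2 : Finset ((I → Prop) ⊕ (J → Prop)) := Finset.univ.image Sum.inr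
  have hS : Disjoint S1 S2 := by
    rw [Finset.disjoint_left]
    simp [S1, S2]
  have hind := (h.iIndepFun_of_fintype hT hTd).indepFun_finset S1 S2 hS
    (fun b => h.measurable_apply (hT b))
  let g1 : (S1 → ℝ≥0∞) → I → ℝ≥0∞ := fun v i =>
    ∑ b : I → Prop, if b i then v ⟨Sum.inl b, by simp [S1]⟩ else 0
  let g2 : (S2 → ℝ≥0∞) → J → ℝ≥0∞ := fun v i =>
    ∑ b : J → Prop, if b i then v ⟨Sum.inr b, by simp [S2]⟩ else 0
  have hg1 : Measurable g1 := by
    refine measurable_pi_lambda _ fun i => Finset.measurable_sum _ fun b _ => ?_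
    by_cases hb : b i
    · simpa [hb] using measurable_pi_apply _
    · simp [hb]
  have hg2 : Measurable g2 := by
    refine measurable_pi_lambda _ fun i => Finset.measurable_sum _ fun b _ => ?_
    by_cases hb : b i
    · simpa [hb] using measurable_pi_apply _
    · simp [hb]
  have := hind.comp hg1 hg2
  convert! this using 1
  · funext ω i
    refine (Measure.restrict_apply i.1.2.1).trans
      ((measure_eq_sum_atomOf hA hC (R ω) i).trans ?_)
    change _ = ∑ b : I → Prop, if b i then R ω (T (Sum.inl b)) else 0
    congr!
  · funext ω i
    refine (Measure.restrict_apply i.1.2.1).trans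
      ((measure_eq_sum_atomOf hA' hD (R ω) i).trans ?_)
    change _ = ∑ b : J → Prop, if b i then R ω (T (Sum.inr b)) else 0
    congr!

/-- The random measure on `Ω × Ω` that follows the second coordinate on `C` and the first one
outside `C`. -/
noncomputable def resample (R : Ω → Measure (Space d)) (C : Set (Space d)) (p : Ω × Ω) : Measure (Space d) :=
  (R p.1).restrict Cᶜ + (R p.2).restrict C

omit [MeasurableSpace Ω] in
lemma resample_isCounting {C : Set (Space d)} (hC : MeasurableSet C) {p : Ω × Ω}
    (h1 : IsCounting (R p.1)) (h2 : IsCounting (R p.2)) :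
    IsCounting (resample R C p) ∧
      support (resample R C p) = (support (R p.1) \ C) ∪ (support (R p.2) ∩ C) := by
  obtain ⟨a1, b1⟩ := h1.restrict hC.compl
  obtain ⟨a2, b2⟩ := h2.restrict hC
  have := a1.add a2 (by
    rw [b1, b2]; exact disjoint_compl_left.mono inter_subset_right inter_subset_right)
  rw [b1, b2] at this
  exact this

/-- Inside and outside of `C` the process is independent already, so gluing pieces of two
independent copies reproduces its law. -/
theorem IsUnitPoissonProcess.resample [IsProbabilityMeasure P] (h : IsUnitPoissonProcess P R)
    {C : Set (Space d)} (hC : MeasurableSet C) :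
    IsUnitPoissonProcess (P.prod P) (StableMatching.resample R C) := by
  have hm1 : Measurable fun ω => (R ω).restrict Cᶜ :=
    (measurable_restrict hC.compl).comp h.measurable
  have hm2 : Measurable fun ω => (R ω).restrict C := (measurable_restrict hC).comp h.measurable
  refine h.of_map_eq ((hm1.comp measurable_fst).add (hm2.comp measurable_snd)) ?_ ?_
  · have e1 : ∀ᵐ p ∂P.prod P, IsCounting (R p.1) :=
      Measure.quasiMeasurePreserving_fst.ae h.ae_isCounting
    have e2 : ∀ᵐ p ∂P.prod P, IsCounting (R p.2) :=
      Measure.quasiMeasurePreserving_snd.ae h.ae_isCounting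
    filter_upwards [e1, e2] with p h1 h2 using (resample_isCounting hC h1 h2).1
  · have hind := h.indepFun_restrict hC.compl hC disjoint_compl_left
    rw [indepFun_iff_map_prod_eq_prod_map_map hm1.aemeasurable hm2.aemeasurable] at hind
    have e1 := Measure.map_prod_map P P hm1 hm2
    have hadd : Measurable fun q : Measure (Space d) × Measure (Space d) => q.1 + q.2 :=
      measurable_fst.add measurable_snd
    have e2 := Measure.map_map (μ := P.prod P) hadd (hm1.prodMap hm2)
    have e3 := Measure.map_map (μ := P) hadd (hm1.prodMk hm2)
    rw [← e1] at e2
    simp only [Function.comp_def] at hind e2 e3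
    rw [hind, e2] at e3
    refine e3.trans ?_
    congr 1
    funext ω
    exact (add_comm _ _).trans (Measure.restrict_add_restrict_compl hC)

/-- Rearranging a product of four measures. -/
lemma map_prod_prod_comm {α β : Type*} [MeasurableSpace α] [MeasurableSpace β]
    (μ : Measure α) (ν : Measure β) [SFinite μ] [SFinite ν] :
    ((μ.prod ν).prod (μ.prod ν)).map (fun q => ((q.1.1, q.2.1), (q.1.2, q.2.2))) =
      (μ.prod μ).prod (ν.prod ν) := by
  have hm : Measurable fun q : (α × β) × α × β => ((q.1.1, q.2.1), (q.1.2, q.2.2)) := by fun_prop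
  refine Measure.ext_of_lintegral _ fun f hf => ?_
  have hfm : Measurable fun q : (α × β) × α × β => f ((q.1.1, q.2.1), (q.1.2, q.2.2)) := by fun_prop
  rw [lintegral_map hf hm, lintegral_prod _ hfm.aemeasurable, lintegral_prod _ (by
    exact (hfm.lintegral_prod_right').aemeasurable), lintegral_prod _ hf.aemeasurable,
    lintegral_prod _ (by exact (hf.lintegral_prod_right').aemeasurable)]
  refine lintegral_congr fun a => ?_
  have e : ∀ b : β, ∫⁻ q : α × β, f ((a, q.1), (b, q.2)) ∂μ.prod ν =
      ∫⁻ a' : α, ∫⁻ b' : β, f ((a, a'), (b, b')) ∂ν ∂μ := fun b =>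
    lintegral_prod _ (by fun_prop)
  have e' : ∀ a' : α, ∫⁻ q : β × β, f ((a, a'), q) ∂ν.prod ν =
      ∫⁻ b : β, ∫⁻ b' : β, f ((a, a'), (b, b')) ∂ν ∂ν := fun a' =>
    lintegral_prod _ (by fun_prop)
  simp_rw [e, e']
  rw [lintegral_lintegral_swap]
  have : Measurable fun q : (β × α) × β => f ((a, q.1.2), (q.1.1, q.2)) := by fun_prop
  exact this.lintegral_prod_right'.aemeasurable

/-- The two copies of `R` are jointly independent of the two copies of `B`; each resampled process
is a function of its own pair of copies. -/
lemma indepFun_resample [IsProbabilityMeasure P] (hR : Measurable R) (hB : Measurable B)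
    (hind : IndepFun R B P) {C : Set (Space d)} (hC : MeasurableSet C) :
    IndepFun (StableMatching.resample R C) (StableMatching.resample B C) (P.prod P) := by
  have key : IndepFun (fun p : Ω × Ω => (R p.1, R p.2)) (fun p => (B p.1, B p.2)) (P.prod P) := by
    have hR2 : Measurable fun p : Ω × Ω => (R p.1, R p.2) := by fun_prop
    have hB2 : Measurable fun p : Ω × Ω => (B p.1, B p.2) := by fun_prop
    have e := (indepFun_iff_map_prod_eq_prod_map_map hR.aemeasurable hB.aemeasurable).1 hind
    have eR := Measure.map_prod_map P P hR hR
    have eB := Measure.map_prod_map P P hB hB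
    have eRB := Measure.map_prod_map P P (hR.prodMk hB) (hR.prodMk hB)
    have hm : Measurable fun q : (Measure (Space d) × Measure (Space d)) ×
        Measure (Space d) × Measure (Space d) => ((q.1.1, q.2.1), (q.1.2, q.2.2)) := by fun_prop
    have e2 := Measure.map_map (μ := P.prod P) hm ((hR.prodMk hB).prodMap (hR.prodMk hB))
    rw [indepFun_iff_map_prod_eq_prod_map_map hR2.aemeasurable hB2.aemeasurable]
    rw [← eRB, e, map_prod_prod_comm, eR, eB] at e2
    exact e2.symm
  have hg : Measurable fun q : Measure (Space d) × Measure (Space d) =>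
      q.1.restrict Cᶜ + q.2.restrict C :=
    ((measurable_restrict hC.compl).comp measurable_fst).add
      ((measurable_restrict hC).comp measurable_snd)
  exact key.comp hg hg

end Poisson


/-! ### Occupation probabilities of cells -/

section Occupation

variable {d : ℕ} {Ω : Type*} [MeasurableSpace Ω] {P : Measure Ω} {R B : Ω → Measure (Space d)}

lemma measurable_natCast_ennreal : Measurable fun n : ℕ => (n : ℝ≥0∞) := measurable_from_top

lemma IsUnitPoissonProcess.lintegral_comp (h : IsUnitPoissonProcess P R) {A : Set (Space d)}
    (hA : MeasurableSet A) (hv : volume A ≠ ∞) {f : ℝ≥0∞ → ℝ≥0∞} (hf : Measurable f) :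
    ∫⁻ ω, f (R ω A) ∂P = ∫⁻ n : ℕ, f n ∂poissonMeasure (volume A).toNNReal := by
  rw [← lintegral_map hf (h.measurable_apply hA), h.law A hA hv,
    lintegral_map hf measurable_natCast_ennreal]

lemma IsUnitPoissonProcess.measure_eq_natCast (h : IsUnitPoissonProcess P R) {A : Set (Space d)}
    (hA : MeasurableSet A) (hv : volume A ≠ ∞) (n : ℕ) :
    P {ω | R ω A = n} = poissonMeasure (volume A).toNNReal {n} := by
  have e : {ω | R ω A = n} = (fun ω => R ω A) ⁻¹' {(n : ℝ≥0∞)} := rfl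
  rw [e, ← Measure.map_apply (h.measurable_apply hA) (measurableSet_singleton _), h.law A hA hv,
    Measure.map_apply measurable_natCast_ennreal (measurableSet_singleton _)]
  congr 1
  ext k
  simp

lemma IsUnitPoissonProcess.measure_eq_natCast_pos (h : IsUnitPoissonProcess P R)
    {A : Set (Space d)} (hA : MeasurableSet A) (hv : volume A ≠ ∞) {n : ℕ}
    (hn : n = 0 ∨ volume A ≠ 0) : 0 < P {ω | R ω A = n} := by
  rw [h.measure_eq_natCast hA hv, poissonMeasure_singleton, ENNReal.ofReal_pos]
  rcases hn with rfl | hn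
  · simp only [pow_zero]; positivity
  · have : 0 < ((volume A).toNNReal : ℝ) := by
      rw [NNReal.coe_pos, pos_iff_ne_zero, Ne, ENNReal.toNNReal_eq_zero_iff]
      tauto
    positivity

/-- For finite volume `v` this is `1 - exp (-v) ≤ v`. -/
lemma IsUnitPoissonProcess.measure_ne_zero_le [IsProbabilityMeasure P]
    (h : IsUnitPoissonProcess P R) {A : Set (Space d)} (hA : MeasurableSet A) :
    P {ω | R ω A ≠ 0} ≤ volume A := by
  by_cases hv : volume A = ∞
  · rw [hv]; exact le_top
  have hm : MeasurableSet {ω | R ω A = (0 : ℕ)} :=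
    h.measurable_apply hA (measurableSet_singleton _)
  have e : {ω | R ω A ≠ 0} = {ω | R ω A = (0 : ℕ)}ᶜ := by ext; simp
  rw [e, prob_compl_eq_one_sub hm, h.measure_eq_natCast hA hv, poissonMeasure_singleton]
  rw [tsub_le_iff_right]
  have hr : (1 : ℝ) ≤ (volume A).toReal + Real.exp (-(volume A).toReal) := by
    have := Real.add_one_le_exp (-(volume A).toReal)
    linarith
  calc (1 : ℝ≥0∞) = ENNReal.ofReal 1 := by simp
    _ ≤ ENNReal.ofReal ((volume A).toReal + Real.exp (-(volume A).toReal)) :=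
      ENNReal.ofReal_le_ofReal hr
    _ = _ := by
      rw [ENNReal.ofReal_add ENNReal.toReal_nonneg (Real.exp_nonneg _), ENNReal.ofReal_toReal hv]
      simp [ENNReal.coe_toNNReal_eq_toReal]

lemma IsUnitPoissonProcess.measure_forall_ne_zero_le [IsProbabilityMeasure P]
    (h : IsUnitPoissonProcess P R) {ι : Type*} [Fintype ι] {a : ι → Set (Space d)}
    (ha : ∀ i, MeasurableSet (a i)) (hd : Pairwise fun i j => Disjoint (a i) (a j)) :
    P {ω | ∀ i, R ω (a i) ≠ 0} ≤ ∏ i, volume (a i) := by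
  have e : {ω | ∀ i, R ω (a i) ≠ 0} = ⋂ i, (fun ω => R ω (a i)) ⁻¹' {0}ᶜ := by
    ext; simp
  rw [e, (h.iIndepFun_of_fintype ha hd).meas_iInter
    fun i => ⟨_, (measurableSet_singleton _).compl, rfl⟩]
  exact Finset.prod_le_prod' fun i _ => h.measure_ne_zero_le (ha i)

/-- The probability that given red and blue cells are all occupied. -/
lemma measure_occupied_le [IsProbabilityMeasure P] (hR : IsUnitPoissonProcess P R)
    (hB : IsUnitPoissonProcess P B) (hind : IndepFun R B P) {ι κ : Type*} [Fintype ι] [Fintype κ]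
    {a : ι → Set (Space d)} {b : κ → Set (Space d)}
    (ha : ∀ i, MeasurableSet (a i)) (hb : ∀ i, MeasurableSet (b i))
    (had : Pairwise fun i j => Disjoint (a i) (a j))
    (hbd : Pairwise fun i j => Disjoint (b i) (b j)) :
    P {ω | (∀ i, R ω (a i) ≠ 0) ∧ ∀ j, B ω (b j) ≠ 0} ≤
      (∏ i, volume (a i)) * ∏ j, volume (b j) := by
  have hms : ∀ {ι : Type _} [Fintype ι] {a : ι → Set (Space d)}, (∀ i, MeasurableSet (a i)) →
      MeasurableSet {π : Measure (Space d) | ∀ i, π (a i) ≠ 0} := by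
    intro ι _ a ha
    have : {π : Measure (Space d) | ∀ i, π (a i) ≠ 0} =
        ⋂ i, (fun π : Measure (Space d) => π (a i)) ⁻¹' {0}ᶜ := by ext; simp
    rw [this]
    exact MeasurableSet.iInter fun i =>
      Measure.measurable_coe (ha i) (measurableSet_singleton _).compl
  have hms' : MeasurableSet {π : Measure (Space d) | ∀ i, π (b i) ≠ 0} := by
    have : {π : Measure (Space d) | ∀ i, π (b i) ≠ 0} =
        ⋂ i, (fun π : Measure (Space d) => π (b i)) ⁻¹' {0}ᶜ := by ext; simp
    rw [this]
    exact MeasurableSet.iInter fun i =>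
      Measure.measurable_coe (hb i) (measurableSet_singleton _).compl
  have := hind.measure_inter_preimage_eq_mul _ _ (hms ha) hms'
  calc _ = P (R ⁻¹' {π | ∀ i, π (a i) ≠ 0} ∩ B ⁻¹' {π | ∀ i, π (b i) ≠ 0}) := rfl
    _ = _ := this
    _ ≤ _ := mul_le_mul' (hR.measure_forall_ne_zero_le ha had) (hB.measure_forall_ne_zero_le hb hbd)

end Occupation

/-- Sums over paths are bounded by the product of the bounds for one step. -/
lemma tsum_path_le {ι : Type*} {G : ι → ℝ≥0∞} {k : ι → ι → ι → ℝ≥0∞} {V θ : ℝ≥0∞}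
    (hG : ∑' a, G a ≤ V) (hk : ∀ a, ∑' (b : ι) (a' : ι), k a b a' ≤ θ) (n : ℕ) :
    ∑' (a : Fin (n + 1) → ι) (b : Fin n → ι), G (a 0) * ∏ i, k (a i.castSucc) (b i) (a i.succ) ≤
      V * θ ^ n := by
  induction n with
  | zero =>
    have : ∀ a : Fin 1 → ι, ∑' b : Fin 0 → ι, G (a 0) * ∏ i, k (a i.castSucc) (b i) (a i.succ) =
        G (a 0) := by
      intro a
      rw [tsum_eq_single default (fun b hb => absurd (Subsingleton.elim _ _) hb)]
      simp
    simp_rw [this]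
    rw [pow_zero, mul_one, ← (Equiv.funUnique (Fin 1) ι).symm.tsum_eq]
    simpa using hG
  | succ n ih =>
    -- Split off the last vertex: the final two steps sum to at most `θ` whatever precedes them.
    rw [← (Fin.snocEquiv fun _ => ι).tsum_eq, ENNReal.tsum_prod', ENNReal.tsum_comm]
    have h1 : ∀ (a : Fin (n + 1) → ι),
        ∑' (z : ι) (b : Fin (n + 1) → ι), G ((Fin.snoc a z : Fin (n + 2) → ι) 0) *
          ∏ i, k ((Fin.snoc a z : Fin (n + 2) → ι) i.castSucc) (b i)
            ((Fin.snoc a z : Fin (n + 2) → ι) i.succ) ≤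
        (∑' b : Fin n → ι, G (a 0) * ∏ i, k (a i.castSucc) (b i) (a i.succ)) * θ := by
      intro a
      have h2 : ∀ z : ι, ∑' (b : Fin (n + 1) → ι), G ((Fin.snoc a z : Fin (n + 2) → ι) 0) *
          ∏ i, k ((Fin.snoc a z : Fin (n + 2) → ι) i.castSucc) (b i)
            ((Fin.snoc a z : Fin (n + 2) → ι) i.succ) =
          (∑' b : Fin n → ι, G (a 0) * ∏ i, k (a i.castSucc) (b i) (a i.succ)) *
            ∑' t, k (a (Fin.last n)) t z := by
        intro z
        rw [← (Fin.snocEquiv fun _ => ι).tsum_eq, ENNReal.tsum_prod', ENNReal.tsum_comm,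
          ← ENNReal.tsum_mul_right]
        refine tsum_congr fun b => ?_
        rw [← ENNReal.tsum_mul_left]
        refine tsum_congr fun t => ?_
        simp only [Fin.snocEquiv_apply]
        rw [Fin.prod_univ_castSucc, ← mul_assoc]
        refine congrArg₂ (· * ·) (congrArg₂ (· * ·) rfl ?_) ?_
        · refine Finset.prod_congr rfl fun i _ => ?_
          rw [Fin.snoc_castSucc (α := fun _ => ι), Fin.snoc_castSucc (α := fun _ => ι),
            Fin.succ_castSucc, Fin.snoc_castSucc (α := fun _ => ι)]
        · rw [Fin.snoc_castSucc (α := fun _ => ι), Fin.snoc_last (α := fun _ => ι), Fin.succ_last,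
            Fin.snoc_last (α := fun _ => ι)]
      simp_rw [h2]
      rw [ENNReal.tsum_mul_left]
      gcongr
      rw [ENNReal.tsum_comm]
      exact hk _
    calc _ ≤ ∑' a : Fin (n + 1) → ι,
          (∑' b : Fin n → ι, G (a 0) * ∏ i, k (a i.castSucc) (b i) (a i.succ)) * θ :=
        ENNReal.tsum_le_tsum h1
      _ ≤ V * θ ^ n * θ := by rw [ENNReal.tsum_mul_right]; gcongr
      _ = _ := by rw [pow_succ, mul_assoc]

/-- The volume of a thin shell. -/
lemma exists_volume_shell_le {d : ℕ} (hd : 1 ≤ d) (b : ℝ) (hb : 0 ≤ b) :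
    ∃ C : ℝ, 0 ≤ C ∧ ∀ (q ε : ℝ) (x : Space d), 0 ≤ q → 0 < ε → ε ≤ 1 → q + 2 ≤ b →
      volume {y | q - ε ≤ dist x y ∧ dist x y < q + 2 * ε} ≤ ENNReal.ofReal (C * ε) := by
  have : Nonempty (Fin d) := ⟨⟨0, hd⟩⟩
  set w := (volume (Metric.ball (0 : Space d) 1)).toReal with hw
  have hwe : volume (Metric.ball (0 : Space d) 1) = ENNReal.ofReal w :=
    (ENNReal.ofReal_toReal measure_ball_lt_top.ne).symm
  -- The shell has thickness at most `3 * ε`, the derivative of `s ^ d` is at most `d * b ^ (d - 1)`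
  -- for `s ≤ b`, and `w` is the volume of the unit ball.
  refine ⟨3 * d * b ^ (d - 1) * w, by positivity, fun q ε x hq hε hε1 hqb => ?_⟩
  set a := max (q - ε) 0
  have ha : 0 ≤ a := le_max_right _ _
  have hab : a ≤ q + 2 * ε := max_le (by linarith) (by linarith)
  have hsub : {y | q - ε ≤ dist x y ∧ dist x y < q + 2 * ε} ⊆
      Metric.ball x (q + 2 * ε) \ Metric.ball x a := by
    rintro y ⟨h1, h2⟩
    refine ⟨by rwa [Metric.mem_ball, dist_comm], ?_⟩
    rw [Metric.mem_ball, dist_comm, not_lt]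
    exact max_le h1 dist_nonneg
  refine (measure_mono hsub).trans ?_
  rw [measure_sdiff (Metric.ball_subset_ball hab) measurableSet_ball.nullMeasurableSet
    measure_ball_lt_top.ne, Measure.addHaar_ball _ _ (by linarith), Measure.addHaar_ball _ _ ha,
    finrank_euclideanSpace, Fintype.card_fin, hwe, ← ENNReal.ofReal_mul (by positivity),
    ← ENNReal.ofReal_mul (by positivity), ← ENNReal.ofReal_sub _ (by positivity)]
  refine ENNReal.ofReal_le_ofReal ?_
  rw [← sub_mul]
  have h1 := abs_pow_sub_pow_le (q + 2 * ε) a d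
  rw [abs_of_nonneg (sub_nonneg.2 hab), abs_of_nonneg ha, abs_of_nonneg (by linarith : 0 ≤ q + 2 * ε),
    max_eq_left hab] at h1
  have h2 : q + 2 * ε - a ≤ 3 * ε := by have := le_max_left (q - ε) 0; linarith
  have h3 : (q + 2 * ε) ^ (d - 1) ≤ b ^ (d - 1) := by gcongr; linarith
  calc ((q + 2 * ε) ^ d - a ^ d) * w ≤ ((q + 2 * ε - a) * d * (q + 2 * ε) ^ (d - 1)) * w := by
        gcongr; exact (le_abs_self _).trans h1
    _ ≤ (3 * ε * d * b ^ (d - 1)) * w := by gcongr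
    _ = _ := by ring

/-! ### Cells -/

/-- The cell of mesh `1 / (m + 1)` that contains `x`. -/
noncomputable def cellIndex {d : ℕ} (m : ℕ) (x : Space d) : Fin d → ℤ := fun i => ⌊(m + 1) * x i⌋

/-- The points with cell index `z`. -/
def cell {d : ℕ} (m : ℕ) (z : Fin d → ℤ) : Set (Space d) := {x | cellIndex m x = z}

section Cells

variable {d : ℕ}

lemma measurable_cellIndex (m : ℕ) : Measurable (cellIndex (d := d) m) := by
  refine measurable_pi_lambda _ fun i => Int.measurable_floor.comp ?_
  exact (by fun_prop : Measurable fun x : Space d => ((m : ℝ) + 1) * x i)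

lemma measurableSet_cell (m : ℕ) (z : Fin d → ℤ) : MeasurableSet (cell m z) :=
  measurable_cellIndex m (measurableSet_singleton z)

lemma mem_cell_cellIndex (m : ℕ) (x : Space d) : x ∈ cell m (cellIndex m x) := rfl

lemma disjoint_cell (m : ℕ) {z z' : Fin d → ℤ} (h : z ≠ z') :
    Disjoint (cell m z) (cell (d := d) m z') := by
  rw [Set.disjoint_left]
  intro x hx hx'
  exact h (hx.symm.trans hx')

lemma dist_le_of_mem_cell {m : ℕ} {z : Fin d → ℤ} {x y : Space d} (hx : x ∈ cell m z)
    (hy : y ∈ cell m z) : dist x y ≤ √d / (m + 1) := by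
  have hc : ∀ i, dist (x i) (y i) ≤ 1 / (m + 1) := by
    intro i
    have h : ⌊((m : ℝ) + 1) * x i⌋ = ⌊((m : ℝ) + 1) * y i⌋ := congrFun (hx.trans hy.symm) i
    have := (Int.abs_sub_lt_one_of_floor_eq_floor h).le
    rw [← mul_sub, abs_mul, abs_of_pos (by positivity : (0 : ℝ) < m + 1)] at this
    rw [Real.dist_eq, le_div_iff₀' (by positivity)]
    exact this
  rw [EuclideanSpace.dist_eq]
  calc √(∑ i, dist (x i) (y i) ^ 2) ≤ √(∑ _i : Fin d, (1 / ((m : ℝ) + 1)) ^ 2) := by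
        gcongr with i; exact hc i
    _ = _ := by
      rw [Finset.sum_const, Finset.card_univ, Fintype.card_fin, nsmul_eq_mul,
        Real.sqrt_mul (by positivity), Real.sqrt_sq (by positivity)]
      ring

lemma tsum_volume_cell_le (m : ℕ) (p : (Fin d → ℤ) → Prop) [DecidablePred p] {A : Set (Space d)}
    (h : ∀ z, p z → cell m z ⊆ A) :
    ∑' z, (if p z then volume (cell (d := d) m z) else 0) ≤ volume A := by
  have : ∀ z, (if p z then volume (cell (d := d) m z) else 0) =
      volume (if p z then cell (d := d) m z else ∅) := by
    intro z; split_ifs <;> simp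
  simp_rw [this]
  rw [← measure_iUnion]
  · refine measure_mono (iUnion_subset fun z => ?_)
    split_ifs with hz
    · exact h z hz
    · exact empty_subset _
  · intro z z' hz
    refine (disjoint_cell m hz).mono ?_ ?_ <;> dsimp only <;> split_ifs <;> simp
  · intro z
    split_ifs
    · exact measurableSet_cell m z
    · exact MeasurableSet.empty

end Cells


/-- There is a self-avoiding path with `2 n` edges that alternates between `U` and `V`, starts
within distance `N` of the origin, and has all edge lengths in `[q, q + ε)`. -/
def HasPath {d : ℕ} (U V : Set (Space d)) (n : ℕ) (q ε N : ℝ) : Prop :=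
  ∃ (x : Fin (n + 1) → Space d) (y : Fin n → Space d), (∀ i, x i ∈ U) ∧ (∀ i, y i ∈ V) ∧
    x.Injective ∧ y.Injective ∧ dist (x 0) 0 ≤ N ∧
    ∀ i : Fin n, dist (x i.castSucc) (y i) ∈ Ico q (q + ε) ∧ dist (x i.succ) (y i) ∈ Ico q (q + ε)

/-- The same with points of one color at distance greater than `κ` from one another. -/
def HasSeparatedPath {d : ℕ} (U V : Set (Space d)) (n : ℕ) (q ε N κ : ℝ) : Prop :=
  ∃ (x : Fin (n + 1) → Space d) (y : Fin n → Space d), (∀ i, x i ∈ U) ∧ (∀ i, y i ∈ V) ∧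
    (∀ i j, i ≠ j → κ < dist (x i) (x j)) ∧ (∀ i j, i ≠ j → κ < dist (y i) (y j)) ∧
    dist (x 0) 0 ≤ N ∧
    ∀ i : Fin n, dist (x i.castSucc) (y i) ∈ Ico q (q + ε) ∧ dist (x i.succ) (y i) ∈ Ico q (q + ε)

/-! ### Alternating paths with nearly equal edge lengths -/

section Paths

variable {d : ℕ}

lemma exists_separation {ι : Type*} [Finite ι] {x : ι → Space d} (hx : x.Injective) :
    ∃ κ : ℝ, 0 < κ ∧ ∀ i j, i ≠ j → κ < dist (x i) (x j) := by
  have : ∀ p : ι × ι, ∃ κ : ℝ, 0 < κ ∧ (p.1 ≠ p.2 → κ < dist (x p.1) (x p.2)) := by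
    rintro ⟨i, j⟩
    by_cases h : i = j
    · exact ⟨1, one_pos, fun h' => absurd h h'⟩
    · exact ⟨dist (x i) (x j) / 2, by simp [hx.ne h],
        fun _ => half_lt_self (by simp [hx.ne h])⟩
  choose f hf0 hf using this
  rcases isEmpty_or_nonempty (ι × ι) with he | he
  · exact ⟨1, one_pos, fun i j => (he.false (i, j)).elim⟩
  · obtain ⟨p, hp⟩ := Finite.exists_min f
    exact ⟨f p, hf0 p, fun i j hij => (hp (i, j)).trans_lt (hf (i, j) hij)⟩

/-- A positive separation puts points of one color into distinct cells of a fine mesh, which is what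
makes the occupation events independent. -/
lemma HasPath.exists_separated {U V : Set (Space d)} {n : ℕ} {q ε N : ℝ}
    (h : HasPath U V n q ε N) : ∃ j : ℕ, HasSeparatedPath U V n q ε N (1 / (j + 1)) := by
  obtain ⟨x, y, hx, hy, hxi, hyi, h0, hl⟩ := h
  obtain ⟨κ, hκ, h1⟩ := exists_separation hxi
  obtain ⟨κ', hκ', h2⟩ := exists_separation hyi
  obtain ⟨j, hj⟩ := exists_nat_one_div_lt (lt_min hκ hκ')
  exact ⟨j, x, y, hx, hy, fun a b hab => (hj.trans_le (min_le_left _ _)).trans (h1 a b hab),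
    fun a b hab => (hj.trans_le (min_le_right _ _)).trans (h2 a b hab), h0, hl⟩

/-- The first coordinate of an edge lies in the cell `z`, the second one in `t`. -/
def CellAdj (m : ℕ) (q ε : ℝ) (z t : Fin d → ℤ) : Prop :=
  ∃ u ∈ cell m z, ∃ v ∈ cell (d := d) m t, dist u v ∈ Ico q (q + ε)

lemma CellAdj.symm {m : ℕ} {q ε : ℝ} {z t : Fin d → ℤ} (h : CellAdj m q ε z t) :
    CellAdj m q ε t z := by
  obtain ⟨u, hu, v, hv, h⟩ := h
  exact ⟨v, hv, u, hu, by rwa [dist_comm]⟩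

-- The two cells of an edge add an error of at most `ε / 2` each, so every cell adjacent to `z` lies
-- in the shell thickened by `ε` about any point of `cell m z`.
open Classical in
lemma tsum_cellAdj_le {m : ℕ} {q ε : ℝ} {S : ℝ≥0∞} (hm : √d / (m + 1) ≤ ε / 2)
    (hS : ∀ x : Space d, volume {y | q - ε ≤ dist x y ∧ dist x y < q + 2 * ε} ≤ S)
    (z : Fin d → ℤ) :
    ∑' t, (if CellAdj m q ε z t then volume (cell (d := d) m t) else 0) ≤ S := by
  by_cases hz : (cell (d := d) m z).Nonempty
  · obtain ⟨x, hx⟩ := hz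
    refine (tsum_volume_cell_le m (fun t => CellAdj m q ε z t) ?_).trans (hS x)
    rintro t ⟨u, hu, v, hv, h1, h2⟩ y hy
    have a1 := dist_le_of_mem_cell hx hu
    have a2 := dist_le_of_mem_cell hv hy
    have a3 := dist_triangle4 x u v y
    have a4 := dist_triangle4 u x y v
    rw [dist_comm u x, dist_comm y v] at a4
    exact ⟨by linarith, by linarith⟩
  · have : ∀ t, ¬ CellAdj m q ε z t := fun t ⟨u, hu, _⟩ => hz ⟨u, hu⟩
    simp [this]

variable {Ω : Type*} [MeasurableSpace Ω] {P : Measure Ω} {R B : Ω → Measure (Space d)}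

lemma apply_ne_zero_of_mem_support {π : Measure (Space d)} {x : Space d} (hx : x ∈ support π)
    {A : Set (Space d)} (hA : x ∈ A) : π A ≠ 0 := by
  intro h
  have := measure_mono_null (singleton_subset_iff.2 hA) h
  rw [show π {x} = 1 from hx] at this
  exact one_ne_zero this

-- A union bound over all sequences of cells. Distinct cells are occupied independently, each with
-- probability at most its volume, and summing over the cells adjacent to the previous one costs at
-- most `S` per edge.
open Classical in
lemma measure_hasSeparatedPath_le [IsProbabilityMeasure P] (hR : IsUnitPoissonProcess P R)
    (hB : IsUnitPoissonProcess P B) (hind : IndepFun R B P) {q ε : ℝ} (hε : 0 < ε) {S : ℝ≥0∞}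
    (hS : ∀ x : Space d, volume {y | q - ε ≤ dist x y ∧ dist x y < q + 2 * ε} ≤ S)
    (n : ℕ) (N : ℝ) {κ : ℝ} (hκ : 0 < κ) :
    P {ω | HasSeparatedPath (support (R ω)) (support (B ω)) n q ε N κ} ≤
      volume (Metric.closedBall (0 : Space d) (N + 1)) * (S * S) ^ n := by
  -- Below `κ` the cells separate the points, below `ε / 2` the shells are thickened by at most `ε`,
  -- and below `1` the first cell stays in the ball of radius `N + 1`.
  obtain ⟨m, hm⟩ : ∃ m : ℕ, √d / (m + 1) < min (min κ (ε / 2)) 1 := by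
    obtain ⟨m, hm⟩ := exists_nat_gt (√d / min (min κ (ε / 2)) 1)
    refine ⟨m, ?_⟩
    have h0 : 0 < min (min κ (ε / 2)) 1 := by positivity
    rw [div_lt_iff₀ h0] at hm
    rw [div_lt_iff₀ (by positivity)]
    nlinarith
  have hmκ : √d / (m + 1) < κ := hm.trans_le ((min_le_left _ _).trans (min_le_left _ _))
  have hmε : √d / (m + 1) ≤ ε / 2 := (hm.trans_le ((min_le_left _ _).trans (min_le_right _ _))).le
  have hm1 : √d / (m + 1) ≤ 1 := (hm.trans_le (min_le_right _ _)).le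
  let g : (Fin d → ℤ) → Prop := fun z => ∃ u ∈ cell (d := d) m z, dist u 0 ≤ N
  let T : (Fin (n + 1) → Fin d → ℤ) → (Fin n → Fin d → ℤ) → Prop := fun a b =>
    a.Injective ∧ b.Injective ∧ g (a 0) ∧
      ∀ i, CellAdj m q ε (a i.castSucc) (b i) ∧ CellAdj m q ε (b i) (a i.succ)
  let G : (Fin d → ℤ) → ℝ≥0∞ := fun z => if g z then volume (cell (d := d) m z) else 0
  let k : (Fin d → ℤ) → (Fin d → ℤ) → (Fin d → ℤ) → ℝ≥0∞ := fun z t z' =>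
    (if CellAdj m q ε z t then volume (cell (d := d) m t) else 0) *
      if CellAdj m q ε t z' then volume (cell (d := d) m z') else 0
  have hG : ∑' z, G z ≤ volume (Metric.closedBall (0 : Space d) (N + 1)) := by
    refine tsum_volume_cell_le m g ?_
    rintro z ⟨u, hu, hN⟩ y hy
    have a1 := dist_le_of_mem_cell hy hu
    have a2 := dist_triangle y u 0
    rw [Metric.mem_closedBall]
    linarith
  have hk : ∀ z, ∑' (t) (z'), k z t z' ≤ S * S := by
    intro z
    simp only [k]
    simp_rw [ENNReal.tsum_mul_left]
    calc _ ≤ ∑' t, (if CellAdj m q ε z t then volume (cell (d := d) m t) else 0) * S := by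
          gcongr with t; exact tsum_cellAdj_le hmε hS t
      _ ≤ S * S := by rw [ENNReal.tsum_mul_right]; gcongr; exact tsum_cellAdj_le hmε hS z
  have hcover : {ω | HasSeparatedPath (support (R ω)) (support (B ω)) n q ε N κ} ⊆
      ⋃ (a : Fin (n + 1) → Fin d → ℤ), ⋃ (b : Fin n → Fin d → ℤ),
        {ω | T a b ∧ (∀ i, R ω (cell m (a i)) ≠ 0) ∧ ∀ i, B ω (cell m (b i)) ≠ 0} := by
    rintro ω ⟨x, y, hx, hy, hxs, hys, h0, hl⟩
    simp only [mem_iUnion, mem_ofPred_eq]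
    refine ⟨fun i => cellIndex m (x i), fun i => cellIndex m (y i), ⟨?_, ?_, ?_, ?_⟩, ?_, ?_⟩
    · intro i j hij
      by_contra hne
      have := dist_le_of_mem_cell (mem_cell_cellIndex m (x i)) (show x j ∈ _ from hij.symm)
      exact absurd (hxs i j hne) (by linarith)
    · intro i j hij
      by_contra hne
      have := dist_le_of_mem_cell (mem_cell_cellIndex m (y i)) (show y j ∈ _ from hij.symm)
      exact absurd (hys i j hne) (by linarith)
    · exact ⟨x 0, mem_cell_cellIndex m _, h0⟩
    · intro i
      exact ⟨⟨_, mem_cell_cellIndex m _, _, mem_cell_cellIndex m _, (hl i).1⟩,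
        CellAdj.symm ⟨_, mem_cell_cellIndex m _, _, mem_cell_cellIndex m _, (hl i).2⟩⟩
    · exact fun i => apply_ne_zero_of_mem_support (hx i) (mem_cell_cellIndex m _)
    · exact fun i => apply_ne_zero_of_mem_support (hy i) (mem_cell_cellIndex m _)
  refine (measure_mono hcover).trans ?_
  refine (measure_iUnion_le _).trans (le_trans ?_ (tsum_path_le hG hk n))
  refine ENNReal.tsum_le_tsum fun a => (measure_iUnion_le _).trans ?_
  refine ENNReal.tsum_le_tsum fun b => ?_
  by_cases hT : T a b
  · obtain ⟨hai, hbi, hg0, hadj⟩ := hT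
    refine (measure_mono fun ω hω => hω.2).trans ((measure_occupied_le hR hB hind
      (fun i => measurableSet_cell m (a i)) (fun i => measurableSet_cell m (b i))
      (fun i j hij => disjoint_cell m (hai.ne hij))
      (fun i j hij => disjoint_cell m (hbi.ne hij))).trans ?_)
    have e : ∀ i : Fin n, k (a i.castSucc) (b i) (a i.succ) =
        volume (cell (d := d) m (b i)) * volume (cell (d := d) m (a i.succ)) := by
      intro i
      simp only [k, if_pos (hadj i).1, if_pos (hadj i).2]
    simp_rw [e]
    simp only [G, if_pos hg0]
    rw [Fin.prod_univ_succ, Finset.prod_mul_distrib, mul_assoc, mul_comm (∏ i, volume (cell m (b i)))]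
  · have : {ω | T a b ∧ (∀ i, R ω (cell m (a i)) ≠ 0) ∧ ∀ i, B ω (cell m (b i)) ≠ 0} = ∅ := by
      ext ω; simp [hT]
    rw [this]
    simp

/-- The bound for separated paths does not depend on the separation, so it survives the monotone
limit. -/
lemma measure_hasPath_le [IsProbabilityMeasure P] (hR : IsUnitPoissonProcess P R)
    (hB : IsUnitPoissonProcess P B) (hind : IndepFun R B P) {q ε : ℝ} (hε : 0 < ε) {S : ℝ≥0∞}
    (hS : ∀ x : Space d, volume {y | q - ε ≤ dist x y ∧ dist x y < q + 2 * ε} ≤ S)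
    (n : ℕ) (N : ℝ) :
    P {ω | HasPath (support (R ω)) (support (B ω)) n q ε N} ≤
      volume (Metric.closedBall (0 : Space d) (N + 1)) * (S * S) ^ n := by
  have hsub : {ω | HasPath (support (R ω)) (support (B ω)) n q ε N} ⊆ ⋃ j : ℕ,
      {ω | HasSeparatedPath (support (R ω)) (support (B ω)) n q ε N (1 / (j + 1))} := by
    intro ω hω
    rw [mem_iUnion]
    exact HasPath.exists_separated hω
  refine (measure_mono hsub).trans ?_
  have hmono : Monotone fun j : ℕ =>
      {ω | HasSeparatedPath (support (R ω)) (support (B ω)) n q ε N (1 / ((j : ℝ) + 1))} := by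
    rintro i j hij ω ⟨x, y, hx, hy, hxs, hys, h0, hl⟩
    have : (1 : ℝ) / (j + 1) ≤ 1 / (i + 1) := by gcongr
    exact ⟨x, y, hx, hy, fun a b hab => this.trans_lt (hxs a b hab),
      fun a b hab => this.trans_lt (hys a b hab), h0, hl⟩
  rw [hmono.measure_iUnion]
  exact iSup_le fun j => measure_hasSeparatedPath_le hR hB hind hε hS n N (by positivity)

/-- Almost surely, no blue point is at the same distance from two red points. -/
lemma ae_no_tie [IsProbabilityMeasure P] (hd : 1 ≤ d) (hR : IsUnitPoissonProcess P R)
    (hB : IsUnitPoissonProcess P B) (hind : IndepFun R B P) :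
    ∀ᵐ ω ∂P, ∀ y ∈ support (B ω), ∀ x ∈ support (R ω), ∀ x' ∈ support (R ω),
      dist x y = dist x' y → x = x' := by
  have key : ∀ N : ℕ, ∀ᵐ ω ∂P, ∀ y ∈ support (B ω), ∀ x ∈ support (R ω), ∀ x' ∈ support (R ω),
      dist x 0 ≤ N → dist x y < N → dist x y = dist x' y → x = x' := by
    intro N
    obtain ⟨C, hC, hS⟩ := exists_volume_shell_le hd (N + 2) (by positivity)
    set W := volume (Metric.closedBall (0 : Space d) (N + 1)) with hW
    have hWt : W ≠ ∞ := measure_closedBall_lt_top.ne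
    set F := {ω | ¬ ∀ y ∈ support (B ω), ∀ x ∈ support (R ω), ∀ x' ∈ support (R ω),
      dist x 0 ≤ N → dist x y < N → dist x y = dist x' y → x = x'}
    -- A tie is a path of two edges of equal length. There are `N * (m + 1)` length windows of width
    -- `1 / (m + 1)`, each of probability at most `W * (C / (m + 1)) ^ 2`.
    have hb : ∀ m : ℕ, P F ≤ W * ENNReal.ofReal (N * C ^ 2 / (m + 1)) := by
      intro m
      have hm : (0 : ℝ) < m + 1 := by positivity
      have hsub : F ⊆ ⋃ i ∈ Finset.range (N * (m + 1)), {ω | HasPath (support (R ω)) (support (B ω)) 1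
          (i / (m + 1)) (1 / (m + 1)) N} := by
        intro ω hω
        simp only [F, mem_ofPred_eq] at hω
        push Not at hω
        obtain ⟨y, hy, x, hx, x', hx', h0, hlt, he, hne⟩ := hω
        have hfl : (⌊dist x y * (m + 1)⌋₊ : ℝ) ≤ dist x y * (m + 1) :=
          Nat.floor_le (by positivity)
        have hfl' : dist x y * (m + 1) < ⌊dist x y * (m + 1)⌋₊ + 1 := Nat.lt_floor_add_one _
        simp only [mem_iUnion, Finset.mem_range, exists_prop]
        refine ⟨⌊dist x y * (m + 1)⌋₊, ?_, ?_⟩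
        · rw [Nat.floor_lt (by positivity)]
          push_cast
          gcongr
        · have hmem : dist x y ∈ Ico ((⌊dist x y * (m + 1)⌋₊ : ℝ) / (m + 1))
              (⌊dist x y * (m + 1)⌋₊ / (m + 1) + 1 / (m + 1)) := by
            rw [← add_div]
            exact ⟨by rwa [div_le_iff₀ hm], by rwa [lt_div_iff₀ hm]⟩
          refine ⟨![x, x'], ![y], ?_, ?_, ?_, ?_, h0, ?_⟩
          · intro i; fin_cases i <;> assumption
          · intro i; fin_cases i; assumption
          · intro i j hij; fin_cases i <;> fin_cases j <;> simp_all
          · intro i j _; exact Subsingleton.elim _ _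
          · intro i; fin_cases i
            exact ⟨hmem, by rw [he] at hmem ⊢; exact hmem⟩
      refine (measure_mono hsub).trans ((measure_biUnion_finset_le _ _).trans ?_)
      calc _ ≤ ∑ i ∈ Finset.range (N * (m + 1)), W * ENNReal.ofReal ((C / (m + 1)) ^ 2) := by
            refine Finset.sum_le_sum fun i hi => ?_
            rw [Finset.mem_range] at hi
            have hq : (i : ℝ) / (m + 1) + 2 ≤ N + 2 := by
              have : (i : ℝ) ≤ N * (m + 1) := by exact_mod_cast hi.le
              have := (div_le_iff₀ hm).2 this
              linarith
            have := measure_hasPath_le hR hB hind (q := i / (m + 1)) (ε := 1 / (m + 1))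
              (by positivity) (fun x => hS _ _ x (by positivity) (by positivity)
                (by rw [div_le_one hm]; linarith [Nat.cast_nonneg (α := ℝ) m]) hq) 1 N
            rw [pow_one, ← ENNReal.ofReal_mul (by positivity), ← sq, mul_one_div] at this
            exact this
        _ = W * ENNReal.ofReal (N * C ^ 2 / (m + 1)) := by
            rw [Finset.sum_const, Finset.card_range, nsmul_eq_mul, mul_left_comm,
              ← ENNReal.ofReal_natCast, ← ENNReal.ofReal_mul (by positivity)]
            congr 2
            push_cast
            field_simp
    have hlim : Filter.Tendsto (fun m : ℕ => W * ENNReal.ofReal (N * C ^ 2 / (m + 1))) Filter.atTop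
        (nhds (W * 0)) := by
      refine ENNReal.Tendsto.const_mul ?_ (Or.inr hWt)
      rw [← ENNReal.ofReal_zero]
      refine ENNReal.tendsto_ofReal ?_
      have := (tendsto_one_div_add_atTop_nhds_zero_nat (𝕜 := ℝ)).const_mul (N * C ^ 2)
      simpa only [mul_one_div, mul_zero] using this
    rw [mul_zero] at hlim
    exact le_antisymm (ge_of_tendsto' hlim hb) (zero_le)
  filter_upwards [ae_all_iff.2 key] with ω hω y hy x hx x' hx' he
  obtain ⟨N, hN⟩ := exists_nat_gt (max (dist x 0) (dist x y))
  exact hω N y hy x hx x' hx' ((le_max_left _ _).trans hN.le) ((le_max_right _ _).trans_lt hN) he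

lemma ae_noTies [IsProbabilityMeasure P] (hd : 1 ≤ d) (hR : IsUnitPoissonProcess P R)
    (hB : IsUnitPoissonProcess P B) (hind : IndepFun R B P) :
    ∀ᵐ ω ∂P, NoTies (support (R ω)) (support (B ω)) := by
  filter_upwards [ae_no_tie hd hR hB hind, ae_no_tie hd hB hR hind.symm] with ω h1 h2
  exact ⟨fun x hx y hy y' hy' e => h2 x hx y hy y' hy' (by rw [dist_comm y, dist_comm y', e]), h1⟩

/-- Almost surely there is no infinite descending chain. -/
lemma ae_noChain [IsProbabilityMeasure P] (hd : 1 ≤ d) (hR : IsUnitPoissonProcess P R)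
    (hB : IsUnitPoissonProcess P B) (hind : IndepFun R B P) :
    ∀ᵐ ω ∂P, NoChain (support (R ω)) (support (B ω)) := by
  have key : ∀ b : ℕ, ∃ ε : ℝ, 0 < ε ∧ ∀ i N : ℕ, i * ε ≤ b → ∀ᵐ ω ∂P,
      ∃ n, ¬ HasPath (support (R ω)) (support (B ω)) n (i * ε) ε N := by
    intro b
    obtain ⟨C, hC, hS⟩ := exists_volume_shell_le hd (b + 2) (by positivity)
    -- This makes `C * ε ≤ 1 / 2`, so the chance of a path with `2 * n` edges in one window is at
    -- most `W * (1 / 2) ^ n`. The width may depend on the bound `b` for the lengths.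
    set ε := 1 / (2 * (C + 1)) with hεdef
    have hε : 0 < ε := by positivity
    have hε1 : ε ≤ 1 := by rw [hεdef, div_le_one (by positivity)]; linarith
    have hCε : C * ε ≤ 1 / 2 := by
      rw [hεdef, mul_one_div, div_le_div_iff₀ (by positivity) (by positivity)]; linarith
    refine ⟨ε, hε, fun i N hi => ?_⟩
    set W := volume (Metric.closedBall (0 : Space d) (N + 1)) with hW
    have hWt : W ≠ ∞ := measure_closedBall_lt_top.ne
    set F := {ω | ¬ ∃ n, ¬ HasPath (support (R ω)) (support (B ω)) n (i * ε) ε N}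
    have hb : ∀ n : ℕ, P F ≤ W * (1 / 2) ^ n := by
      intro n
      have hsub : F ⊆ {ω | HasPath (support (R ω)) (support (B ω)) n (i * ε) ε N} := by
        intro ω hω
        simp only [F, mem_ofPred_eq] at hω
        push Not at hω
        exact hω n
      refine (measure_mono hsub).trans ((measure_hasPath_le hR hB hind hε (fun x =>
        hS (i * ε) ε x (by positivity) hε hε1 (by linarith)) n N).trans ?_)
      have h12 : ENNReal.ofReal (C * ε) ≤ 1 / 2 := by
        refine (ENNReal.ofReal_le_ofReal hCε).trans ?_
        rw [ENNReal.ofReal_div_of_pos (by norm_num)]; simp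
      gcongr
      calc ENNReal.ofReal (C * ε) * ENNReal.ofReal (C * ε) ≤ 1 / 2 * 1 := by
            gcongr; exact h12.trans (by simp)
        _ = 1 / 2 := mul_one _
    have hlim : Filter.Tendsto (fun n : ℕ => W * (1 / 2 : ℝ≥0∞) ^ n) Filter.atTop (nhds (W * 0)) :=
      ENNReal.Tendsto.const_mul (ENNReal.tendsto_pow_atTop_nhds_zero_of_lt_one (by simp))
        (Or.inr hWt)
    rw [mul_zero] at hlim
    exact le_antisymm (ge_of_tendsto' hlim hb) (zero_le)
  choose ε hε key using key
  have hall : ∀ᵐ ω ∂P, ∀ b i N : ℕ, i * ε b ≤ b →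
      ∃ n, ¬ HasPath (support (R ω)) (support (B ω)) n (i * ε b) (ε b) N := by
    rw [ae_all_iff]; intro b; rw [ae_all_iff]; intro i; rw [ae_all_iff]; intro N
    by_cases h : i * ε b ≤ b
    · filter_upwards [key b i N h] with ω hω using fun _ => hω
    · exact Filter.Eventually.of_forall fun ω h' => absurd h' h
  filter_upwards [hall] with ω hω
  rintro ⟨x, y, hx, hy, hxi, hyi, h1, h2⟩
  have hanti : StrictAnti fun n => dist (x n) (y n) :=
    strictAnti_nat_of_succ_lt fun n => (h2 n).trans (h1 n)
  obtain ⟨b, hb⟩ := exists_nat_gt (dist (x 0) (y 0))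
  have hbdd : BddBelow (range fun n => dist (x n) (y n)) := ⟨0, by rintro _ ⟨n, rfl⟩; positivity⟩
  set l := ⨅ n, dist (x n) (y n) with hl
  have hlim := tendsto_atTop_ciInf hanti.antitone hbdd
  have hl0 : 0 ≤ l := le_ciInf fun n => dist_nonneg
  have hle : ∀ n, l ≤ dist (x n) (y n) := fun n => ciInf_le hbdd n
  have hb0 := hε b
  -- The window number `i` contains the limit `l` of the decreasing lengths. From some index `j` on
  -- all edges lie in this window, and the tail of the chain contains paths of every length.
  set i := ⌊l / ε b⌋₊ with hi
  have hi1 : i * ε b ≤ l := by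
    rw [← le_div_iff₀ hb0]; exact Nat.floor_le (by positivity)
  have hi2 : l < i * ε b + ε b := by
    have := Nat.lt_floor_add_one (l / ε b)
    rw [div_lt_iff₀ hb0] at this
    linarith
  obtain ⟨j, hj⟩ := (hlim.eventually (gt_mem_nhds hi2)).exists_forall_of_atTop
  obtain ⟨N, hN⟩ := exists_nat_gt (dist (x j) 0)
  obtain ⟨n, hn⟩ := hω b i N (hi1.trans ((hle 0).trans hb.le))
  refine hn ⟨fun k => x (j + k), fun k => y (j + k), fun k => hx _, fun k => hy _, ?_, ?_, ?_, ?_⟩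
  · intro a b hab
    exact Fin.ext (Nat.add_left_cancel (hxi hab))
  · intro a b hab
    exact Fin.ext (Nat.add_left_cancel (hyi hab))
  · simpa using hN.le
  · intro k
    have a1 := hj (j + k) (by omega)
    have a2 := hle (j + k)
    have a3 := hle (j + k + 1)
    have a4 := h1 (j + k)
    have a5 := h2 (j + k)
    refine ⟨⟨hi1.trans a2, a1⟩, ?_, ?_⟩
    · show _ ≤ dist (x (j + (k + 1))) _
      rw [← add_assoc]; linarith
    · show dist (x (j + (k + 1))) _ < _
      rw [← add_assoc]; exact a4.trans a1

end Paths


/-! ### Moments and volumes -/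

section Moments

open scoped NNReal Nat

/-- The factor `n` cancels against the factorial, leaving `r` times the shifted Poisson weights. -/
lemma hasSum_poisson_mul_natCast (r : ℝ≥0) :
    HasSum (fun n : ℕ => Real.exp (-r) * r ^ n / n ! * n) r := by
  rw [← hasSum_nat_add_iff' 1]
  simp only [Finset.range_one, Finset.sum_singleton, Nat.cast_zero, mul_zero, sub_zero]
  have := (hasSum_one_poissonMeasure r).mul_left (r : ℝ)
  rw [mul_one] at this
  refine this.congr_fun fun n => ?_
  rw [Nat.factorial_succ, pow_succ]
  push_cast
  field_simp

/-- The factorial moment of `n * (n - 1)` is `r * r` by the same shift; then expand `(n - r) ^ 2 = n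
* (n - 1) + (1 - 2 * r) * n + r ^ 2`. -/
lemma hasSum_poisson_mul_sq (r : ℝ≥0) :
    HasSum (fun n : ℕ => Real.exp (-r) * r ^ n / n ! * ((n : ℝ) - r) ^ 2) r := by
  have h2 : HasSum (fun n : ℕ => Real.exp (-r) * r ^ n / n ! * (n * (n - 1))) (r * r) := by
    rw [← hasSum_nat_add_iff' 1]
    simp only [Finset.range_one, Finset.sum_singleton, Nat.cast_zero, zero_mul, mul_zero, sub_zero]
    refine ((hasSum_poisson_mul_natCast r).mul_left (r : ℝ)).congr_fun fun n => ?_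
    rw [Nat.factorial_succ]
    push_cast
    field_simp
    ring
  have h1 := hasSum_poisson_mul_natCast r
  have h0 := hasSum_one_poissonMeasure r
  have := (h2.add (h1.mul_left (1 - 2 * (r : ℝ)))).add (h0.mul_left ((r : ℝ) ^ 2))
  convert! this using 1
  · funext n; ring
  · ring

lemma lintegral_natCast_poissonMeasure (r : ℝ≥0) :
    ∫⁻ n : ℕ, (n : ℝ≥0∞) ∂poissonMeasure r = r := by
  rw [lintegral_countable']
  have : ∀ n : ℕ, (n : ℝ≥0∞) * poissonMeasure r {n} =
      ENNReal.ofReal (Real.exp (-r) * r ^ n / n ! * n) := by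
    intro n
    rw [poissonMeasure_singleton, mul_comm, ENNReal.ofReal_mul (by positivity),
      ENNReal.ofReal_natCast]
  simp_rw [this]
  rw [← ENNReal.ofReal_tsum_of_nonneg (fun n => by positivity) (hasSum_poisson_mul_natCast r).summable,
    (hasSum_poisson_mul_natCast r).tsum_eq, ENNReal.ofReal_coe_nnreal]

lemma lintegral_sq_poissonMeasure (r : ℝ≥0) :
    ∫⁻ n : ℕ, ENNReal.ofReal (((n : ℝ) - r) ^ 2) ∂poissonMeasure r = r := by
  rw [lintegral_countable']
  have : ∀ n : ℕ, ENNReal.ofReal (((n : ℝ) - r) ^ 2) * poissonMeasure r {n} =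
      ENNReal.ofReal (Real.exp (-r) * r ^ n / n ! * ((n : ℝ) - r) ^ 2) := by
    intro n
    rw [poissonMeasure_singleton, mul_comm, ENNReal.ofReal_mul (by positivity)]
  simp_rw [this]
  rw [← ENNReal.ofReal_tsum_of_nonneg (fun n => by positivity) (hasSum_poisson_mul_sq r).summable,
    (hasSum_poisson_mul_sq r).tsum_eq, ENNReal.ofReal_coe_nnreal]

variable {d : ℕ} {Ω : Type*} [MeasurableSpace Ω] {P : Measure Ω} {R : Ω → Measure (Space d)}

lemma IsUnitPoissonProcess.lintegral_apply (h : IsUnitPoissonProcess P R) {A : Set (Space d)}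
    (hA : MeasurableSet A) (hv : volume A ≠ ∞) : ∫⁻ ω, R ω A ∂P = volume A := by
  rw [h.lintegral_comp hA hv (f := fun z => z) measurable_id, lintegral_natCast_poissonMeasure, ENNReal.coe_toNNReal hv]

lemma IsUnitPoissonProcess.lintegral_sq_sub (h : IsUnitPoissonProcess P R) {A : Set (Space d)}
    (hA : MeasurableSet A) (hv : volume A ≠ ∞) :
    ∫⁻ ω, ENNReal.ofReal (((R ω A).toReal - (volume A).toReal) ^ 2) ∂P = volume A := by
  rw [h.lintegral_comp hA hv (f := fun z => ENNReal.ofReal ((z.toReal - (volume A).toReal) ^ 2))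
    (by fun_prop)]
  simp only [ENNReal.toReal_natCast]
  exact (lintegral_sq_poissonMeasure _).trans (ENNReal.coe_toNNReal hv)

lemma measurableSet_box {I : Fin d → Set ℝ} (hI : ∀ i, MeasurableSet (I i)) :
    MeasurableSet {x : Space d | ∀ i, x i ∈ I i} := by
  have : {x : Space d | ∀ i, x i ∈ I i} = ⋂ i, (fun x : Space d => x i) ⁻¹' I i := by ext; simp
  rw [this]
  exact MeasurableSet.iInter fun i => (by fun_prop : Measurable fun x : Space d => x i) (hI i)

lemma volume_box {I : Fin d → Set ℝ} (hI : ∀ i, MeasurableSet (I i)) :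
    volume {x : Space d | ∀ i, x i ∈ I i} = ∏ i, volume (I i) := by
  rw [← volume_pi_pi, ← (EuclideanSpace.volume_preserving_symm_measurableEquiv_toLp
    (Fin d)).measure_preimage (MeasurableSet.univ_pi hI).nullMeasurableSet]
  congr 1
  ext x
  simp

lemma measurableSet_unitCube : MeasurableSet (unitCube d) :=
  measurableSet_box fun _ => measurableSet_Ico

lemma volume_unitCube : volume (unitCube d) = 1 := by
  have := volume_box (d := d) (I := fun _ => Ico 0 1) fun _ => measurableSet_Ico
  simpa [unitCube] using this

end Moments

/-! ### Almost sure existence and uniqueness -/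

/-- A pair of counting measures in general position. -/
structure IsGeneric {d : ℕ} (π ρ : Measure (Space d)) : Prop where
  red : IsCounting π
  blue : IsCounting ρ
  noTies : NoTies (support π) (support ρ)
  noChain : NoChain (support π) (support ρ)

/-- The stable matching of a generic pair of counting measures. -/
def stableMatching {d : ℕ} (π ρ : Measure (Space d)) : Set (Space d × Space d) :=
  {e ∈ support π ×ˢ support ρ | ∃ n, e ∈ selected π ρ n}

section Generic

variable {d : ℕ} {Ω : Type*} [MeasurableSpace Ω] {P : Measure Ω} {R B : Ω → Measure (Space d)}

lemma IsGeneric.isStableMatching_iff {π ρ : Measure (Space d)} (h : IsGeneric π ρ)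
    {m : Set (Space d × Space d)} :
    IsStableMatching (support π) (support ρ) m ↔ m = stableMatching π ρ :=
  isStableMatching_iff_eq_selected h.red.locFinite h.blue.locFinite h.noTies h.noChain
    h.red.null_iff h.blue.null_iff

lemma ae_isGeneric [IsProbabilityMeasure P] (hd : 1 ≤ d) (hR : IsUnitPoissonProcess P R)
    (hB : IsUnitPoissonProcess P B) (hind : IndepFun R B P) :
    ∀ᵐ ω ∂P, IsGeneric (R ω) (B ω) := by
  filter_upwards [hR.ae_isCounting, hB.ae_isCounting, ae_noTies hd hR hB hind,
    ae_noChain hd hR hB hind] with ω h1 h2 h3 h4 using ⟨h1, h2, h3, h4⟩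

end Generic

/-! ### A measurable version of the matching -/

/-- The measures that are finite on bounded sets. -/
def locFiniteMeasures (d : ℕ) : Set (Measure (Space d)) := {π | ∀ n : ℕ, π (Metric.ball 0 n) < ∞}

lemma measurableSet_locFiniteMeasures (d : ℕ) : MeasurableSet (locFiniteMeasures d) := by
  have : locFiniteMeasures d =
      ⋂ n : ℕ, (fun π : Measure (Space d) => π (Metric.ball 0 n)) ⁻¹' Iio ∞ := by
    ext; simp [locFiniteMeasures]
  rw [this]
  exact MeasurableSet.iInter fun n => Measure.measurable_coe measurableSet_ball measurableSet_Iio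

open Classical in
/-- A locally finite measure, viewed as a kernel. -/
noncomputable def locKernel (d : ℕ) : Kernel (Measure (Space d)) (Space d) :=
  Kernel.piecewise (measurableSet_locFiniteMeasures d) ⟨id, measurable_id⟩ 0

section Kernel

variable {d : ℕ}

open Classical in
lemma locKernel_apply {π : Measure (Space d)} (h : IsCounting π) : locKernel d π = π := by
  have : π ∈ locFiniteMeasures d := by
    intro n
    rw [h.apply]
    have := (h.locFinite.inter_closedBall n).subset
      (inter_subset_inter_right _ Metric.ball_subset_closedBall)
    simpa using this
  rw [locKernel, Kernel.piecewise_apply, if_pos this]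
  rfl

-- Cut space into bounded shells, and for each shell cut the measures according to the integer part
-- of its mass. Every piece is a finite kernel, and for each shell exactly one piece is active at a
-- given locally finite measure.
open Classical in
instance : IsSFiniteKernel (locKernel d) := by
  let A : ℕ → Set (Space d) := disjointed fun n : ℕ => Metric.ball (0 : Space d) n
  have hA : ∀ n, MeasurableSet (A n) := MeasurableSet.disjointed fun n => measurableSet_ball
  have hU : ⋃ n, A n = univ := by rw [iUnion_disjointed, Metric.iUnion_ball_nat]
  let L : ℕ × ℕ → Set (Measure (Space d)) := fun p =>
    locFiniteMeasures d ∩ (fun π => π (A p.1)) ⁻¹' Ico (p.2 : ℝ≥0∞) (p.2 + 1)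
  have hL : ∀ p, MeasurableSet (L p) := fun p =>
    (measurableSet_locFiniteMeasures d).inter (Measure.measurable_coe (hA _) measurableSet_Ico)
  let κ : ℕ × ℕ → Kernel (Measure (Space d)) (Space d) := fun p =>
    Kernel.piecewise (hL p) (Kernel.restrict ⟨id, measurable_id⟩ (hA p.1)) 0
  have hκ : ∀ p, IsFiniteKernel (κ p) := by
    intro p
    refine ⟨⟨p.2 + 1, by simp, fun π => ?_⟩⟩
    rw [Kernel.piecewise_apply']
    split_ifs with h
    · rw [Kernel.restrict_apply, Measure.restrict_apply_univ]
      exact h.2.2.le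
    · simp
  have : locKernel d = Kernel.sum κ := by
    ext π s hs
    rw [Kernel.sum_apply' _ _ hs, locKernel, Kernel.piecewise_apply']
    by_cases h : π ∈ locFiniteMeasures d
    · rw [if_pos h, ENNReal.tsum_prod']
      have e : ∀ n, ∑' k, κ (n, k) π s = π (s ∩ A n) := by
        intro n
        have hlt : π (A n) ≠ ∞ := ((measure_mono (disjointed_subset _ n)).trans_lt (h n)).ne
        have hmem : π ∈ L (n, ⌊(π (A n)).toReal⌋₊) := by
          refine ⟨h, ?_, ?_⟩
          · rw [← ENNReal.ofReal_natCast]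
            exact ENNReal.ofReal_le_of_le_toReal (Nat.floor_le ENNReal.toReal_nonneg)
          · have := Nat.lt_floor_add_one (π (A n)).toReal
            have h2 : (((⌊(π (A n)).toReal⌋₊ + 1 : ℕ) : ℝ≥0∞)).toReal =
              (⌊(π (A n)).toReal⌋₊ : ℝ) + 1 := by rw [ENNReal.toReal_natCast]; push_cast; rfl
            rw [← h2, ENNReal.toReal_lt_toReal hlt (by simp)] at this
            simpa using this
        rw [tsum_eq_single ⌊(π (A n)).toReal⌋₊]
        · rw [Kernel.piecewise_apply', if_pos hmem, Kernel.restrict_apply,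
            Measure.restrict_apply hs]
          rfl
        · intro k hk
          rw [Kernel.piecewise_apply', if_neg]
          · simp
          · rintro ⟨-, hk1, hk2⟩
            refine hk ?_
            have h3 : (k : ℝ) ≤ (π (A n)).toReal := by
              have := ENNReal.toReal_mono hlt hk1
              simpa using this
            have h4 : (π (A n)).toReal < k + 1 := by
              have := (ENNReal.toReal_lt_toReal hlt (by simp)).2 hk2
              simpa [ENNReal.toReal_add] using this
            exact ((Nat.floor_eq_iff ENNReal.toReal_nonneg).2 ⟨h3, h4⟩).symm
      simp_rw [e]
      rw [← measure_iUnion (fun i j hij => ((disjoint_disjointed _ hij).mono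
        inter_subset_right inter_subset_right)) (fun n => hs.inter (hA n)), ← inter_iUnion, hU,
        inter_univ]
      rfl
    · rw [if_neg h]
      symm
      simp only [FunLike.coe_zero, Pi.zero_apply, Measure.coe_zero, ENNReal.tsum_eq_zero]
      intro p
      rw [Kernel.piecewise_apply', if_neg fun h' => h h'.1]
      simp
  rw [this]
  infer_instance

/-- Pairs of measures: the red and the blue points. -/
abbrev Conf (d : ℕ) : Type := Measure (Space d) × Measure (Space d)

/-- The red points of a configuration, as a kernel. -/
noncomputable def redKernel (d : ℕ) : Kernel (Conf d) (Space d) :=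
  (locKernel d).comap Prod.fst measurable_fst

/-- The blue points of a configuration, as a kernel. -/
noncomputable def blueKernel (d : ℕ) : Kernel (Conf d) (Space d) :=
  (locKernel d).comap Prod.snd measurable_snd

noncomputable instance : IsSFiniteKernel (redKernel d) := by
  unfold redKernel; infer_instance

noncomputable instance : IsSFiniteKernel (blueKernel d) := by
  unfold blueKernel; infer_instance

/-- For s-finite kernels, the measures of the sections of a measurable set depend measurably on the
parameter, here the configuration together with the edge. -/
lemma measurableSet_beatenBy {A : Conf d → Set (Space d × Space d)}
    (hA : MeasurableSet {p : Conf d × Space d × Space d | p.2 ∈ A p.1}) :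
    MeasurableSet {p : Conf d × Space d × Space d |
      p.2 ∈ beatenBy (redKernel d p.1) (blueKernel d p.1) (A p.1)} := by
  let kb : Kernel (Conf d × Space d × Space d) (Space d) :=
    (blueKernel d).comap Prod.fst measurable_fst
  let kr : Kernel (Conf d × Space d × Space d) (Space d) :=
    (redKernel d).comap Prod.fst measurable_fst
  have m1 : MeasurableSet {q : (Conf d × Space d × Space d) × Space d |
      dist q.1.2.1 q.2 < dist q.1.2.1 q.1.2.2 ∧ (q.1.2.1, q.2) ∈ A q.1.1} := by
    exact (measurableSet_lt (f := fun q : (Conf d × Space d × Space d) × Space d =>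
      dist q.1.2.1 q.2) (g := fun q => dist q.1.2.1 q.1.2.2) (by fun_prop) (by fun_prop)).inter
      ((by fun_prop : Measurable fun q : (Conf d × Space d × Space d) × Space d =>
        (q.1.1, (q.1.2.1, q.2))) hA)
  have m2 : MeasurableSet {q : (Conf d × Space d × Space d) × Space d |
      dist q.2 q.1.2.2 < dist q.1.2.1 q.1.2.2 ∧ (q.2, q.1.2.2) ∈ A q.1.1} := by
    exact (measurableSet_lt (f := fun q : (Conf d × Space d × Space d) × Space d =>
      dist q.2 q.1.2.2) (g := fun q => dist q.1.2.1 q.1.2.2) (by fun_prop) (by fun_prop)).inter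
      ((by fun_prop : Measurable fun q : (Conf d × Space d × Space d) × Space d =>
        (q.1.1, (q.2, q.1.2.2))) hA)
  have h1 := Kernel.measurable_kernel_prodMk_left (κ := kb) m1 (measurableSet_singleton 0).compl
  have h2 := Kernel.measurable_kernel_prodMk_left (κ := kr) m2 (measurableSet_singleton 0).compl
  exact h1.union h2

lemma measurableSet_selected (n : ℕ) : MeasurableSet {p : Conf d × Space d × Space d |
    p.2 ∈ selected (redKernel d p.1) (blueKernel d p.1) n} := by
  induction n with
  | zero => simp [selected]
  | succ n ih =>
    have h1 : MeasurableSet {p : Conf d × Space d × Space d | p.2 ∈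
        (beatenBy (redKernel d p.1) (blueKernel d p.1)
          (selected (redKernel d p.1) (blueKernel d p.1) n))ᶜ} :=
      (measurableSet_beatenBy (A := fun c => selected (redKernel d c) (blueKernel d c) n) ih).compl
    exact (measurableSet_beatenBy (A := fun c => (beatenBy (redKernel d c) (blueKernel d c)
      (selected (redKernel d c) (blueKernel d c) n))ᶜ) h1).compl

/-- The triples of a configuration and two points matched in it. -/
def selectedPairs (d : ℕ) : Set (Conf d × Space d × Space d) :=
  {p | ∃ n, p.2 ∈ selected (redKernel d p.1) (blueKernel d p.1) n}

lemma measurableSet_selectedPairs : MeasurableSet (selectedPairs d) := by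
  have : selectedPairs d = ⋃ n, {p : Conf d × Space d × Space d |
      p.2 ∈ selected (redKernel d p.1) (blueKernel d p.1) n} := by
    ext; simp [selectedPairs]
  rw [this]
  exact MeasurableSet.iUnion measurableSet_selected

lemma mem_stableMatching_iff {π ρ : Measure (Space d)} (h : IsGeneric π ρ) {x y : Space d}
    (hx : x ∈ support π) (hy : y ∈ support ρ) :
    (x, y) ∈ stableMatching π ρ ↔ ((π, ρ), x, y) ∈ selectedPairs d := by
  have e1 : redKernel d (π, ρ) = π := locKernel_apply h.red
  have e2 : blueKernel d (π, ρ) = ρ := locKernel_apply h.blue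
  simp only [stableMatching, selectedPairs, mem_ofPred_eq, e1, e2, mem_prod, hx, hy, and_self,
    true_and]

open Classical in
/-- The matching distance as a measurable function of the configuration and the red point. -/
noncomputable def matchDist (p : Conf d × Space d) : ℝ≥0∞ :=
  if blueKernel d p.1 {y | (p.1, p.2, y) ∈ selectedPairs d} = 0 then ∞
  else ∫⁻ y, {y | (p.1, p.2, y) ∈ selectedPairs d}.indicator (fun y => edist p.2 y) y
    ∂blueKernel d p.1

lemma measurable_matchDist : Measurable (matchDist (d := d)) := by
  classical
  let kb : Kernel (Conf d × Space d) (Space d) := (blueKernel d).comap Prod.fst measurable_fst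
  have m1 : MeasurableSet {q : (Conf d × Space d) × Space d |
      (q.1.1, q.1.2, q.2) ∈ selectedPairs d} :=
    (by fun_prop : Measurable fun q : (Conf d × Space d) × Space d => (q.1.1, (q.1.2, q.2)))
      measurableSet_selectedPairs
  have h1 := Kernel.measurable_kernel_prodMk_left (κ := kb) m1 (measurableSet_singleton 0)
  have h2 : Measurable fun p : Conf d × Space d => ∫⁻ y,
      {q : (Conf d × Space d) × Space d | (q.1.1, q.1.2, q.2) ∈ selectedPairs d}.indicator
        (fun q => edist q.1.2 q.2) (p, y) ∂kb p := by
    refine Measurable.lintegral_kernel_prod_right (f := fun p y =>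
      {q : (Conf d × Space d) × Space d | (q.1.1, q.1.2, q.2) ∈ selectedPairs d}.indicator
        (fun q => edist q.1.2 q.2) (p, y)) ?_
    exact Measurable.indicator (by fun_prop) m1
  exact Measurable.ite h1 measurable_const h2

/-- At most one blue point is selected for `x`. If there is one, the integral has the single term
given by its distance; otherwise the first branch gives `∞`. -/
lemma matchDist_eq {π ρ : Measure (Space d)} (h : IsGeneric π ρ) {x : Space d}
    (hx : x ∈ support π) : matchDist ((π, ρ), x) = redDist (stableMatching π ρ) x := by
  classical
  have e2 : blueKernel d (π, ρ) = ρ := locKernel_apply h.blue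
  have hm := (h.isStableMatching_iff.2 rfl).partialMatching
  rw [matchDist]
  simp only [e2]
  split_ifs with h0
  · rw [h.blue.null_iff] at h0
    refine (redDist_eq_top fun y hy => ?_).symm
    exact h0 y (hm.subset hy).2 ((mem_stableMatching_iff h hx (hm.subset hy).2).1 hy)
  · rw [h.blue.null_iff] at h0
    push Not at h0
    obtain ⟨y, hy, hs⟩ := h0
    have hxy := (mem_stableMatching_iff h hx hy).2 hs
    have hmeas : MeasurableSet {y | ((π, ρ), x, y) ∈ selectedPairs d} :=
      (by fun_prop : Measurable fun y : Space d => ((π, ρ), (x, y))) measurableSet_selectedPairs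
    rw [hm.redDist_eq hxy, lintegral_indicator hmeas]
    have : support ρ ∩ {y | ((π, ρ), x, y) ∈ selectedPairs d} = {y} := by
      ext y'
      constructor
      · rintro ⟨h1, h2⟩
        exact hm.red_unique x y' y ((mem_stableMatching_iff h hx h1).2 h2) hxy
      · rintro rfl
        exact ⟨hy, hs⟩
    rw [((h.blue.restrict hmeas).1).eq, (h.blue.restrict hmeas).2, this]
    simp

end Kernel


/-! ### Stable matchings under translation -/

section Translation

variable {d : ℕ}

/-- The translate of a set of pairs. -/
def translatePairs (t : Space d) (m : Set (Space d × Space d)) : Set (Space d × Space d) :=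
  {p | (p.1 + -t, p.2 + -t) ∈ m}

lemma redDist_translatePairs (t : Space d) (m : Set (Space d × Space d)) (x : Space d) :
    redDist (translatePairs t m) x = redDist m (x + -t) := by
  unfold redDist translatePairs
  rw [← (Equiv.addRight (-t)).iInf_comp (g := fun y => ⨅ (_ : (x + -t, y) ∈ m), edist (x + -t) y)]
  simp [edist_add_right]

lemma blueDist_translatePairs (t : Space d) (m : Set (Space d × Space d)) (x : Space d) :
    blueDist (translatePairs t m) x = blueDist m (x + -t) := by
  unfold blueDist translatePairs
  rw [← (Equiv.addRight (-t)).iInf_comp (g := fun y => ⨅ (_ : (y, x + -t) ∈ m), edist y (x + -t))]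
  simp [edist_add_right]

lemma IsStableMatching.translate {U V : Set (Space d)} {m : Set (Space d × Space d)}
    (h : IsStableMatching U V m) (t : Space d) :
    IsStableMatching ((· + t) '' U) ((· + t) '' V) (translatePairs t m) := by
  rw [image_add_right, image_add_right]
  refine ⟨⟨fun p hp => h.partialMatching.subset hp, fun x y y' h1 h2 => ?_,
    fun x x' y h1 h2 => ?_⟩, fun x hx y hy => ?_⟩
  · exact add_right_cancel (h.partialMatching.red_unique _ _ _ h1 h2)
  · exact add_right_cancel (h.partialMatching.blue_unique _ _ _ h1 h2)
  · rw [redDist_translatePairs, blueDist_translatePairs, ← edist_add_right x y (-t)]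
    exact h.stable _ hx _ hy

end Translation

/-! ### The mean measure of marked points -/

section Campbell

variable {d : ℕ} {Ω : Type*} [MeasurableSpace Ω] {P : Measure Ω} {R B : Ω → Measure (Space d)}

/-- The mean measure of the red points marked with their matching distance. -/
noncomputable def markedIntensity (μ : Measure (Conf d)) : Measure (Space d × ℝ≥0∞) :=
  (μ ⊗ₘ redKernel d).map fun p => (p.2, matchDist p)

/-- The red points with mark in `G`. -/
def markedPoints (U : Set (Space d)) (m : Set (Space d × Space d)) (G : Set (Space d × ℝ≥0∞)) :
    Set (Space d) := {x | x ∈ U ∧ (x, redDist m x) ∈ G}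

lemma IsGeneric.encard_markedPoints {π ρ : Measure (Space d)} (h : IsGeneric π ρ)
    {m : Set (Space d × Space d)} (hm : IsStableMatching (support π) (support ρ) m)
    (G : Set (Space d × ℝ≥0∞)) :
    ((markedPoints (support π) m G).encard : ℝ≥0∞) =
      redKernel d (π, ρ) {x | (x, matchDist ((π, ρ), x)) ∈ G} := by
  rw [h.isStableMatching_iff] at hm
  have e1 : redKernel d (π, ρ) = π := locKernel_apply h.red
  rw [e1, h.red.apply]
  congr 2
  ext x
  simp only [markedPoints, mem_ofPred_eq, mem_inter_iff]
  refine and_congr_right fun hx => ?_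
  rw [matchDist_eq h hx, hm]

lemma measurable_redKernel_marked {G : Set (Space d × ℝ≥0∞)} (hG : MeasurableSet G) :
    Measurable fun c : Conf d => redKernel d c {x | (x, matchDist (c, x)) ∈ G} := by
  have hm : MeasurableSet {p : Conf d × Space d | (p.2, matchDist p) ∈ G} :=
    (measurable_snd.prodMk measurable_matchDist) hG
  exact Kernel.measurable_kernel_prodMk_left hm

lemma ae_encard_markedPoints [IsProbabilityMeasure P] (hd : 1 ≤ d) (hR : IsUnitPoissonProcess P R)
    (hB : IsUnitPoissonProcess P B) (hind : IndepFun R B P) {M : Ω → Set (Space d × Space d)}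
    (hM : ∀ᵐ ω ∂P, IsStableMatching (support (R ω)) (support (B ω)) (M ω))
    (G : Set (Space d × ℝ≥0∞)) :
    (fun ω => ((markedPoints (support (R ω)) (M ω) G).encard : ℝ≥0∞)) =ᵐ[P]
      fun ω => redKernel d (R ω, B ω) {x | (x, matchDist ((R ω, B ω), x)) ∈ G} := by
  filter_upwards [ae_isGeneric hd hR hB hind, hM] with ω h hm
  exact h.encard_markedPoints hm G

lemma aemeasurable_encard_markedPoints [IsProbabilityMeasure P] (hd : 1 ≤ d)
    (hR : IsUnitPoissonProcess P R) (hB : IsUnitPoissonProcess P B) (hind : IndepFun R B P)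
    {M : Ω → Set (Space d × Space d)}
    (hM : ∀ᵐ ω ∂P, IsStableMatching (support (R ω)) (support (B ω)) (M ω))
    {G : Set (Space d × ℝ≥0∞)} (hG : MeasurableSet G) :
    AEMeasurable (fun ω => ((markedPoints (support (R ω)) (M ω) G).encard : ℝ≥0∞)) P :=
  ⟨_, (measurable_redKernel_marked hG).comp (hR.measurable.prodMk hB.measurable),
    ae_encard_markedPoints hd hR hB hind hM G⟩

lemma lintegral_encard_markedPoints [IsProbabilityMeasure P] (hd : 1 ≤ d)
    (hR : IsUnitPoissonProcess P R) (hB : IsUnitPoissonProcess P B) (hind : IndepFun R B P)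
    {M : Ω → Set (Space d × Space d)}
    (hM : ∀ᵐ ω ∂P, IsStableMatching (support (R ω)) (support (B ω)) (M ω))
    {G : Set (Space d × ℝ≥0∞)} (hG : MeasurableSet G) :
    ∫⁻ ω, ((markedPoints (support (R ω)) (M ω) G).encard : ℝ≥0∞) ∂P =
      markedIntensity (P.map fun ω => (R ω, B ω)) G := by
  have hRB := hR.measurable.prodMk hB.measurable
  have hmm : Measurable fun p : Conf d × Space d => (p.2, matchDist p) :=
    measurable_snd.prodMk measurable_matchDist
  have : IsProbabilityMeasure (P.map fun ω => (R ω, B ω)) :=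
    Measure.isProbabilityMeasure_map hRB.aemeasurable
  rw [lintegral_congr_ae (ae_encard_markedPoints hd hR hB hind hM G), markedIntensity,
    Measure.map_apply hmm hG, Measure.compProd_apply (hmm hG),
    lintegral_map (Kernel.measurable_kernel_prodMk_left (hmm hG)) hRB]
  rfl

/-- The translated pair of processes has the same law, and its stable matching is the translated
one, with the same distances. -/
lemma markedIntensity_translate [IsProbabilityMeasure P] (hd : 1 ≤ d)
    (hR : IsUnitPoissonProcess P R) (hB : IsUnitPoissonProcess P B) (hind : IndepFun R B P)
    {M : Ω → Set (Space d × Space d)}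
    (hM : ∀ᵐ ω ∂P, IsStableMatching (support (R ω)) (support (B ω)) (M ω)) (t : Space d)
    {G : Set (Space d × ℝ≥0∞)} (hG : MeasurableSet G) :
    markedIntensity (P.map fun ω => (R ω, B ω)) {p | (p.1 + t, p.2) ∈ G} =
      markedIntensity (P.map fun ω => (R ω, B ω)) G := by
  have hR' := hR.map_add t
  have hB' := hB.map_add t
  have hind' : IndepFun (fun ω => (R ω).map (· + t)) (fun ω => (B ω).map (· + t)) P :=
    hind.comp (measurable_map_add t) (measurable_map_add t)
  have hlaw : P.map (fun ω => ((R ω).map (· + t), (B ω).map (· + t))) =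
      P.map fun ω => (R ω, B ω) := by
    rw [(indepFun_iff_map_prod_eq_prod_map_map hR'.measurable.aemeasurable
      hB'.measurable.aemeasurable).1 hind', (indepFun_iff_map_prod_eq_prod_map_map
      hR.measurable.aemeasurable hB.measurable.aemeasurable).1 hind, hR'.map_eq hR, hB'.map_eq hB]
  have hM' : ∀ᵐ ω ∂P, IsStableMatching (support ((R ω).map (· + t))) (support ((B ω).map (· + t)))
      (translatePairs t (M ω)) := by
    filter_upwards [hM, hR.ae_isCounting, hB.ae_isCounting] with ω h h1 h2
    rw [(h1.map_add t).2, (h2.map_add t).2]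
    exact h.translate t
  have hpre : {p : Space d × ℝ≥0∞ | (p.1 + t, p.2) ∈ G} =
    (fun p : Space d × ℝ≥0∞ => (p.1 + t, p.2)) ⁻¹' G := rfl
  rw [hpre, ← lintegral_encard_markedPoints hd hR hB hind hM
    ((by fun_prop : Measurable fun p : Space d × ℝ≥0∞ => (p.1 + t, p.2)) hG)]
  conv_rhs => rw [← hlaw]
  rw [← lintegral_encard_markedPoints hd hR' hB' hind' hM' hG]
  refine lintegral_congr_ae ?_
  filter_upwards [hR.ae_isCounting] with ω h1
  rw [(h1.map_add t).2]
  congr 1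
  rw [← (add_left_injective t).encard_image]
  congr 1
  ext x
  rw [image_add_right, image_add_right]
  simp only [markedPoints, mem_preimage, mem_ofPred_eq, redDist_translatePairs, neg_add_cancel_right]

/-- The Campbell formula for red points marked with their distance in the stable matching: the
mean measure is the product of the volume and the law of the typical distance. -/
theorem exists_typicalLaw [IsProbabilityMeasure P] (hd : 1 ≤ d)
    (hR : IsUnitPoissonProcess P R) (hB : IsUnitPoissonProcess P B) (hind : IndepFun R B P)
    {M : Ω → Set (Space d × Space d)}
    (hM : ∀ᵐ ω ∂P, IsStableMatching (support (R ω)) (support (B ω)) (M ω)) :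
    ∃ ν : Measure ℝ≥0∞, IsProbabilityMeasure ν ∧ ∀ G : Set (Space d × ℝ≥0∞), MeasurableSet G →
      ∫⁻ ω, ((markedPoints (support (R ω)) (M ω) G).encard : ℝ≥0∞) ∂P =
        ((volume : Measure (Space d)).prod ν) G := by
  set Λ := markedIntensity (P.map fun ω => (R ω, B ω)) with hΛ
  have huniv : ∀ A : Set (Space d), MeasurableSet A → volume A ≠ ∞ → Λ (A ×ˢ univ) = volume A := by
    intro A hA hv
    rw [hΛ, ← lintegral_encard_markedPoints hd hR hB hind hM (hA.prod MeasurableSet.univ),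
      ← hR.lintegral_apply hA hv]
    refine lintegral_congr_ae ?_
    filter_upwards [hR.ae_isCounting] with ω h
    rw [h.apply]
    congr 2
    ext x
    simp [markedPoints]
  -- For a fixed set `T` of marks, the mean measure is translation invariant and finite on compact
  -- sets, hence a multiple of Lebesgue measure; the unit cube reads off the factor.
  have hT : ∀ T : Set ℝ≥0∞, MeasurableSet T → ∀ A : Set (Space d), MeasurableSet A →
      Λ (A ×ˢ T) = volume A * Λ (unitCube d ×ˢ T) := by
    intro T hT
    let κ : Measure (Space d) := (Λ.restrict (univ ×ˢ T)).map Prod.fst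
    have hκ : ∀ A, MeasurableSet A → κ A = Λ (A ×ˢ T) := by
      intro A hA
      rw [Measure.map_apply measurable_fst hA, Measure.restrict_apply (measurable_fst hA)]
      congr 1
      ext p
      simp
    have hfin : IsFiniteMeasureOnCompacts κ := by
      refine ⟨fun K hK => ?_⟩
      rw [hκ K hK.measurableSet]
      calc Λ (K ×ˢ T) ≤ Λ (K ×ˢ univ) := measure_mono (prod_mono_right (subset_univ T))
        _ = volume K := huniv K hK.measurableSet hK.measure_lt_top.ne
        _ < ∞ := hK.measure_lt_top
    have hinv : κ.IsAddLeftInvariant := by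
      refine ⟨fun t => ?_⟩
      ext A hA
      rw [Measure.map_apply (measurable_const_add t) hA, hκ _ (measurable_const_add t hA), hκ A hA,
        hΛ, ← markedIntensity_translate hd hR hB hind hM t (hA.prod hT)]
      congr 1
      ext p
      simp [add_comm]
    have he := Measure.isAddLeftInvariant_eq_smul κ (volume : Measure (Space d))
    intro A hA
    rw [← hκ A hA, ← hκ _ measurableSet_unitCube, he]
    rw [Measure.smul_apply, Measure.smul_apply, volume_unitCube, ENNReal.smul_def,
      ENNReal.smul_def, smul_eq_mul, smul_eq_mul, mul_one, mul_comm]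
  let ν : Measure ℝ≥0∞ := (Λ.restrict (unitCube d ×ˢ univ)).map Prod.snd
  have hν : ∀ T, MeasurableSet T → ν T = Λ (unitCube d ×ˢ T) := by
    intro T hT
    rw [Measure.map_apply measurable_snd hT, Measure.restrict_apply (measurable_snd hT)]
    congr 1
    ext p
    simp only [mem_inter_iff, mem_preimage, mem_prod, mem_univ, and_true]
    exact and_comm
  have hprob : IsProbabilityMeasure ν := by
    refine ⟨?_⟩
    rw [hν _ MeasurableSet.univ, huniv _ measurableSet_unitCube (by simp [volume_unitCube]),
      volume_unitCube]
  refine ⟨ν, hprob, fun G hG => ?_⟩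
  rw [lintegral_encard_markedPoints hd hR hB hind hM hG, ← hΛ,
    Measure.prod_eq fun A T hA hT' => by rw [hT T hT' A hA, hν T hT']]

-- The embedding of `ℕ∞` into `ℝ≥0∞` has a measurable left inverse.
open Classical in
lemma aemeasurable_of_toENNReal {f : Ω → ℕ∞} (h : AEMeasurable (fun a => (f a : ℝ≥0∞)) P) :
    AEMeasurable f P := by
  let g : ℝ≥0∞ → ℕ∞ := fun z => if z = ∞ then ⊤ else (⌊z.toNNReal⌋₊ : ℕ∞)
  have hgm : Measurable g := by
    refine Measurable.ite (measurableSet_singleton ∞) measurable_const ?_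
    exact (measurable_from_top (f := fun n : ℕ => (n : ℕ∞))).comp
      (Nat.measurable_floor.comp ENNReal.measurable_toNNReal)
  have hg : ∀ k : ℕ∞, g k = k := by
    intro k
    induction k using ENat.recTopCoe with
    | top => simp [g]
    | coe n => simp [g]
  have := hgm.comp_aemeasurable h
  simpa only [Function.comp_def, hg] using this

/-- Pairs of a matching are counted by their red points: count those for which the set of blue
points selected with them inside `S` is not null. Measurability of sections is applied twice, for
blue and then for red. -/
lemma aemeasurable_encard_inter [IsProbabilityMeasure P] (hd : 1 ≤ d)
    (hR : IsUnitPoissonProcess P R) (hB : IsUnitPoissonProcess P B) (hind : IndepFun R B P)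
    {M : Ω → Set (Space d × Space d)}
    (hM : ∀ᵐ ω ∂P, IsStableMatching (support (R ω)) (support (B ω)) (M ω))
    {S : Set (Space d × Space d)} (hS : MeasurableSet S) :
    AEMeasurable (fun ω => (M ω ∩ S).encard) P := by
  refine aemeasurable_of_toENNReal ?_
  let kb : Kernel (Conf d × Space d) (Space d) := (blueKernel d).comap Prod.fst measurable_fst
  have m1 : MeasurableSet {q : (Conf d × Space d) × Space d |
      (q.1.1, q.1.2, q.2) ∈ selectedPairs d ∧ (q.1.2, q.2) ∈ S} :=
    ((by fun_prop : Measurable fun q : (Conf d × Space d) × Space d => (q.1.1, (q.1.2, q.2)))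
      measurableSet_selectedPairs).inter
    ((by fun_prop : Measurable fun q : (Conf d × Space d) × Space d => (q.1.2, q.2)) hS)
  have h1 := Kernel.measurable_kernel_prodMk_left (κ := kb) m1 (measurableSet_singleton 0).compl
  have h2 := Kernel.measurable_kernel_prodMk_left (κ := redKernel d) h1
  refine ⟨_, h2.comp (hR.measurable.prodMk hB.measurable), ?_⟩
  filter_upwards [ae_isGeneric hd hR hB hind, hM] with ω h hm
  rw [h.isStableMatching_iff] at hm
  have hp := (h.isStableMatching_iff.2 hm).partialMatching
  have e1 : redKernel d (R ω, B ω) = R ω := locKernel_apply h.red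
  have e2 : blueKernel d (R ω, B ω) = B ω := locKernel_apply h.blue
  rw [Function.comp_apply, e1, h.red.apply]
  congr 1
  have hinj : InjOn Prod.fst (M ω ∩ S) := by
    rintro ⟨x, y⟩ ⟨hxy, -⟩ ⟨x', y'⟩ ⟨hxy', -⟩ (rfl : x = x')
    rw [hp.red_unique _ _ _ hxy hxy']
  rw [← hinj.encard_image]
  congr 1
  ext x
  simp only [mem_image, mem_inter_iff, Prod.exists, exists_and_right, exists_eq_right, mem_preimage]
  constructor
  · rintro ⟨y, hy, hyS⟩
    have hU := hp.subset hy
    refine ⟨hU.1, fun h0 => ?_⟩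
    have h0' : B ω {y | ((R ω, B ω), x, y) ∈ selectedPairs d ∧ (x, y) ∈ S} = 0 := by
      exact (DFunLike.congr_fun e2 _).symm.trans h0
    rw [h.blue.null_iff] at h0'
    rw [hm] at hy
    exact h0' y hU.2 ⟨(mem_stableMatching_iff h hU.1 hU.2).1 hy, hyS⟩
  · rintro ⟨hx, h0⟩
    by_contra hc
    push Not at hc
    refine h0 ?_
    have h0' : B ω {y | ((R ω, B ω), x, y) ∈ selectedPairs d ∧ (x, y) ∈ S} = 0 := by
      rw [h.blue.null_iff]
      rintro y hy ⟨h3, h4⟩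
      refine hc y ?_ h4
      rw [hm]
      exact (mem_stableMatching_iff h hx hy).2 h3
    exact (DFunLike.congr_fun e2 _).trans h0'

end Campbell


/-! ### The matching in a bounded region -/

lemma encard_biUnion_le_sum {ι α : Type*} (s : Finset ι) (f : ι → Set α) :
    (⋃ i ∈ s, f i).encard ≤ ∑ i ∈ s, (f i).encard := by
  classical
  induction s using Finset.induction_on with
  | empty => simp
  | insert a s ha ih =>
    rw [Finset.set_biUnion_insert, Finset.sum_insert ha]
    exact (encard_union_le _ _).trans (by gcongr)

section Region

variable {d : ℕ} {U V : Set (Space d)} {m : Set (Space d × Space d)}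

/-- Points that are matched far away, within a bounded region, have a single color. -/
lemma IsStableMatching.red_far_or_blue_far (h : IsStableMatching U V m) {Q : Set (Space d)}
    {r : ℝ≥0∞} (hQ : ∀ x ∈ Q, ∀ y ∈ Q, edist x y ≤ r) :
    (∀ x ∈ U ∩ Q, redDist m x ≤ r) ∨ ∀ y ∈ V ∩ Q, blueDist m y ≤ r := by
  by_contra! hc
  obtain ⟨⟨x, hx, hxr⟩, y, hy, hyr⟩ := hc
  exact h.stable x hx.1 y hy.1
    (lt_min ((hQ x hx.2 y hy.2).trans_lt hxr) ((hQ x hx.2 y hy.2).trans_lt hyr))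

/-- Counting the two colors in a region that contains no blue point matched far away. -/
lemma IsPartialMatching.encard_far_add_le (h : IsPartialMatching U V m) {Q : Set (Space d)}
    {ρ r : ℝ≥0∞} (hr : r ≠ ∞) (hb : ∀ y ∈ V ∩ Q, blueDist m y ≤ r) :
    {x | x ∈ U ∩ Q ∧ r < redDist m x}.encard + (V ∩ Q).encard ≤
      (U ∩ Q).encard + {y | y ∈ V ∩ Q ∧ ρ < blueDist m y ∧ blueDist m y ≤ r}.encard +
        {y | y ∈ V ∩ Q ∧ blueDist m y ≤ ρ ∧ ∃ x, (x, y) ∈ m ∧ x ∉ Q}.encard := by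
  set g : Set (Space d) := {y | y ∈ V ∩ Q ∧ ∃ x, (x, y) ∈ m ∧ x ∈ Q ∧ edist x y ≤ r} with hg
  set g' : Set (Space d) := {x | x ∈ U ∩ Q ∧ redDist m x ≤ r} with hg'
  set far : Set (Space d) := {x | x ∈ U ∩ Q ∧ r < redDist m x} with hfar
  set mid := {y | y ∈ V ∩ Q ∧ ρ < blueDist m y ∧ blueDist m y ≤ r}
  set cross := {y | y ∈ V ∩ Q ∧ blueDist m y ≤ ρ ∧ ∃ x, (x, y) ∈ m ∧ x ∉ Q}
  -- Each blue point of `Q` is matched within distance `r`: inside `Q`, or at distance more than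
  -- `ρ`, or at distance at most `ρ` across the boundary.
  have h1 : (V ∩ Q).encard ≤ g.encard + mid.encard + cross.encard := by
    refine le_trans (encard_le_encard (t := g ∪ mid ∪ cross) ?_)
      ((encard_union_le _ _).trans (by gcongr; exact encard_union_le _ _))
    intro y hy
    obtain ⟨x, hx, hd⟩ := h.exists_of_blueDist_lt ((hb y hy).trans_lt (lt_top_iff_ne_top.2 hr))
    by_cases hρ : ρ < blueDist m y
    · exact Or.inl (Or.inr ⟨hy, hρ, hb y hy⟩)
    · by_cases hxQ : x ∈ Q
      · exact Or.inl (Or.inl ⟨hy, x, hx, hxQ, hd ▸ hb y hy⟩)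
      · exact Or.inr ⟨hy, not_lt.1 hρ, x, hx, hxQ⟩
  -- The matching injects the blue points matched inside `Q` into the red points of `Q` that are not
  -- far.
  have h2 : g.encard ≤ g'.encard := by
    have hc : ∀ y, ∃ x, y ∈ g → (x, y) ∈ m ∧ x ∈ Q ∧ edist x y ≤ r := by
      intro y
      by_cases hy : y ∈ g
      · obtain ⟨x, hx⟩ := hy.2; exact ⟨x, fun _ => hx⟩
      · exact ⟨0, fun h => absurd h hy⟩
    choose f hf using hc
    refine encard_le_encard_of_injOn (f := f) (fun y hy => ?_) fun y hy y' hy' he => ?_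
    · obtain ⟨a1, a2, a3⟩ := hf y hy
      exact ⟨⟨(h.subset a1).1, a2⟩, (h.redDist_eq a1).trans_le a3⟩
    · have a1 := (hf y hy).1
      have a2 := (hf y' hy').1
      rw [← he] at a2
      exact h.red_unique _ _ _ a1 a2
  have h3 : far.encard + g'.encard ≤ (U ∩ Q).encard := by
    rw [← encard_union_eq]
    · exact encard_le_encard (union_subset (fun x hx => hx.1) fun x hx => hx.1)
    · rw [Set.disjoint_left]
      exact fun x hx hx' => absurd hx.2 (not_lt.2 hx'.2)
  calc far.encard + (V ∩ Q).encard ≤ far.encard + (g'.encard + mid.encard + cross.encard) := by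
        gcongr; exact h1.trans (by gcongr)
    _ = far.encard + g'.encard + mid.encard + cross.encard := by ring
    _ ≤ _ := by gcongr

end Region

/-! ### Laws of marks, fluctuations and boundary terms in cubes -/

section Laws

variable {d : ℕ} {Ω : Type*} [MeasurableSpace Ω] {P : Measure Ω} {R B : Ω → Measure (Space d)}
  {M : Ω → Set (Space d × Space d)} {ν ν' : Measure ℝ≥0∞}

/-- `ν` is the law of the matching distance of a typical red point. -/
structure IsMarkLaw (P : Measure Ω) (R : Ω → Measure (Space d)) (M : Ω → Set (Space d × Space d))
    (ν : Measure ℝ≥0∞) : Prop where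
  prob : IsProbabilityMeasure ν
  aemeasurable : ∀ G : Set (Space d × ℝ≥0∞), MeasurableSet G →
    AEMeasurable (fun ω => ((markedPoints (support (R ω)) (M ω) G).encard : ℝ≥0∞)) P
  lintegral_eq : ∀ G : Set (Space d × ℝ≥0∞), MeasurableSet G →
    ∫⁻ ω, ((markedPoints (support (R ω)) (M ω) G).encard : ℝ≥0∞) ∂P =
      ((volume : Measure (Space d)).prod ν) G

theorem exists_isMarkLaw [IsProbabilityMeasure P] (hd : 1 ≤ d)
    (hR : IsUnitPoissonProcess P R) (hB : IsUnitPoissonProcess P B) (hind : IndepFun R B P)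
    (hM : ∀ᵐ ω ∂P, IsStableMatching (support (R ω)) (support (B ω)) (M ω)) :
    ∃ ν, IsMarkLaw P R M ν := by
  obtain ⟨ν, h1, h2⟩ := exists_typicalLaw hd hR hB hind hM
  exact ⟨ν, h1, fun G hG => aemeasurable_encard_markedPoints hd hR hB hind hM hG, h2⟩

/-- The cube `[0,L)^d`. -/
def cube (d : ℕ) (L : ℝ) : Set (Space d) := {x | ∀ i, x i ∈ Ico 0 L}

lemma measurableSet_cube (L : ℝ) : MeasurableSet (cube d L) :=
  measurableSet_box fun _ => measurableSet_Ico

lemma volume_cube (L : ℕ) : volume (cube d L) = (L : ℝ≥0∞) ^ d := by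
  have := volume_box (d := d) (I := fun _ => Ico 0 (L : ℝ)) fun _ => measurableSet_Ico
  simpa [cube] using this

lemma edist_le_of_mem_cube {L : ℕ} {x y : Space d} (hx : x ∈ cube d L) (hy : y ∈ cube d L) :
    edist x y ≤ d * L := by
  have hc : ∀ i, dist (x i) (y i) ≤ L := by
    intro i
    rw [Real.dist_eq, abs_le]
    have := hx i; have := hy i
    simp only [mem_Ico] at *
    constructor <;> linarith
  have : dist x y ≤ d * L := by
    rw [EuclideanSpace.dist_eq]
    calc √(∑ i, dist (x i) (y i) ^ 2) ≤ √((∑ i, dist (x i) (y i)) ^ 2) := by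
          gcongr
          exact Finset.sum_sq_le_sq_sum_of_nonneg fun i _ => dist_nonneg
      _ = ∑ i, dist (x i) (y i) := Real.sqrt_sq (Finset.sum_nonneg fun i _ => dist_nonneg)
      _ ≤ ∑ _i : Fin d, (L : ℝ) := Finset.sum_le_sum fun i _ => hc i
      _ = d * L := by simp
  rw [edist_dist]
  refine (ENNReal.ofReal_le_ofReal this).trans ?_
  rw [ENNReal.ofReal_mul (by positivity), ENNReal.ofReal_natCast, ENNReal.ofReal_natCast]

/-- The mean deviation of the number of points. -/
lemma IsUnitPoissonProcess.lintegral_abs_sub_le (h : IsUnitPoissonProcess P R) {A : Set (Space d)}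
    (hA : MeasurableSet A) (hv : volume A ≠ ∞) (hv0 : volume A ≠ 0) :
    ∫⁻ ω, ENNReal.ofReal |(R ω A).toReal - (volume A).toReal| ∂P ≤
      ENNReal.ofReal √(volume A).toReal := by
  set v := (volume A).toReal with hvd
  have hvp : 0 < v := ENNReal.toReal_pos hv0 hv
  have hs : 0 < √v := Real.sqrt_pos.2 hvp
  have hP : IsProbabilityMeasure P := by
    have h1 := h.lintegral_comp hA hv (f := fun _ => 1) measurable_const
    simp only [lintegral_const, measure_univ, mul_one, one_mul] at h1
    exact ⟨h1⟩
  -- With `a` the deviation, `a ≤ a ^ 2 / (2 * √v) + √v / 2`; as the variance is `v`, both terms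
  -- have mean `√v / 2`.
  have hpt : ∀ ω, ENNReal.ofReal |(R ω A).toReal - v| ≤
      ENNReal.ofReal (1 / (2 * √v)) * ENNReal.ofReal (((R ω A).toReal - v) ^ 2) +
        ENNReal.ofReal (√v / 2) := by
    intro ω
    rw [← ENNReal.ofReal_mul (by positivity), ← ENNReal.ofReal_add (by positivity) (by positivity)]
    refine ENNReal.ofReal_le_ofReal ?_
    rw [← sq_abs]
    set a := |(R ω A).toReal - v|
    have : 0 ≤ (a - √v) ^ 2 / (2 * √v) := by positivity
    have e : (a - √v) ^ 2 / (2 * √v) = 1 / (2 * √v) * a ^ 2 + √v / 2 - a := by field_simp; ring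
    linarith
  refine (lintegral_mono hpt).trans ?_
  rw [lintegral_add_right _ measurable_const, lintegral_const_mul' _ _ ENNReal.ofReal_ne_top,
    h.lintegral_sq_sub hA hv, lintegral_const, measure_univ, mul_one,
    ← ENNReal.ofReal_toReal hv, ← hvd, ← ENNReal.ofReal_mul (by positivity),
    ← ENNReal.ofReal_add (by positivity) (by positivity)]
  refine ENNReal.ofReal_le_ofReal (le_of_eq ?_)
  have := Real.mul_self_sqrt hvp.le
  field_simp
  nlinarith

lemma IsMarkLaw.lintegral_prod (h : IsMarkLaw P R M ν) {A : Set (Space d)} (hA : MeasurableSet A)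
    {T : Set ℝ≥0∞} (hT : MeasurableSet T) :
    ∫⁻ ω, ((markedPoints (support (R ω)) (M ω) (A ×ˢ T)).encard : ℝ≥0∞) ∂P = volume A * ν T := by
  have := h.prob
  rw [h.lintegral_eq _ (hA.prod hT), Measure.prod_prod]

/-- Points of the cube that are at distance at most their mark from a given face. -/
lemma IsMarkLaw.lintegral_face_le (h : IsMarkLaw P R M ν) {L : ℕ} {ρ : ℝ≥0∞} (hρ : ρ ≠ ∞)
    (i : Fin d) {a : ℝ → ℝ} (ha : Measurable a) (hvol : ∀ t : ℝ≥0∞, t ≠ ∞ →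
      volume {s : ℝ | s ∈ Ico (0 : ℝ) L ∧ ENNReal.ofReal (a s) ≤ t} ≤ t) :
    ∫⁻ ω, ((markedPoints (support (R ω)) (M ω)
      {p | p.1 ∈ cube d L ∧ ENNReal.ofReal (a (p.1 i)) ≤ p.2 ∧ p.2 ≤ ρ}).encard : ℝ≥0∞) ∂P ≤
        (L : ℝ≥0∞) ^ (d - 1) * ∫⁻ t in Iic ρ, t ∂ν := by
  classical
  have := h.prob
  have hcoord : Measurable fun p : Space d × ℝ≥0∞ => p.1 i :=
    (by fun_prop : Measurable fun x : Space d => x i).comp measurable_fst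
  have hG : MeasurableSet {p : Space d × ℝ≥0∞ |
      p.1 ∈ cube d L ∧ ENNReal.ofReal (a (p.1 i)) ≤ p.2 ∧ p.2 ≤ ρ} := by
    refine MeasurableSet.inter (measurable_fst (measurableSet_cube (L : ℝ))) ?_
    exact (measurableSet_le ((ha.comp hcoord).ennreal_ofReal) measurable_snd).inter
      (measurable_snd measurableSet_Iic)
  -- For each mark `t ≤ ρ` the admissible positions form a slab of thickness at most `t` along the
  -- face; then integrate over `ν`.
  rw [h.lintegral_eq _ hG, Measure.prod_apply_symm hG, ← lintegral_const_mul' _ _ (by simp),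
    ← lintegral_indicator measurableSet_Iic]
  refine lintegral_mono fun t => ?_
  by_cases ht : t ≤ ρ
  · rw [indicator_of_mem (show t ∈ Iic ρ from ht)]
    have htt : t ≠ ∞ := ne_top_of_le_ne_top hρ ht
    let I : Fin d → Set ℝ := fun j =>
      if j = i then {s : ℝ | s ∈ Ico (0 : ℝ) L ∧ ENNReal.ofReal (a s) ≤ t} else Ico 0 L
    have hI : ∀ j, MeasurableSet (I j) := by
      intro j
      by_cases hj : j = i
      · simp only [I, if_pos hj]
        exact measurableSet_Ico.inter (measurableSet_le ha.ennreal_ofReal measurable_const)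
      · simp only [I, if_neg hj]; exact measurableSet_Ico
    have hsub : (fun x : Space d => (x, t)) ⁻¹' {p : Space d × ℝ≥0∞ |
        p.1 ∈ cube d L ∧ ENNReal.ofReal (a (p.1 i)) ≤ p.2 ∧ p.2 ≤ ρ} ⊆ {x | ∀ j, x j ∈ I j} := by
      rintro x ⟨h1, h2, -⟩ j
      by_cases hj : j = i
      · subst hj
        simp only [I, if_true]
        exact ⟨h1 j, h2⟩
      · simp only [I, if_neg hj]; exact h1 j
    refine (measure_mono hsub).trans ?_
    rw [volume_box hI, ← Finset.mul_prod_erase _ _ (Finset.mem_univ i), mul_comm]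
    refine mul_le_mul' (le_of_eq ?_) ?_
    · rw [Finset.prod_congr rfl (g := fun _ => (L : ℝ≥0∞))]
      · simp
      · intro j hj
        simp [I, Finset.ne_of_mem_erase hj]
    · simp only [I, if_true]
      exact hvol t htt
  · rw [indicator_of_notMem (show t ∉ Iic ρ from ht)]
    have : (fun x : Space d => (x, t)) ⁻¹' {p : Space d × ℝ≥0∞ |
        p.1 ∈ cube d L ∧ ENNReal.ofReal (a (p.1 i)) ≤ p.2 ∧ p.2 ≤ ρ} = ∅ := by
      ext x; simp [ht]
    rw [this]
    simp

/-- Points of the cube matched across its boundary. -/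
lemma IsMarkLaw.exists_cross_le (h : IsMarkLaw P R M ν)
    (hp : ∀ᵐ ω ∂P, IsPartialMatching (support (R ω)) (support (B ω)) (M ω)) {L : ℕ} {ρ : ℝ≥0∞}
    (hρ : ρ ≠ ∞) :
    ∃ g : Ω → ℝ≥0∞, AEMeasurable g P ∧
      (∀ᵐ ω ∂P, ({x | x ∈ support (R ω) ∩ cube d L ∧ redDist (M ω) x ≤ ρ ∧
        ∃ y, (x, y) ∈ M ω ∧ y ∉ cube d L}.encard : ℝ≥0∞) ≤ g ω) ∧
      ∫⁻ ω, g ω ∂P ≤ 2 * d * ((L : ℝ≥0∞) ^ (d - 1) * ∫⁻ t in Iic ρ, t ∂ν) := by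
  -- The crossing count depends on the position of the partner and not only on the mark. It is
  -- majorized by counts of marked points: some coordinate of the partner leaves `[0, L)`, so the
  -- mark is at least the distance to the lower face (`G1`) or the upper face (`G2`).
  let G1 : Fin d → Set (Space d × ℝ≥0∞) := fun i =>
    {p | p.1 ∈ cube d L ∧ ENNReal.ofReal (p.1 i) ≤ p.2 ∧ p.2 ≤ ρ}
  let G2 : Fin d → Set (Space d × ℝ≥0∞) := fun i =>
    {p | p.1 ∈ cube d L ∧ ENNReal.ofReal (L - p.1 i) ≤ p.2 ∧ p.2 ≤ ρ}
  have hcoord : ∀ i, Measurable fun p : Space d × ℝ≥0∞ => p.1 i := fun i =>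
    (by fun_prop : Measurable fun x : Space d => x i).comp measurable_fst
  have hG1 : ∀ i, MeasurableSet (G1 i) := fun i =>
    MeasurableSet.inter (measurable_fst (measurableSet_cube (L : ℝ)))
      ((measurableSet_le (hcoord i).ennreal_ofReal measurable_snd).inter
      (measurable_snd measurableSet_Iic))
  have hG2 : ∀ i, MeasurableSet (G2 i) := fun i =>
    MeasurableSet.inter (measurable_fst (measurableSet_cube (L : ℝ)))
      ((measurableSet_le ((hcoord i).const_sub _).ennreal_ofReal measurable_snd).inter
      (measurable_snd measurableSet_Iic))
  have hpt : ∀ᵐ ω ∂P, ({x | x ∈ support (R ω) ∩ cube d L ∧ redDist (M ω) x ≤ ρ ∧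
      ∃ y, (x, y) ∈ M ω ∧ y ∉ cube d L}.encard : ℝ≥0∞) ≤
      ∑ i, (((markedPoints (support (R ω)) (M ω) (G1 i)).encard : ℝ≥0∞) +
        ((markedPoints (support (R ω)) (M ω) (G2 i)).encard : ℝ≥0∞)) := by
    filter_upwards [hp] with ω hpω
    have hsub : {x | x ∈ support (R ω) ∩ cube d L ∧ redDist (M ω) x ≤ ρ ∧
        ∃ y, (x, y) ∈ M ω ∧ y ∉ cube d L} ⊆ ⋃ i ∈ (Finset.univ : Finset (Fin d)),
        (markedPoints (support (R ω)) (M ω) (G1 i) ∪ markedPoints (support (R ω)) (M ω) (G2 i)) := by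
      rintro x ⟨⟨hxR, hxQ⟩, hxρ, y, hxy, hyQ⟩
      have : ∃ i, y i ∉ Ico (0 : ℝ) L := by
        by_contra! hc; exact hyQ hc
      obtain ⟨i, hi⟩ := this
      have hdi : |x i - y i| ≤ dist x y := by
        rw [← Real.dist_eq, EuclideanSpace.dist_eq]
        refine Real.le_sqrt_of_sq_le ?_
        exact Finset.single_le_sum (f := fun j => dist (x j) (y j) ^ 2) (fun j _ => sq_nonneg _)
          (Finset.mem_univ i)
      have hxi := hxQ i
      have hmark := hpω.redDist_eq hxy
      simp only [mem_iUnion, Finset.mem_univ, exists_true_left]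
      refine ⟨i, ?_⟩
      rw [mem_Ico, not_and_or, not_le, not_lt] at hi
      have habs := abs_le.1 hdi
      rcases hi with hi | hi
      · left
        refine ⟨hxR, hxQ, ?_, hxρ⟩
        simp only
        rw [hmark, edist_dist]
        exact ENNReal.ofReal_le_ofReal (by linarith)
      · right
        refine ⟨hxR, hxQ, ?_, hxρ⟩
        simp only
        rw [hmark, edist_dist]
        exact ENNReal.ofReal_le_ofReal (by linarith)
    have hle : {x | x ∈ support (R ω) ∩ cube d L ∧ redDist (M ω) x ≤ ρ ∧
        ∃ y, (x, y) ∈ M ω ∧ y ∉ cube d L}.encard ≤ ∑ i,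
        ((markedPoints (support (R ω)) (M ω) (G1 i)).encard +
          (markedPoints (support (R ω)) (M ω) (G2 i)).encard) := by
      refine (encard_le_encard hsub).trans ?_
      exact (encard_biUnion_le_sum _ _).trans (Finset.sum_le_sum fun i _ => encard_union_le _ _)
    have := ENat.toENNReal_mono hle
    refine this.trans (le_of_eq ?_)
    rw [← ENat.toENNRealRingHom_apply, map_sum]
    simp
  have hmeas : ∀ i, AEMeasurable (fun ω =>
      ((markedPoints (support (R ω)) (M ω) (G1 i)).encard : ℝ≥0∞) +
        ((markedPoints (support (R ω)) (M ω) (G2 i)).encard : ℝ≥0∞)) P := fun i =>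
    (h.aemeasurable _ (hG1 i)).add (h.aemeasurable _ (hG2 i))
  refine ⟨_, Finset.aemeasurable_fun_sum _ fun i _ => hmeas i, hpt, ?_⟩
  rw [lintegral_finsetSum' _ fun i _ => hmeas i]
  calc _ ≤ ∑ _i : Fin d, 2 * ((L : ℝ≥0∞) ^ (d - 1) * ∫⁻ t in Iic ρ, t ∂ν) := by
        refine Finset.sum_le_sum fun i _ => ?_
        rw [lintegral_add_left' (h.aemeasurable _ (hG1 i)), two_mul]
        refine add_le_add (h.lintegral_face_le hρ i (a := fun s => s) measurable_id ?_)
          (h.lintegral_face_le hρ i (a := fun s => L - s) (by fun_prop) ?_)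
        · intro t ht
          refine (measure_mono (t := Icc 0 t.toReal) ?_).trans ?_
          · rintro s ⟨h1, h2⟩
            exact ⟨h1.1, (ENNReal.ofReal_le_iff_le_toReal ht).1 h2⟩
          · simp [ht]
        · intro t ht
          refine (measure_mono (t := Icc (L - t.toReal) L) ?_).trans ?_
          · rintro s ⟨h1, h2⟩
            have := (ENNReal.ofReal_le_iff_le_toReal ht).1 h2
            exact ⟨by linarith, h1.2.le⟩
          · simp [ht]
    _ = _ := by
      rw [Finset.sum_const, Finset.card_univ, Fintype.card_fin, nsmul_eq_mul]
      ring

end Laws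


/-! ### The mass transport inequality -/

section MassTransport

variable {d : ℕ} {Ω : Type*} [MeasurableSpace Ω] {P : Measure Ω} {R B : Ω → Measure (Space d)}
  {M : Ω → Set (Space d × Space d)} {ν ν' : Measure ℝ≥0∞}

/-- Both counts `b` and `c` are compared with their common mean `v`; finiteness of `b` allows its
cancellation. -/
lemma le_of_counts_le {a b c e v : ℝ≥0∞} (hb : b ≠ ∞) (hc : c ≠ ∞) (hv : v ≠ ∞)
    (h : a + b ≤ c + e) :
    a ≤ ENNReal.ofReal |c.toReal - v.toReal| + ENNReal.ofReal |b.toReal - v.toReal| + e := by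
  have key : ∀ x y : ℝ≥0∞, x ≠ ∞ → y ≠ ∞ → x ≤ y + ENNReal.ofReal |x.toReal - y.toReal| := by
    intro x y hx hy
    rw [← ENNReal.ofReal_toReal hx, ← ENNReal.ofReal_toReal hy, ENNReal.toReal_ofReal (by simp),
      ENNReal.toReal_ofReal (by simp), ← ENNReal.ofReal_add (by simp) (abs_nonneg _)]
    exact ENNReal.ofReal_le_ofReal (by linarith [le_abs_self (x.toReal - y.toReal)])
  have h1 := key c v hc hv
  have h2 := key v b hv hb
  rw [abs_sub_comm] at h2
  refine (ENNReal.add_le_add_iff_right hb).1 ?_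
  calc a + b ≤ c + e := h
    _ ≤ v + ENNReal.ofReal |c.toReal - v.toReal| + e := by gcongr
    _ ≤ b + ENNReal.ofReal |b.toReal - v.toReal| + ENNReal.ofReal |c.toReal - v.toReal| + e := by
        gcongr
    _ = _ := by ring

/-- Points of `Q` with distance at most `ρ` to their partner, which is outside of `Q`. -/
def crossPoints (U : Set (Space d)) (m : Set (Space d × Space d)) (Q : Set (Space d))
    (ρ : ℝ≥0∞) : Set (Space d) :=
  {x | x ∈ U ∩ Q ∧ redDist m x ≤ ρ ∧ ∃ y, (x, y) ∈ m ∧ y ∉ Q}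

section Deterministic

variable {U V : Set (Space d)} {m : Set (Space d × Space d)} {Q : Set (Space d)} {r ρ v : ℝ≥0∞}

lemma IsPartialMatching.far_add_le (h : IsPartialMatching U V m) (hr : r ≠ ∞)
    (hb : ∀ y ∈ V ∩ Q, blueDist m y ≤ r) :
    ((markedPoints U m (Q ×ˢ Ioi r)).encard : ℝ≥0∞) + ((V ∩ Q).encard : ℝ≥0∞) ≤
      ((U ∩ Q).encard : ℝ≥0∞) +
        (((markedPoints V (Prod.swap ⁻¹' m) (Q ×ˢ Ioc ρ r)).encard : ℝ≥0∞) +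
          ((crossPoints V (Prod.swap ⁻¹' m) Q ρ).encard : ℝ≥0∞)) := by
  have key := ENat.toENNReal_mono (h.encard_far_add_le (ρ := ρ) hr hb)
  rw [ENat.toENNReal_add, ENat.toENNReal_add, ENat.toENNReal_add, add_assoc] at key
  convert! key using 6 <;> ext x <;>
    simp [markedPoints, crossPoints, redDist_swap, and_assoc]

/-- Since one color has no far points, the one-sided count applies to the other. The error terms of
both colors are included so that the bound does not depend on which color it is. -/
lemma IsStableMatching.far_le (h : IsStableMatching U V m) (hQ : ∀ x ∈ Q, ∀ y ∈ Q, edist x y ≤ r)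
    (hr : r ≠ ∞) (hU : ((U ∩ Q).encard : ℝ≥0∞) ≠ ∞) (hV : ((V ∩ Q).encard : ℝ≥0∞) ≠ ∞)
    (hv : v ≠ ∞) :
    ((markedPoints U m (Q ×ˢ Ioi r)).encard : ℝ≥0∞) +
        ((markedPoints V (Prod.swap ⁻¹' m) (Q ×ˢ Ioi r)).encard : ℝ≥0∞) ≤
      ENNReal.ofReal |((U ∩ Q).encard : ℝ≥0∞).toReal - v.toReal| +
        ENNReal.ofReal |((V ∩ Q).encard : ℝ≥0∞).toReal - v.toReal| +
        (((markedPoints U m (Q ×ˢ Ioc ρ r)).encard : ℝ≥0∞) +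
          ((markedPoints V (Prod.swap ⁻¹' m) (Q ×ˢ Ioc ρ r)).encard : ℝ≥0∞)) +
        (((crossPoints U m Q ρ).encard : ℝ≥0∞) +
          ((crossPoints V (Prod.swap ⁻¹' m) Q ρ).encard : ℝ≥0∞)) := by
  have hempty : ∀ {W : Set (Space d)} {m' : Set (Space d × Space d)},
      (∀ x ∈ W ∩ Q, redDist m' x ≤ r) → markedPoints W m' (Q ×ˢ Ioi r) = ∅ := by
    intro W m' hW
    ext x
    simp only [markedPoints, mem_ofPred_eq, mem_prod, mem_Ioi, mem_empty_iff_false, iff_false]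
    rintro ⟨h1, h2, h3⟩
    exact absurd h3 (not_lt.2 (hW x ⟨h1, h2⟩))
  rcases h.red_far_or_blue_far hQ with hc | hc
  · rw [hempty hc]
    have := le_of_counts_le hU hV hv (h.partialMatching.swap.far_add_le (ρ := ρ) hr
      (by simpa only [blueDist_swap] using hc))
    rw [encard_empty, ENat.toENNReal_zero, zero_add]
    refine this.trans ?_
    rw [show Prod.swap ⁻¹' (Prod.swap ⁻¹' m) = m from rfl,
      add_comm (ENNReal.ofReal |((V ∩ Q).encard : ℝ≥0∞).toReal - v.toReal|), ← add_assoc]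
    gcongr ?_ + ?_ + ?_
    · exact le_rfl
    · exact le_self_add
    · exact le_self_add
  · rw [hempty (m' := Prod.swap ⁻¹' m) (by simpa only [redDist_swap] using hc)]
    have := le_of_counts_le hV hU hv (h.partialMatching.far_add_le (ρ := ρ) hr hc)
    rw [encard_empty, ENat.toENNReal_zero, add_zero]
    refine this.trans ?_
    rw [← add_assoc]
    gcongr ?_ + ?_ + ?_
    · exact le_rfl
    · exact le_add_self
    · exact le_add_self

end Deterministic

lemma IsUnitPoissonProcess.ae_apply_ne_top (h : IsUnitPoissonProcess P R) {A : Set (Space d)}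
    (hA : MeasurableSet A) (hv : volume A ≠ ∞) : ∀ᵐ ω ∂P, R ω A ≠ ∞ := by
  have := ae_lt_top' (h.measurable_apply hA).aemeasurable (by rwa [h.lintegral_apply hA hv])
  filter_upwards [this] with ω hω using hω.ne

/-- The mass transport inequality. -/
theorem lintegral_far_le (hR : IsUnitPoissonProcess P R)
    (hB : IsUnitPoissonProcess P B)
    (hM : ∀ᵐ ω ∂P, IsStableMatching (support (R ω)) (support (B ω)) (M ω))
    (h : IsMarkLaw P R M ν) (h' : IsMarkLaw P B (fun ω => Prod.swap ⁻¹' M ω) ν') {L : ℕ}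
    (hL : 1 ≤ L) {r ρ : ℝ≥0∞} (hr : r ≠ ∞) (hρ : ρ ≠ ∞) (hLr : d * L ≤ r) :
    (L : ℝ≥0∞) ^ d * (ν + ν') (Ioi r) ≤ 2 * ENNReal.ofReal √((L : ℝ) ^ d) +
      (L : ℝ≥0∞) ^ d * (ν + ν') (Ioc ρ r) +
        2 * d * ((L : ℝ≥0∞) ^ (d - 1) * ∫⁻ t in Iic ρ, t ∂(ν + ν')) := by
  have hQ : MeasurableSet (cube d L) := measurableSet_cube (L : ℝ)
  have hvol : volume (cube d L) ≠ ∞ := by rw [volume_cube]; finiteness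
  have hvol0 : volume (cube d L) ≠ 0 := by
    rw [volume_cube]; exact pow_ne_zero _ (by exact_mod_cast (by lia : L ≠ 0))
  obtain ⟨g, hg, hg1, hg2⟩ := h.exists_cross_le (B := B) (L := L)
    (hM.mono fun ω hω => hω.partialMatching) hρ
  obtain ⟨g', hg', hg1', hg2'⟩ := h'.exists_cross_le (B := R) (L := L)
    (hM.mono fun ω hω => hω.partialMatching.swap) hρ
  have hpt : ∀ᵐ ω ∂P, ((markedPoints (support (R ω)) (M ω) (cube d L ×ˢ Ioi r)).encard : ℝ≥0∞) +
      ((markedPoints (support (B ω)) (Prod.swap ⁻¹' M ω) (cube d L ×ˢ Ioi r)).encard : ℝ≥0∞) ≤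
      ENNReal.ofReal |(R ω (cube d L)).toReal - (volume (cube d L)).toReal| +
      ENNReal.ofReal |(B ω (cube d L)).toReal - (volume (cube d L)).toReal| +
      (((markedPoints (support (R ω)) (M ω) (cube d L ×ˢ Ioc ρ r)).encard : ℝ≥0∞) +
      ((markedPoints (support (B ω)) (Prod.swap ⁻¹' M ω) (cube d L ×ˢ Ioc ρ r)).encard : ℝ≥0∞)) +
      (g ω + g' ω) := by
    filter_upwards [hM, hR.ae_isCounting, hB.ae_isCounting, hR.ae_apply_ne_top hQ hvol,
      hB.ae_apply_ne_top hQ hvol, hg1, hg1'] with ω h1 h2 h3 h4 h5 h6 h7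
    rw [h2.apply] at h4 ⊢
    rw [h3.apply] at h5 ⊢
    refine (h1.far_le (ρ := ρ) (v := volume (cube d L)) (fun x hx y hy =>
      (edist_le_of_mem_cube hx hy).trans hLr) hr h4 h5 hvol).trans ?_
    gcongr
    · exact h6
    · exact h7
  have mI := h.aemeasurable _ (hQ.prod (measurableSet_Ioi (a := r)))
  have mC := h.aemeasurable _ (hQ.prod (measurableSet_Ioc (a := ρ) (b := r)))
  have mD : AEMeasurable (fun ω => ENNReal.ofReal
      |(R ω (cube d L)).toReal - (volume (cube d L)).toReal|) P := by
    have := hR.measurable_apply hQ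
    fun_prop
  have mD' : AEMeasurable (fun ω => ENNReal.ofReal
      |(B ω (cube d L)).toReal - (volume (cube d L)).toReal|) P := by
    have := hB.measurable_apply hQ
    fun_prop
  have mg : AEMeasurable (fun ω => g ω + g' ω) P := hg.add hg'
  have mDD : AEMeasurable (fun ω => ENNReal.ofReal
      |(R ω (cube d L)).toReal - (volume (cube d L)).toReal| + ENNReal.ofReal
      |(B ω (cube d L)).toReal - (volume (cube d L)).toReal|) P := mD.add mD'
  have key := lintegral_mono_ae hpt
  rw [lintegral_add_left' mI, h.lintegral_prod hQ measurableSet_Ioi,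
    h'.lintegral_prod hQ measurableSet_Ioi, lintegral_add_right' _ mg,
    lintegral_add_left' hg, lintegral_add_left' mDD, lintegral_add_left' mD,
    lintegral_add_left' mC, h.lintegral_prod hQ measurableSet_Ioc,
    h'.lintegral_prod hQ measurableSet_Ioc, volume_cube] at key
  rw [Measure.add_apply, Measure.add_apply, Measure.restrict_add, lintegral_add_measure, mul_add]
  have hd1 := hR.lintegral_abs_sub_le hQ hvol hvol0
  have hd2 := hB.lintegral_abs_sub_le hQ hvol hvol0
  rw [volume_cube] at hd1 hd2
  have hv : (((L : ℝ≥0∞) ^ d).toReal) = (L : ℝ) ^ d := by simp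
  rw [hv] at hd1 hd2 key
  refine key.trans ?_
  rw [two_mul (ENNReal.ofReal _), mul_add ((L : ℝ≥0∞) ^ d), mul_add ((L : ℝ≥0∞) ^ (d - 1)),
    mul_add (2 * (d : ℝ≥0∞))]
  gcongr

end MassTransport


/-! ### Power law tails from the mass transport inequality -/

section Iteration

variable {d : ℕ} {β : Measure ℝ≥0∞}

/-- The mass transport inequality for the sum `β` of the laws of the red and blue distances. -/
def MassTransport (d : ℕ) (β : Measure ℝ≥0∞) : Prop :=
  ∀ L : ℕ, 1 ≤ L → ∀ r ρ : ℝ≥0∞, r ≠ ∞ → ρ ≠ ∞ → d * L ≤ r →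
    (L : ℝ≥0∞) ^ d * β (Ioi r) ≤ 2 * ENNReal.ofReal √((L : ℝ) ^ d) +
      (L : ℝ≥0∞) ^ d * β (Ioc ρ r) + 2 * d * ((L : ℝ≥0∞) ^ (d - 1) * ∫⁻ t in Iic ρ, t ∂β)

/-- The exponent of the tail in dimension `d`. -/
noncomputable def tailExponent (d : ℕ) : ℝ :=
  if d = 1 then 1 / 2 else Real.log (4 / 3) / Real.log (16 * d ^ 2)

lemma setLIntegral_Iic_le (x : ℝ≥0∞) : ∫⁻ t in Iic x, t ∂β ≤ x * β univ := by
  calc ∫⁻ t in Iic x, t ∂β ≤ ∫⁻ _t in Iic x, x ∂β :=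
        setLIntegral_mono measurable_const fun t ht => ht
    _ = x * β (Iic x) := by simp
    _ ≤ _ := by gcongr; exact subset_univ _

lemma setLIntegral_Iic_le_add {x y : ℝ≥0∞} (hxy : x ≤ y) :
    ∫⁻ t in Iic y, t ∂β ≤ ∫⁻ t in Iic x, t ∂β + y * β (Ioi x) := by
  rw [← Iic_union_Ioc_eq_Iic hxy, lintegral_union measurableSet_Ioc
    (Iic_disjoint_Ioc le_rfl)]
  gcongr
  calc ∫⁻ t in Ioc x y, t ∂β ≤ ∫⁻ _t in Ioc x y, y ∂β :=
        setLIntegral_mono measurable_const fun t ht => ht.2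
    _ = y * β (Ioc x y) := by simp
    _ ≤ _ := by gcongr; exact fun t ht => ht.1

/-- With `K = 16 * d ^ 2` and `L = 16 * d * K ^ j` one has `d * L = K ^ (j + 1)`. After division by
`L ^ d` the fluctuation term is at most `1 / 2 * (1 / 4) ^ j` and the boundary factor `2 * d / L` is
`1 / (8 * K ^ j)`. The mass between the scales is a difference of tails, which puts the tail at `K ^
(j + 1)` twice on the left. -/
lemma MassTransport.step (h : MassTransport d β) (hd : 1 ≤ d) (hβ : β univ ≤ 2) (j : ℕ) :
    2 * (β (Ioi ((16 * d ^ 2 : ℕ) ^ (j + 1) : ℝ≥0∞))).toReal ≤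
      (β (Ioi ((16 * d ^ 2 : ℕ) ^ j : ℝ≥0∞))).toReal + 1 / 2 * (3 / 4) ^ j +
        1 / 8 * ((∫⁻ t in Iic ((16 * d ^ 2 : ℕ) ^ j : ℝ≥0∞), t ∂β).toReal /
          (16 * d ^ 2 : ℕ) ^ j) := by
  set K : ℕ := 16 * d ^ 2 with hK
  have hK16 : 16 ≤ K := by nlinarith
  have hfin : IsFiniteMeasure β := ⟨hβ.trans_lt (by simp)⟩
  set L : ℕ := 16 * d * K ^ j with hL
  have hL1 : 16 * 16 ^ j ≤ L := by
    have : 16 ^ j ≤ K ^ j := Nat.pow_le_pow_left hK16 j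
    calc 16 * 16 ^ j = 16 * 1 * 16 ^ j := by ring
      _ ≤ 16 * d * K ^ j := by gcongr
  have hLpos : 1 ≤ L := le_trans (by have := Nat.one_le_pow j 16 (by norm_num); lia) hL1
  have hdL : d * L = K ^ (j + 1) := by rw [hL, hK]; ring
  have hI : ∫⁻ t in Iic ((K : ℝ≥0∞) ^ j), t ∂β ≠ ∞ :=
    ne_top_of_le_ne_top (by finiteness) (setLIntegral_Iic_le (β := β) ((K : ℝ≥0∞) ^ j))
  have key := h L hLpos ((K : ℝ≥0∞) ^ (j + 1)) ((K : ℝ≥0∞) ^ j) (by finiteness) (by finiteness)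
    (by exact_mod_cast hdL.le)
  have hsplit : (β (Ioi ((K : ℝ≥0∞) ^ j))).toReal =
      (β (Ioc ((K : ℝ≥0∞) ^ j) ((K : ℝ≥0∞) ^ (j + 1)))).toReal +
        (β (Ioi ((K : ℝ≥0∞) ^ (j + 1)))).toReal := by
    rw [← ENNReal.toReal_add (by finiteness) (by finiteness),
      ← measure_union (Ioc_disjoint_Ioi le_rfl) measurableSet_Ioi, Ioc_union_Ioi_eq_Ioi]
    exact pow_le_pow_right₀ (by exact_mod_cast (by lia : 1 ≤ K)) (by lia)
  set I := ∫⁻ t in Iic ((K : ℝ≥0∞) ^ j), t ∂β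
  have key' := ENNReal.toReal_mono (by finiteness) key
  rw [ENNReal.toReal_add (by finiteness) (by finiteness),
    ENNReal.toReal_add (by finiteness) (by finiteness)] at key'
  simp only [ENNReal.toReal_mul, ENNReal.toReal_pow, ENNReal.toReal_natCast, ENNReal.toReal_ofNat,
    ENNReal.toReal_ofReal (Real.sqrt_nonneg _)] at key'
  set b := (β (Ioc ((K : ℝ≥0∞) ^ j) ((K : ℝ≥0∞) ^ (j + 1)))).toReal
  set b' := (β (Ioi ((K : ℝ≥0∞) ^ (j + 1)))).toReal
  rw [hsplit]
  have hLr : (0 : ℝ) < L := by exact_mod_cast hLpos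
  have hLd : (0 : ℝ) < (L : ℝ) ^ d := by positivity
  have hpow : (L : ℝ) ^ d = L * (L : ℝ) ^ (d - 1) := by
    rw [← pow_succ']; congr 1; lia
  have hsq : √((L : ℝ) ^ d) * √((L : ℝ) ^ d) = (L : ℝ) ^ d := Real.mul_self_sqrt hLd.le
  have hs : 4 * 4 ^ j ≤ √((L : ℝ) ^ d) := by
    refine Real.le_sqrt_of_sq_le ?_
    calc ((4 : ℝ) * 4 ^ j) ^ 2 = 16 * 16 ^ j := by
          rw [mul_pow, ← pow_mul, mul_comm j 2, pow_mul]; norm_num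
      _ ≤ L := by exact_mod_cast hL1
      _ = (L : ℝ) ^ 1 := (pow_one _).symm
      _ ≤ _ := pow_le_pow_right₀ (by exact_mod_cast hLpos) hd
  have hspos : 0 < √((L : ℝ) ^ d) := Real.sqrt_pos.2 hLd
  have e1 : 2 * √((L : ℝ) ^ d) ≤ (L : ℝ) ^ d * (1 / 2 * (3 / 4) ^ j) := by
    have : (1 : ℝ) ≤ 4 ^ j * (3 / 4) ^ j := by rw [← mul_pow]; exact one_le_pow₀ (by norm_num)
    have h4 : 4 ≤ √((L : ℝ) ^ d) * (3 / 4) ^ j := by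
      calc (4 : ℝ) ≤ 4 * (4 ^ j * (3 / 4) ^ j) := by linarith
        _ = (4 * 4 ^ j) * (3 / 4) ^ j := by ring
        _ ≤ _ := by gcongr
    calc 2 * √((L : ℝ) ^ d) = 1 / 2 * (√((L : ℝ) ^ d) * 4) := by ring
      _ ≤ 1 / 2 * (√((L : ℝ) ^ d) * (√((L : ℝ) ^ d) * (3 / 4) ^ j)) := by gcongr
      _ = 1 / 2 * ((√((L : ℝ) ^ d) * √((L : ℝ) ^ d)) * (3 / 4) ^ j) := by ring
      _ = _ := by rw [hsq]; ring
  have e2 : 2 * (d : ℝ) * ((L : ℝ) ^ (d - 1) * I.toReal) =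
      (L : ℝ) ^ d * (1 / 8 * (I.toReal / (K : ℝ) ^ j)) := by
    have : (L : ℝ) = 16 * d * (K : ℝ) ^ j := by rw [hL]; push_cast; ring
    have hKj : (0 : ℝ) < (K : ℝ) ^ j := by positivity
    rw [hpow]
    nth_rewrite 2 [this]
    field_simp
    ring
  rw [e2] at key'
  have : (L : ℝ) ^ d * b' ≤ (L : ℝ) ^ d *
      (1 / 2 * (3 / 4) ^ j + b + 1 / 8 * (I.toReal / (K : ℝ) ^ j)) := by linarith
  have := le_of_mul_le_mul_left this hLd
  linarith

/-- Joint induction. The tail bound closes because `3 + 1 / 2 + 9 / 16 ≤ 2 * (9 / 4)`; the bound for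
the truncated mean closes because `9 / 2 + 3 * K ≤ 27 / 8 * K` for `K ≥ 16`. -/
lemma MassTransport.geometric (h : MassTransport d β) (hd : 1 ≤ d) (hβ : β univ ≤ 2) (j : ℕ) :
    (β (Ioi ((16 * d ^ 2 : ℕ) ^ j : ℝ≥0∞))).toReal ≤ 3 * (3 / 4) ^ j ∧
      (∫⁻ t in Iic ((16 * d ^ 2 : ℕ) ^ j : ℝ≥0∞), t ∂β).toReal / (16 * d ^ 2 : ℕ) ^ j ≤
        9 / 2 * (3 / 4) ^ j := by
  have hfin : IsFiniteMeasure β := ⟨hβ.trans_lt (by simp)⟩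
  induction j with
  | zero =>
    constructor
    · have := ENNReal.toReal_mono (by simp) ((measure_mono (subset_univ _)).trans hβ :
        β (Ioi ((16 * d ^ 2 : ℕ) ^ 0 : ℝ≥0∞)) ≤ 2)
      norm_num at this ⊢
      linarith
    · have := ENNReal.toReal_mono (by simp) ((setLIntegral_Iic_le (β := β)
        ((16 * d ^ 2 : ℕ) ^ 0 : ℝ≥0∞)).trans (mul_le_mul_right hβ _))
      norm_num at this ⊢
      linarith
  | succ j ih =>
    have hs := h.step hd hβ j
    set K : ℕ := 16 * d ^ 2 with hK
    have hK16 : 16 ≤ K := by nlinarith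
    have hKr : (16 : ℝ) ≤ K := by exact_mod_cast hK16
    have hp : (0 : ℝ) < (3 / 4) ^ j := by positivity
    rw [pow_succ (3 / 4 : ℝ) j]
    refine ⟨by linarith [ih.1, ih.2], ?_⟩
    have hI : ∀ j, ∫⁻ t in Iic ((K : ℝ≥0∞) ^ j), t ∂β ≠ ∞ := fun j =>
      ne_top_of_le_ne_top (by finiteness) (setLIntegral_Iic_le (β := β) ((K : ℝ≥0∞) ^ j))
    have key := ENNReal.toReal_mono (ENNReal.add_ne_top.2 ⟨hI j, by finiteness⟩)
      (setLIntegral_Iic_le_add (β := β) (x := (K : ℝ≥0∞) ^ j)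
        (y := (K : ℝ≥0∞) ^ (j + 1))
        (pow_le_pow_right₀ (by exact_mod_cast (by lia : 1 ≤ K)) (by lia)))
    rw [ENNReal.toReal_add (hI j) (by finiteness), ENNReal.toReal_mul, ENNReal.toReal_pow,
      ENNReal.toReal_natCast] at key
    have hKj : (0 : ℝ) < (K : ℝ) ^ j := by positivity
    have ih2 := ih.2
    rw [div_le_iff₀ hKj] at ih2
    rw [div_le_iff₀ (by positivity)]
    refine key.trans ?_
    have e : (K : ℝ) ^ (j + 1) = K * K ^ j := pow_succ' _ _
    rw [e]
    calc _ ≤ 9 / 2 * (3 / 4) ^ j * (K : ℝ) ^ j + K * K ^ j * (3 * (3 / 4) ^ j) := by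
          gcongr; exact ih.1
      _ = (9 / 2 + 3 * K) * ((3 / 4) ^ j * (K : ℝ) ^ j) := by ring
      _ ≤ (27 / 8 * K) * ((3 / 4) ^ j * (K : ℝ) ^ j) := by gcongr; linarith
      _ = _ := by ring

theorem MassTransport.tail_le (h : MassTransport d β) (hd : 1 ≤ d) (hβ : β univ ≤ 2) {r : ℝ}
    (hr : 0 < r) : β (Ioi (ENNReal.ofReal r)) ≤
      ENNReal.ofReal (4 * r ^ (-(Real.log (4 / 3) / Real.log (16 * d ^ 2)))) := by
  have hfin : IsFiniteMeasure β := ⟨hβ.trans_lt (by simp)⟩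
  have hd' : (1 : ℝ) ≤ d := by exact_mod_cast hd
  have hK1 : (1 : ℝ) < 16 * d ^ 2 := by nlinarith
  have hlK : 0 < Real.log (16 * d ^ 2) := Real.log_pos hK1
  have hl : 0 < Real.log (4 / 3) := Real.log_pos (by norm_num)
  set s := Real.log (4 / 3) / Real.log (16 * d ^ 2) with hs
  have hspos : 0 < s := div_pos hl hlK
  rcases lt_or_ge r 1 with h1 | h1
  · refine (measure_mono (subset_univ _)).trans (hβ.trans ?_)
    have : 1 ≤ r ^ (-s) := Real.one_le_rpow_of_pos_of_le_one_of_nonpos hr h1.le (by linarith)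
    rw [show (2 : ℝ≥0∞) = ENNReal.ofReal 2 by simp]
    exact ENNReal.ofReal_le_ofReal (by linarith)
  · obtain ⟨j, hj1, hj2⟩ := exists_nat_pow_near h1 hK1
    have hb := (h.geometric hd hβ j).1
    rw [← ENNReal.ofReal_toReal (measure_ne_top β (Ioi (ENNReal.ofReal r)))]
    refine ENNReal.ofReal_le_ofReal ?_
    have hmono : (β (Ioi (ENNReal.ofReal r))).toReal ≤
        (β (Ioi ((16 * d ^ 2 : ℕ) ^ j : ℝ≥0∞))).toReal := by
      refine ENNReal.toReal_mono (by finiteness) (measure_mono (Ioi_subset_Ioi ?_))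
      rw [← ENNReal.ofReal_natCast, ← ENNReal.ofReal_pow (by positivity)]
      refine ENNReal.ofReal_le_ofReal ?_
      push_cast
      exact hj1
    refine (hmono.trans hb).trans ?_
    -- This equation defines `s`. Passing from `r` to the next power of `16 * d ^ 2` loses a factor
    -- `4 / 3`, which turns the constant `3` into `4`.
    have hKs : ((16 * d ^ 2 : ℝ)) ^ (-s) = 3 / 4 := by
      rw [Real.rpow_def_of_pos (by linarith), hs, mul_neg, mul_div_cancel₀ _ hlK.ne', ← Real.log_inv,
        Real.exp_log (by norm_num)]
      norm_num
    calc 3 * (3 / 4 : ℝ) ^ j = 4 * (3 / 4) ^ (j + 1) := by rw [pow_succ]; ring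
      _ = 4 * ((16 * d ^ 2 : ℝ) ^ (j + 1)) ^ (-s) := by
          rw [← hKs, ← Real.rpow_natCast _ (j + 1), ← Real.rpow_natCast _ (j + 1),
            ← Real.rpow_mul (by positivity), ← Real.rpow_mul (by positivity), mul_comm (-s)]
      _ ≤ _ := by
          gcongr 4 * ?_
          exact Real.rpow_le_rpow_of_nonpos hr hj2.le (by linarith)

/-- The point `∞` lies in all tails, and these tend to zero geometrically. -/
lemma MassTransport.measure_top (h : MassTransport d β) (hd : 1 ≤ d) (hβ : β univ ≤ 2) :
    β {∞} = 0 := by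
  have ht : Filter.Tendsto (fun j : ℕ => ENNReal.ofReal (3 * (3 / 4 : ℝ) ^ j)) Filter.atTop
      (nhds 0) := by
    have := (tendsto_pow_atTop_nhds_zero_of_lt_one (by norm_num : (0 : ℝ) ≤ 3 / 4)
      (by norm_num)).const_mul 3
    simpa using ENNReal.tendsto_ofReal this
  have hfin : IsFiniteMeasure β := ⟨hβ.trans_lt (by simp)⟩
  refine le_antisymm (ge_of_tendsto' ht fun j => ?_) zero_le
  have hb := (h.geometric hd hβ j).1
  rw [← ENNReal.ofReal_toReal (measure_ne_top β {∞})]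
  refine ENNReal.ofReal_le_ofReal (le_trans (ENNReal.toReal_mono (by finiteness)
    (measure_mono ?_)) hb)
  rintro _ rfl
  exact lt_top_iff_ne_top.2 (ENNReal.pow_ne_top (ENNReal.natCast_ne_top _))

lemma tailExponent_pos (hd : 1 ≤ d) : 0 < tailExponent d := by
  unfold tailExponent
  split_ifs
  · norm_num
  · have hd' : (1 : ℝ) ≤ d := by exact_mod_cast hd
    exact div_pos (Real.log_pos (by norm_num)) (Real.log_pos (by nlinarith))

lemma tailExponent_lt_one (hd : 1 ≤ d) : tailExponent d < 1 := by
  unfold tailExponent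
  split_ifs
  · norm_num
  · have hd' : (1 : ℝ) ≤ d := by exact_mod_cast hd
    rw [div_lt_one (Real.log_pos (by nlinarith))]
    exact Real.log_lt_log (by norm_num) (by nlinarith)

end Iteration


/-! ### Perfectness and the typical distance -/

section Perfect

variable {d : ℕ} {Ω : Type*} [MeasurableSpace Ω] {P : Measure Ω} {R B : Ω → Measure (Space d)}
  {M : Ω → Set (Space d × Space d)} {ν ν' : Measure ℝ≥0∞}

theorem massTransport (hR : IsUnitPoissonProcess P R) (hB : IsUnitPoissonProcess P B)
    (hM : ∀ᵐ ω ∂P, IsStableMatching (support (R ω)) (support (B ω)) (M ω))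
    (h : IsMarkLaw P R M ν) (h' : IsMarkLaw P B (fun ω => Prod.swap ⁻¹' M ω) ν') :
    MassTransport d (ν + ν') :=
  fun _ hL _ _ hr hρ hLr => lintegral_far_le hR hB hM h h' hL hr hρ hLr

lemma IsMarkLaw.add_univ_le (h : IsMarkLaw P R M ν)
    (h' : IsMarkLaw P B (fun ω => Prod.swap ⁻¹' M ω) ν') : (ν + ν') univ ≤ 2 := by
  have := h.prob
  have := h'.prob
  rw [Measure.add_apply, measure_univ, measure_univ, one_add_one_eq_two]

/-- By the Campbell formula the mean number of unmatched points in the whole space is `∞ * 0 = 0`.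
-/
lemma IsMarkLaw.ae_redDist_ne_top (h : IsMarkLaw P R M ν) (h0 : ν {∞} = 0) :
    ∀ᵐ ω ∂P, ∀ x ∈ support (R ω), redDist (M ω) x ≠ ∞ := by
  have hm : MeasurableSet (univ ×ˢ {∞} : Set (Space d × ℝ≥0∞)) :=
    MeasurableSet.univ.prod (measurableSet_singleton _)
  have h1 := h.lintegral_prod MeasurableSet.univ (measurableSet_singleton ∞)
  rw [h0, mul_zero, lintegral_eq_zero_iff' (h.aemeasurable _ hm)] at h1
  filter_upwards [h1] with ω hω x hx hxt
  simp only [Pi.zero_apply, ENat.toENNReal_eq_zero, encard_eq_zero] at hω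
  exact (hω ▸ (⟨hx, mem_univ _, hxt⟩ : x ∈ markedPoints (support (R ω)) (M ω) (univ ×ˢ {∞})) :
    x ∈ (∅ : Set (Space d)))

/-- The stable matching is almost surely perfect. -/
theorem ae_isPerfectMatching [IsProbabilityMeasure P] (hd : 1 ≤ d)
    (hR : IsUnitPoissonProcess P R) (hB : IsUnitPoissonProcess P B) (hind : IndepFun R B P)
    (hM : ∀ᵐ ω ∂P, IsStableMatching (support (R ω)) (support (B ω)) (M ω)) :
    ∀ᵐ ω ∂P, IsPerfectMatching (support (R ω)) (support (B ω)) (M ω) := by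
  obtain ⟨ν, h⟩ := exists_isMarkLaw hd hR hB hind hM
  obtain ⟨ν', h'⟩ := exists_isMarkLaw (M := fun ω => Prod.swap ⁻¹' M ω) hd hB hR hind.symm
    (hM.mono fun ω hω => hω.swap)
  have h0 := (massTransport hR hB hM h h').measure_top hd (h.add_univ_le h')
  rw [Measure.add_apply, add_eq_zero] at h0
  filter_upwards [hM, h.ae_redDist_ne_top h0.1, h'.ae_redDist_ne_top h0.2] with ω h1 h2 h3
  refine ⟨h1.partialMatching, fun x hx => ?_, fun y hy => ?_⟩
  · by_contra! hc
    exact h2 x hx (redDist_eq_top hc)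
  · by_contra! hc
    exact h3 y hy (redDist_eq_top hc)

theorem ae_existsUnique_isStableMatching [IsProbabilityMeasure P] (hd : 1 ≤ d)
    (hR : IsUnitPoissonProcess P R) (hB : IsUnitPoissonProcess P B) (hind : IndepFun R B P) :
    ∀ᵐ ω ∂P, ∃! m : Set (Space d × Space d), IsStableMatching (support (R ω)) (support (B ω)) m := by
  filter_upwards [ae_isGeneric hd hR hB hind] with ω h
  exact ⟨_, h.isStableMatching_iff.2 rfl, fun m hm => h.isStableMatching_iff.1 hm⟩

theorem isMatchingScheme [IsProbabilityMeasure P] (hd : 1 ≤ d)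
    (hR : IsUnitPoissonProcess P R) (hB : IsUnitPoissonProcess P B) (hind : IndepFun R B P)
    (hM : ∀ᵐ ω ∂P, IsStableMatching (support (R ω)) (support (B ω)) (M ω)) :
    IsMatchingScheme P R B M :=
  ⟨fun _ hS => aemeasurable_encard_inter hd hR hB hind hM hS,
    ae_isPerfectMatching hd hR hB hind hM⟩

lemma IsMarkLaw.isTypicalDistanceLaw (h : IsMarkLaw P R M ν) : IsTypicalDistanceLaw P R M ν := by
  refine ⟨h.prob, fun r => ?_⟩
  have := h.lintegral_prod measurableSet_unitCube (measurableSet_Iic (a := r))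
  rw [volume_unitCube, one_mul] at this
  rw [← this]
  refine lintegral_congr fun ω => ?_
  congr 2
  ext x
  simp [markedPoints, and_assoc]

theorem IsMarkLaw.tail_le [IsProbabilityMeasure P] (hd : 1 ≤ d)
    (hR : IsUnitPoissonProcess P R) (hB : IsUnitPoissonProcess P B) (hind : IndepFun R B P)
    (hM : ∀ᵐ ω ∂P, IsStableMatching (support (R ω)) (support (B ω)) (M ω))
    (h : IsMarkLaw P R M ν) {r : ℝ} (hr : 0 < r) :
    ν (Ioi (ENNReal.ofReal r)) ≤
      ENNReal.ofReal (4 * r ^ (-(Real.log (4 / 3) / Real.log (16 * d ^ 2)))) := by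
  obtain ⟨ν', h'⟩ := exists_isMarkLaw (M := fun ω => Prod.swap ⁻¹' M ω) hd hB hR hind.symm
    (hM.mono fun ω hω => hω.swap)
  refine le_trans ?_ ((massTransport hR hB hM h h').tail_le hd (h.add_univ_le h') hr)
  rw [Measure.add_apply]
  exact le_self_add

end Perfect


/-! ### The moment of order `d` is infinite -/

section Trap

variable {d : ℕ}

/-- The red points with matching distance greater than their norm minus one. -/
def reachingPoints (U : Set (Space d)) (m : Set (Space d × Space d)) : Set (Space d) :=
  {x | x ∈ U ∧ edist x 0 < redDist m x + 1}

/-- Removing the edges of all red points that reach the unit ball makes room for an additional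
blue point that stays unmatched. -/
lemma exists_not_isPerfectMatching {U V C : Set (Space d)} {m : Set (Space d × Space d)}
    {z : Space d} (h : IsStableMatching U V m) (hU : U ∩ C = reachingPoints U m)
    (hV : V ∩ C = {y | ∃ x ∈ reachingPoints U m, (x, y) ∈ m}) (hz : z ∈ Metric.ball (0 : Space d) 1)
    (hzC : z ∈ C) :
    ∃ m', IsStableMatching (U \ C) (V \ C ∪ {z}) m' ∧
      ¬ IsPerfectMatching (U \ C) (V \ C ∪ {z}) m' := by
  have hp := h.partialMatching
  -- No edge of `m` joins `C` to its complement, so deleting `C` removes whole edges only.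
  have hmem : ∀ x y, (x, y) ∈ m → (x ∉ C ↔ y ∉ C) := by
    intro x y hxy
    have hs := hp.subset hxy
    rw [not_iff_not]
    constructor
    · intro hx
      have : y ∈ V ∩ C := hV ▸ ⟨x, hU ▸ ⟨hs.1, hx⟩, hxy⟩
      exact this.2
    · intro hy
      have : y ∈ V ∩ C := ⟨hs.2, hy⟩
      rw [hV] at this
      obtain ⟨x', hx', hxy'⟩ := this
      rw [hp.blue_unique _ _ _ hxy hxy']
      rw [← hU] at hx'
      exact hx'.2
  refine ⟨{p | p ∈ m ∧ p.1 ∉ C}, ⟨⟨?_, ?_, ?_⟩, ?_⟩, fun hc => ?_⟩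
  · rintro ⟨x, y⟩ ⟨hxy, hx⟩
    have hs := hp.subset hxy
    exact ⟨⟨hs.1, hx⟩, Or.inl ⟨hs.2, (hmem x y hxy).1 hx⟩⟩
  · exact fun x y y' h1 h2 => hp.red_unique _ _ _ h1.1 h2.1
  · exact fun x x' y h1 h2 => hp.blue_unique _ _ _ h1.1 h2.1
  · intro x hx y hy hlt
    have er : redDist {p | p ∈ m ∧ p.1 ∉ C} x = redDist m x := by
      simp [redDist, hx.2]
    rw [er] at hlt
    rcases hy with hy | rfl
    · have eb : blueDist {p | p ∈ m ∧ p.1 ∉ C} y = blueDist m y := by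
        unfold blueDist
        refine iInf_congr fun x' => iInf_congr_Prop ?_ fun _ => rfl
        exact ⟨fun h1 => h1.1, fun h1 => ⟨h1, (hmem x' y h1).2 hy.2⟩⟩
      rw [eb] at hlt
      exact h.stable x hx.1 y hy.1 hlt
    -- The new point is within distance one of the origin, so any red point closer to it than to its
    -- partner reaches the unit ball, and all such red points were deleted.
    · have hx' : x ∉ reachingPoints U m := by rw [← hU]; exact fun hh => hx.2 hh.2
      refine hx' ⟨hx.1, ?_⟩
      have h1 : edist y 0 < 1 := by
        rw [edist_dist, ENNReal.ofReal_lt_one]; exact hz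
      exact (edist_triangle x y 0).trans_lt
        (ENNReal.add_lt_add (hlt.trans_le (min_le_left _ _)) h1)
  · obtain ⟨x, hxz, hx⟩ := hc.blue_matched z (Or.inr rfl)
    exact (hmem x z hxz).1 hx hzC

/-- The unit ball together with finitely many cells. -/
def trapRegion (q : ℕ × Finset (Fin d → ℤ)) : Set (Space d) :=
  Metric.ball 0 1 ∪ ⋃ z ∈ q.2, cell q.1 z

lemma measurableSet_trapRegion (q : ℕ × Finset (Fin d → ℤ)) : MeasurableSet (trapRegion q) :=
  measurableSet_ball.union (Finset.measurableSet_biUnion _ fun z _ => measurableSet_cell q.1 z)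

lemma volume_cell_lt_top (m : ℕ) (z : Fin d → ℤ) : volume (cell (d := d) m z) < ∞ := by
  rcases (cell (d := d) m z).eq_empty_or_nonempty with h | ⟨x, hx⟩
  · simp [h]
  · exact (measure_mono fun y hy => (Metric.mem_closedBall.2 (dist_le_of_mem_cell hy hx))).trans_lt
      (measure_closedBall_lt_top (x := x))

lemma volume_trapRegion_lt_top (q : ℕ × Finset (Fin d → ℤ)) : volume (trapRegion q) < ∞ := by
  refine (measure_union_le _ _).trans_lt (ENNReal.add_lt_top.2 ⟨measure_ball_lt_top, ?_⟩)
  exact measure_biUnion_lt_top q.2.finite_toSet fun z _ => volume_cell_lt_top _ _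

/-- Finitely many points can be separated from the others by cells. -/
lemma exists_cells {W F : Set (Space d)} (hW : LocFinite W) (hF : F.Finite) :
    ∃ q : ℕ × Finset (Fin d → ℤ), F ⊆ (⋃ z ∈ q.2, cell q.1 z) ∧
      W ∩ (⋃ z ∈ q.2, cell q.1 z) ⊆ F := by
  classical
  obtain ⟨n, hn⟩ := hF.isBounded.subset_closedBall 0
  -- Cells have diameter at most `√d`, so only points of `W` in this larger ball can share a cell
  -- with a point of `F`; a fine enough mesh separates these finitely many.
  have hfin : (F ×ˢ ((W ∩ Metric.closedBall 0 (n + √d)) \ F)).Finite :=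
    hF.prod ((hW.inter_closedBall _).sdiff)
  have hlim : Filter.Tendsto (fun m : ℕ => √(d : ℝ) / ((m : ℝ) + 1)) Filter.atTop (nhds 0) :=
    by
    simpa [Function.comp_def] using (tendsto_const_div_atTop_nhds_zero_nat √(d : ℝ)).comp (Filter.tendsto_add_atTop_nat 1)
  have hev : ∀ᶠ m : ℕ in Filter.atTop, ∀ p ∈ F ×ˢ ((W ∩ Metric.closedBall 0 (n + √d)) \ F),
      √(d : ℝ) / ((m : ℝ) + 1) < dist p.2 p.1 := by
    rw [Filter.eventually_all_finite hfin]
    rintro ⟨f, w⟩ ⟨hf, hw⟩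
    exact hlim.eventually_lt_const (dist_pos.2 fun e => hw.2 (e ▸ hf))
  obtain ⟨m, hm⟩ := hev.exists
  refine ⟨(m, hF.toFinset.image (cellIndex m)), fun f hf => ?_, ?_⟩
  · simp only [mem_iUnion]
    exact ⟨cellIndex m f, Finset.mem_image_of_mem _ (hF.mem_toFinset.2 hf), mem_cell_cellIndex m f⟩
  · rintro w ⟨hw, hwc⟩
    simp only [mem_iUnion, Finset.mem_image, hF.mem_toFinset] at hwc
    obtain ⟨_, ⟨f, hf, rfl⟩, hwf⟩ := hwc
    by_contra hwF
    have hd := dist_le_of_mem_cell hwf (mem_cell_cellIndex m f)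
    have h1 : √(d : ℝ) / ((m : ℝ) + 1) ≤ √d :=
      div_le_self (Real.sqrt_nonneg _) (by linarith [(Nat.cast_nonneg m : (0 : ℝ) ≤ m)])
    have h2 : dist f 0 ≤ n := hn hf
    exact absurd (hm (f, w) ⟨hf, ⟨hw, Metric.mem_closedBall.2
      (by linarith [dist_triangle w f 0])⟩, hwF⟩) (not_lt.2 hd)

/-- The colors are not assumed disjoint. A common point is matched to itself, so a trap around red
points and their partners catches no unwanted point through its other color. -/
lemma IsStableMatching.self_mem {U V : Set (Space d)} {m : Set (Space d × Space d)}
    (h : IsStableMatching U V m) {x : Space d} (hU : x ∈ U) (hV : x ∈ V) : (x, x) ∈ m := by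
  have hs := h.stable x hU x hV
  rw [edist_self, lt_min_iff, not_and_or, not_lt, not_lt] at hs
  rcases hs with hs | hs
  · obtain ⟨y, hy, he⟩ := h.partialMatching.exists_of_redDist_lt (hs.trans_lt zero_lt_one)
    rw [he, nonpos_iff_eq_zero, edist_eq_zero] at hs
    rwa [← hs] at hy
  · obtain ⟨y, hy, he⟩ := h.partialMatching.exists_of_blueDist_lt (hs.trans_lt zero_lt_one)
    rw [he, nonpos_iff_eq_zero, edist_eq_zero] at hs
    rwa [hs] at hy

/-- If finitely many red points reach the unit ball, a trap region contains exactly these and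
their partners. -/
lemma exists_trapRegion {U V : Set (Space d)} {m : Set (Space d × Space d)}
    (hs : IsStableMatching U V m) (h : IsPerfectMatching U V m) (hU : LocFinite U)
    (hV : LocFinite V) (hfin : (reachingPoints U m).Finite) :
    ∃ q : ℕ × Finset (Fin d → ℤ), U ∩ trapRegion q = reachingPoints U m ∧
      V ∩ trapRegion q = {y | ∃ x ∈ reachingPoints U m, (x, y) ∈ m} := by
  have hp := h.partialMatching
  set D := reachingPoints U m with hD
  set E := {y | ∃ x ∈ D, (x, y) ∈ m} with hE
  have hEfin : E.Finite := by
    have : ∀ x, ∃ y, x ∈ D → (x, y) ∈ m := fun x => by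
      by_cases hx : x ∈ D
      · obtain ⟨y, hy⟩ := h.red_matched x hx.1
        exact ⟨y, fun _ => hy⟩
      · exact ⟨0, fun h => absurd h hx⟩
    choose f hf using this
    refine (hfin.image f).subset ?_
    rintro y ⟨x, hx, hxy⟩
    exact ⟨x, hx, hp.red_unique _ _ _ (hf x hx) hxy⟩
  obtain ⟨q, h1, h2⟩ := exists_cells (hU.union hV) (hfin.union hEfin)
  refine ⟨q, ?_, ?_⟩
  · refine Subset.antisymm ?_ fun x hx => ⟨hx.1, Or.inr (h1 (Or.inl hx))⟩
    -- Red points in the unit ball reach it trivially.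
    rintro x ⟨hxU, hx | hx⟩
    · refine ⟨hxU, lt_of_lt_of_le ?_ le_add_self⟩
      rw [edist_dist, ENNReal.ofReal_lt_one]; exact hx
    · rcases h2 ⟨Or.inl hxU, hx⟩ with hxD | ⟨x', hx', hxx⟩
      · exact hxD
      · rwa [hp.blue_unique _ _ _ (hs.self_mem hxU (hp.subset hxx).2) hxx]
  · refine Subset.antisymm ?_ fun y hy => ⟨?_, Or.inr (h1 (Or.inr hy))⟩
    · rintro y ⟨hyV, hy | hy⟩
      -- By the triangle inequality, the partner of a blue point in the unit ball reaches the ball.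
      -- Perfectness provides this partner.
      · obtain ⟨x, hx⟩ := h.blue_matched y hyV
        refine ⟨x, ⟨(hp.subset hx).1, ?_⟩, hx⟩
        rw [hp.redDist_eq hx]
        refine (edist_triangle x y 0).trans_lt ?_
        refine ENNReal.add_lt_add_left (edist_ne_top x y) ?_
        rw [edist_dist, ENNReal.ofReal_lt_one]; exact hy
      · rcases h2 ⟨Or.inr hyV, hy⟩ with hyD | hyE
        · exact ⟨y, hyD, hs.self_mem hyD.1 hyV⟩
        · exact hyE
    · obtain ⟨x, -, hxy⟩ := hy
      exact (hp.subset hxy).2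

end Trap

/-! ### Resampling the trap region -/

section Moment

variable {d : ℕ} {Ω : Type*} [MeasurableSpace Ω] {P : Measure Ω} {R B : Ω → Measure (Space d)}
  {M : Ω → Set (Space d × Space d)} {ν : Measure ℝ≥0∞}

/-- By the Campbell formula the mean number of reaching points is the integral over `ν` of the
volume of the ball of radius `t + 1`, finite because `(t + 1) ^ d ≤ 2 ^ d * (t ^ d + 1)`. -/
lemma IsMarkLaw.ae_finite_reachingPoints (hd : 1 ≤ d) (h : IsMarkLaw P R M ν)
    (hm : ∫⁻ t, t ^ d ∂ν ≠ ∞) : ∀ᵐ ω ∂P, (reachingPoints (support (R ω)) (M ω)).Finite := by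
  have := h.prob
  have hG : MeasurableSet {p : Space d × ℝ≥0∞ | edist p.1 0 < p.2 + 1} :=
    measurableSet_lt (f := fun p : Space d × ℝ≥0∞ => edist p.1 0)
      (g := fun p : Space d × ℝ≥0∞ => p.2 + 1) (by fun_prop) (by fun_prop)
  set c := volume (Metric.ball (0 : Space d) 1) with hc
  have hc0 : c ≠ 0 := (Metric.measure_ball_pos volume 0 one_pos).ne'
  have hct : c ≠ ∞ := measure_ball_lt_top.ne
  have : Nonempty (Fin d) := ⟨⟨0, hd⟩⟩
  have hball : ∀ t : ℝ≥0∞, volume {x : Space d | edist x 0 < t + 1} ≤ 2 ^ d * (t ^ d + 1) * c := by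
    intro t
    by_cases ht : t = ∞
    · subst ht
      rw [ENNReal.top_pow (by lia), top_add, ENNReal.mul_top (by simp), ENNReal.top_mul hc0]
      exact le_top
    · have e : {x : Space d | edist x 0 < t + 1} = Metric.ball 0 (t + 1).toReal := by
        ext x
        rw [mem_ofPred_eq, Metric.mem_ball, edist_dist,
          ENNReal.ofReal_lt_iff_lt_toReal dist_nonneg (by finiteness)]
      rw [e, Measure.addHaar_ball _ _ ENNReal.toReal_nonneg, finrank_euclideanSpace,
        Fintype.card_fin, ENNReal.ofReal_pow ENNReal.toReal_nonneg,
        ENNReal.ofReal_toReal (by finiteness)]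
      gcongr
      rcases le_total t 1 with h1 | h1
      · calc (t + 1) ^ d ≤ (1 + 1) ^ d := by gcongr
          _ = 2 ^ d * 1 := by norm_num
          _ ≤ _ := by gcongr; exact le_add_self
      · calc (t + 1) ^ d ≤ (t + t) ^ d := by gcongr
          _ = 2 ^ d * t ^ d := by rw [← two_mul, mul_pow]
          _ ≤ _ := by gcongr; exact le_self_add
  have hlt : ((volume : Measure (Space d)).prod ν) {p | edist p.1 0 < p.2 + 1} ≠ ∞ := by
    rw [Measure.prod_apply_symm hG]
    refine ne_top_of_le_ne_top ?_ (lintegral_mono fun t => hball t)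
    rw [lintegral_mul_const _ (by fun_prop), lintegral_const_mul _ (by fun_prop),
      lintegral_add_right _ measurable_const, lintegral_const, measure_univ, mul_one]
    finiteness
  have hae := ae_lt_top' (h.aemeasurable _ hG) (by rwa [h.lintegral_eq _ hG])
  filter_upwards [hae] with ω hω
  rw [ENat.toENNReal_lt_top, encard_lt_top_iff] at hω
  exact hω

/-- In any region, with positive probability there are no red points and a single blue point. -/
lemma measure_single_blue_pos [IsProbabilityMeasure P] (hR : IsUnitPoissonProcess P R)
    (hB : IsUnitPoissonProcess P B) (hind : IndepFun R B P) {A C : Set (Space d)}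
    (hA : MeasurableSet A) (hC : MeasurableSet C) (hAC : A ⊆ C) (hA0 : volume A ≠ 0)
    (hv : volume C ≠ ∞) : 0 < P {ω | R ω C = 0 ∧ B ω A = 1 ∧ B ω (C \ A) = 0} := by
  have hvA : volume A ≠ ∞ := ne_top_of_le_ne_top hv (measure_mono hAC)
  have hvD : volume (C \ A) ≠ ∞ := ne_top_of_le_ne_top hv (measure_mono sdiff_subset)
  have h1 : 0 < P {ω | R ω C = 0} := by
    simpa using hR.measure_eq_natCast_pos hC hv (n := 0) (Or.inl rfl)
  have h2 : 0 < P {ω | B ω A = 1} := by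
    simpa using hB.measure_eq_natCast_pos hA hvA (n := 1) (Or.inr hA0)
  have h3 : 0 < P {ω | B ω (C \ A) = 0} := by
    simpa using hB.measure_eq_natCast_pos (hC.diff hA) hvD (n := 0) (Or.inl rfl)
  have hi : IndepFun (fun ω => B ω A) (fun ω => B ω (C \ A)) P := by
    have := hB.iIndepFun_of_fintype (ι := Bool) (A := fun b => if b then A else C \ A)
      (by rintro (_ | _); exacts [hC.diff hA, hA])
      (by rintro (_ | _) (_ | _) hne
          · exact absurd rfl hne
          · exact disjoint_sdiff_left
          · exact disjoint_sdiff_right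
          · exact absurd rfl hne)
    simpa using this.indepFun (i := true) (j := false) (by simp)
  have e1 := hi.measure_inter_preimage_eq_mul {1} {0} (measurableSet_singleton _)
    (measurableSet_singleton _)
  have e2 := hind.measure_inter_preimage_eq_mul {π | π C = 0} {π | π A = 1 ∧ π (C \ A) = 0}
    (Measure.measurable_coe hC (measurableSet_singleton 0))
    ((Measure.measurable_coe hA (measurableSet_singleton 1)).inter
      (Measure.measurable_coe (hC.diff hA) (measurableSet_singleton 0)))
  have e3 : P (B ⁻¹' {π | π A = 1 ∧ π (C \ A) = 0}) =
      P {ω | B ω A = 1} * P {ω | B ω (C \ A) = 0} := e1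
  rw [e3] at e2
  exact (ENNReal.mul_pos h1.ne' (ENNReal.mul_pos h2.ne' h3.ne').ne').trans_le e2.ge

/-- Resampling gives independent Poisson processes again, so their unique stable matching is
perfect; Fubini fixes the configuration outside. Quantifying over all stable `m` allows the matching
built by hand to be inserted. -/
lemma ae_resample_perfect [IsProbabilityMeasure P] (hd : 1 ≤ d) (hR : IsUnitPoissonProcess P R)
    (hB : IsUnitPoissonProcess P B) (hind : IndepFun R B P) {C : Set (Space d)}
    (hC : MeasurableSet C) :
    ∀ᵐ ω ∂P, ∀ᵐ ω' ∂P, ∀ m, IsStableMatching (support (resample R C (ω, ω')))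
        (support (resample B C (ω, ω'))) m →
      IsPerfectMatching (support (resample R C (ω, ω'))) (support (resample B C (ω, ω'))) m := by
  have hR' := hR.resample hC
  have hB' := hB.resample hC
  have hi' := indepFun_resample hR.measurable hB.measurable hind hC
  have hg := ae_isGeneric hd hR' hB' hi'
  have hper := ae_isPerfectMatching (M := fun p => stableMatching (resample R C p) (resample B C p))
    hd hR' hB' hi' (hg.mono fun p h => h.isStableMatching_iff.2 rfl)
  refine Measure.ae_ae_of_ae_prod (p := fun p => ∀ m, IsStableMatching
    (support (resample R C p)) (support (resample B C p)) m → IsPerfectMatching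
    (support (resample R C p)) (support (resample B C p)) m) ?_
  filter_upwards [hg, hper] with p h1 h2 m hm
  rwa [h1.isStableMatching_iff.1 hm]

/-- A finite moment would give a typical `ω` with a trap region. This region is fixed for the
independent second sample `ω'`, which with positive probability places a single blue point there and
so spoils perfectness. -/
theorem IsMarkLaw.lintegral_pow_eq_top [IsProbabilityMeasure P] (hd : 1 ≤ d)
    (hR : IsUnitPoissonProcess P R) (hB : IsUnitPoissonProcess P B) (hind : IndepFun R B P)
    (hM : ∀ᵐ ω ∂P, IsStableMatching (support (R ω)) (support (B ω)) (M ω))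
    (h : IsMarkLaw P R M ν) : ∫⁻ t, t ^ d ∂ν = ∞ := by
  by_contra hne
  -- The trap region depends on `ω`, but trap regions are indexed by a countable set, so one null
  -- set serves them all.
  have hres : ∀ᵐ ω ∂P, ∀ q : ℕ × Finset (Fin d → ℤ), ∀ᵐ ω' ∂P, ∀ m,
      IsStableMatching (support (resample R (trapRegion q) (ω, ω')))
        (support (resample B (trapRegion q) (ω, ω'))) m →
      IsPerfectMatching (support (resample R (trapRegion q) (ω, ω')))
        (support (resample B (trapRegion q) (ω, ω'))) m :=
    ae_all_iff.2 fun q => ae_resample_perfect hd hR hB hind (measurableSet_trapRegion q)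
  obtain ⟨ω, h1, h2, h3, h4, h5, h6⟩ := (((((hR.ae_isCounting.and hB.ae_isCounting).and hM).and
    (ae_isPerfectMatching hd hR hB hind hM)).and (h.ae_finite_reachingPoints hd hne)).and
    hres).exists.imp fun ω hω => show _ ∧ _ ∧ _ ∧ _ ∧ _ ∧ _ by
      simpa only [and_assoc] using hω
  obtain ⟨q, hq1, hq2⟩ := exists_trapRegion h3 h4 h1.locFinite h2.locFinite h5
  have hball : Metric.ball (0 : Space d) 1 ⊆ trapRegion q := subset_union_left
  have hpos := measure_single_blue_pos hR hB hind measurableSet_ball (measurableSet_trapRegion q)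
    hball (Metric.measure_ball_pos volume 0 one_pos).ne' (volume_trapRegion_lt_top q).ne
  have hae := ((h6 q).and (hR.ae_isCounting.and hB.ae_isCounting))
  -- An event of positive probability meets the almost sure ones.
  obtain ⟨ω', ⟨hr, hb1, hb2⟩, h7, h8, h9⟩ := Measure.exists_mem_of_measure_ne_zero_of_ae hpos.ne'
    (ae_restrict_of_ae hae)
  rw [h8.apply, ENat.toENNReal_eq_zero, encard_eq_zero] at hr
  rw [h9.apply, ← ENat.toENNReal_one, ENat.toENNReal_inj, encard_eq_one] at hb1
  rw [h9.apply, ENat.toENNReal_eq_zero, encard_eq_zero] at hb2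
  obtain ⟨z, hz⟩ := hb1
  have hzm : z ∈ support (B ω') ∩ Metric.ball 0 1 := hz ▸ mem_singleton z
  have hb : support (B ω') ∩ trapRegion q = {z} := by
    rw [← hz]
    refine Subset.antisymm (fun y hy => ⟨hy.1, ?_⟩) fun y hy => ⟨hy.1, hball hy.2⟩
    by_contra hc
    exact (hb2 ▸ (⟨hy.1, hy.2, hc⟩ : y ∈ support (B ω') ∩ (trapRegion q \ Metric.ball 0 1)) :
      y ∈ (∅ : Set (Space d)))
  have e1 := (resample_isCounting (p := (ω, ω')) (measurableSet_trapRegion q) h1 h8).2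
  have e2 := (resample_isCounting (p := (ω, ω')) (measurableSet_trapRegion q) h2 h9).2
  rw [hr, union_empty] at e1
  rw [hb] at e2
  obtain ⟨m', hm1, hm2⟩ := exists_not_isPerfectMatching h3 hq1 hq2 hzm.2 (hball hzm.2)
  rw [← e1, ← e2] at hm1 hm2
  exact hm2 (h7 m' hm1)

end Moment


/-! ### The running maximum of a random walk -/

section RunMax

/-- The maximum of the partial sums of length at most `n`. -/
noncomputable def runMax (x : ℕ → ℝ) : ℕ → ℝ
  | 0 => 0
  | n + 1 => max (runMax x n) (∑ i ∈ Finset.range (n + 1), x i)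

lemma runMax_mono (x : ℕ → ℝ) : Monotone (runMax x) :=
  monotone_nat_of_le_succ fun _ => le_max_left _ _

lemma runMax_nonneg (x : ℕ → ℝ) (n : ℕ) : 0 ≤ runMax x n := runMax_mono x (Nat.zero_le n)

lemma sum_le_runMax (x : ℕ → ℝ) {k n : ℕ} (h : k ≤ n) :
    ∑ i ∈ Finset.range k, x i ≤ runMax x n := by
  cases k with
  | zero => simpa using runMax_nonneg x n
  | succ k => exact (le_max_right _ _).trans (runMax_mono x h)

lemma neg_sum_le_runMax (x : ℕ → ℝ) {k n : ℕ} (h : k ≤ n) :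
    -∑ i ∈ Finset.range k, x i ≤ runMax (-x) n := by
  simpa using sum_le_runMax (-x) h

lemma runMax_congr {x y : ℕ → ℝ} {n : ℕ} (h : ∀ i < n, x i = y i) : runMax x n = runMax y n := by
  induction n with
  | zero => rfl
  | succ n ih =>
    rw [runMax, runMax, ih fun i hi => h i (hi.trans n.lt_succ_self),
      Finset.sum_congr rfl fun i hi => h i (Finset.mem_range.1 hi)]

lemma runMax_le_sum_abs (x : ℕ → ℝ) (n : ℕ) : runMax x n ≤ ∑ i ∈ Finset.range n, |x i| := by
  induction n with
  | zero => simp [runMax]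
  | succ n ih =>
    refine max_le (ih.trans ?_) (Finset.sum_le_sum fun i _ => le_abs_self _)
    rw [Finset.sum_range_succ]
    linarith [abs_nonneg (x n)]

/-- Induction on `n`. A step that does not raise the maximum changes only the right side, by two
terms that cancel; a step that raises it leaves a surplus of half the squared increment. -/
lemma half_sq_runMax_le (x : ℕ → ℝ) (n : ℕ) :
    runMax x n ^ 2 / 2 ≤ runMax x n * ∑ i ∈ Finset.range n, x i -
      ∑ k ∈ Finset.range n, runMax x k * x k := by
  induction n with
  | zero => simp [runMax]
  | succ n ih =>
    have hS : ∑ i ∈ Finset.range (n + 1), x i = ∑ i ∈ Finset.range n, x i + x n :=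
      Finset.sum_range_succ _ _
    rw [Finset.sum_range_succ (fun k => runMax x k * x k)]
    rcases le_total (∑ i ∈ Finset.range (n + 1), x i) (runMax x n) with h | h
    · rw [runMax, max_eq_left h, hS]
      linarith
    · rw [runMax, max_eq_right h]
      rw [hS] at h ⊢
      nlinarith [sq_nonneg (∑ i ∈ Finset.range n, x i + x n - runMax x n)]

/-- A pathwise form of the maximal inequality of Doob. -/
lemma sq_runMax_le (x : ℕ → ℝ) (n : ℕ) :
    runMax x n ^ 2 ≤ 4 * (∑ i ∈ Finset.range n, x i) ^ 2 -
      4 * ∑ k ∈ Finset.range n, runMax x k * x k := by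
  nlinarith [half_sq_runMax_le x n, sq_nonneg (runMax x n - 2 * ∑ i ∈ Finset.range n, x i)]

variable {Ω : Type*} [MeasurableSpace Ω] {P : Measure Ω} {X : ℕ → Ω → ℝ}

lemma measurable_runMax : ∀ n, Measurable fun x : ℕ → ℝ => runMax x n
  | 0 => measurable_const
  | n + 1 => by
    have := measurable_runMax n
    simp only [runMax]
    fun_prop

lemma memLp_runMax (hX : ∀ i, MemLp (X i) 2 P) (hm : ∀ i, Measurable (X i)) (n : ℕ) :
    MemLp (fun ω => runMax (fun i => X i ω) n) 2 P := by
  have h : MemLp (fun ω => ∑ i ∈ Finset.range n, |X i ω|) 2 P :=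
    memLp_finsetSum _ fun i _ => (hX i).abs
  refine h.mono ((measurable_runMax n).comp (measurable_pi_lambda _ hm)).aestronglyMeasurable
    (ae_of_all _ fun ω => ?_)
  rw [Real.norm_of_nonneg (runMax_nonneg _ _),
    Real.norm_of_nonneg (Finset.sum_nonneg fun i _ => abs_nonneg _)]
  exact runMax_le_sum_abs _ _

/-- A centered step of an independent sequence is orthogonal to the functions of the past. -/
lemma integral_past_mul_eq_zero [IsProbabilityMeasure P] (hi : iIndepFun X P)
    (hm : ∀ i, Measurable (X i)) (h0 : ∀ i, ∫ ω, X i ω ∂P = 0) {φ : (ℕ → ℝ) → ℝ}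
    (hφ : Measurable φ) {n : ℕ} (hc : ∀ x y : ℕ → ℝ, (∀ i < n, x i = y i) → φ x = φ y) :
    ∫ ω, φ (fun i => X i ω) * X n ω ∂P = 0 := by
  have hind := hi.indepFun_finset (Finset.range n) {n} (by simp) hm
  -- Extension by zero: `φ` sees only the first `n` coordinates, so it becomes a function of the
  -- finite past.
  let e : (Finset.range n → ℝ) → ℕ → ℝ := fun v i => if h : i ∈ Finset.range n then v ⟨i, h⟩ else 0
  have he : Measurable e := by
    refine measurable_pi_lambda _ fun i => ?_
    by_cases h : i ∈ Finset.range n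
    · simp only [e, dif_pos h]; exact measurable_pi_apply _
    · simp only [e, dif_neg h]; exact measurable_const
  have hind' := hind.comp (hφ.comp he)
    (measurable_pi_apply (⟨n, Finset.mem_singleton_self n⟩ : ({n} : Finset ℕ)))
  have e1 : (φ ∘ e) ∘ (fun ω (i : Finset.range n) => X i ω) = fun ω => φ (fun i => X i ω) := by
    funext ω
    refine hc _ _ fun i hi => ?_
    simp [e, hi]
  rw [e1] at hind'
  have := hind'.integral_fun_mul_eq_mul_integral (hφ.comp (measurable_pi_lambda _ hm)).aestronglyMeasurable
    (hm n).aestronglyMeasurable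
  refine this.trans ?_
  exact mul_eq_zero_of_right _ (h0 n)

/-- Each new step is orthogonal to the previous partial sum, so variances add. -/
lemma integral_sq_sum_le [IsProbabilityMeasure P] (hi : iIndepFun X P)
    (hm : ∀ i, Measurable (X i)) (hX : ∀ i, MemLp (X i) 2 P) (h0 : ∀ i, ∫ ω, X i ω ∂P = 0)
    {v : ℝ} (hv : ∀ i, ∫ ω, X i ω ^ 2 ∂P ≤ v) (n : ℕ) :
    ∫ ω, (∑ i ∈ Finset.range n, X i ω) ^ 2 ∂P ≤ n * v := by
  induction n with
  | zero => simp
  | succ n ih =>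
    have hS : MemLp (fun ω => ∑ i ∈ Finset.range n, X i ω) 2 P := memLp_finsetSum _ fun i _ => hX i
    have hz := integral_past_mul_eq_zero hi hm h0 (φ := fun x => ∑ i ∈ Finset.range n, x i) (n := n)
      (by fun_prop) (fun x y h => Finset.sum_congr rfl fun i hi => h i (Finset.mem_range.1 hi))
    have e : ∀ ω, (∑ i ∈ Finset.range (n + 1), X i ω) ^ 2 = (∑ i ∈ Finset.range n, X i ω) ^ 2 +
        2 * ((∑ i ∈ Finset.range n, X i ω) * X n ω) + X n ω ^ 2 := by
      intro ω; rw [Finset.sum_range_succ]; ring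
    have i1 := hS.integrable_sq
    have i2 : Integrable (fun ω => 2 * ((∑ i ∈ Finset.range n, X i ω) * X n ω)) P :=
      (hS.integrable_mul (hX n)).const_mul 2
    have i3 := (hX n).integrable_sq
    have i12 : Integrable (fun ω => (∑ i ∈ Finset.range n, X i ω) ^ 2 +
      2 * ((∑ i ∈ Finset.range n, X i ω) * X n ω)) P := i1.add i2
    simp_rw [e]
    rw [integral_add i12 i3, integral_add i1 i2, integral_const_mul, hz]
    push_cast
    linarith [hv n]

/-- In the pathwise inequality every product `runMax x k * x k` has mean zero, because the maximum
up to time `k` involves only earlier steps. -/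
lemma integral_sq_runMax_le [IsProbabilityMeasure P] (hi : iIndepFun X P)
    (hm : ∀ i, Measurable (X i)) (hX : ∀ i, MemLp (X i) 2 P) (h0 : ∀ i, ∫ ω, X i ω ∂P = 0)
    {v : ℝ} (hv : ∀ i, ∫ ω, X i ω ^ 2 ∂P ≤ v) (n : ℕ) :
    ∫ ω, runMax (fun i => X i ω) n ^ 2 ∂P ≤ 4 * (n * v) := by
  have hS : MemLp (fun ω => ∑ i ∈ Finset.range n, X i ω) 2 P := memLp_finsetSum _ fun i _ => hX i
  have i1 : Integrable (fun ω => 4 * (∑ i ∈ Finset.range n, X i ω) ^ 2) P :=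
    hS.integrable_sq.const_mul 4
  have i2 : ∀ k, Integrable (fun ω => runMax (fun i => X i ω) k * X k ω) P := fun k =>
    (memLp_runMax hX hm k).integrable_mul (hX k)
  have i3 : Integrable (fun ω => 4 * ∑ k ∈ Finset.range n, runMax (fun i => X i ω) k * X k ω) P :=
    (integrable_finsetSum _ fun k _ => i2 k).const_mul 4
  calc ∫ ω, runMax (fun i => X i ω) n ^ 2 ∂P
      ≤ ∫ ω, (4 * (∑ i ∈ Finset.range n, X i ω) ^ 2 -
          4 * ∑ k ∈ Finset.range n, runMax (fun i => X i ω) k * X k ω) ∂P :=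
        integral_mono (memLp_runMax hX hm n).integrable_sq (i1.sub i3) fun ω => sq_runMax_le _ n
    _ = 4 * ∫ ω, (∑ i ∈ Finset.range n, X i ω) ^ 2 ∂P := by
        rw [integral_sub i1 i3, integral_const_mul, integral_const_mul,
          integral_finsetSum _ fun k _ => i2 k, Finset.sum_eq_zero fun k _ =>
            integral_past_mul_eq_zero hi hm h0 (φ := fun x => runMax x k) (measurable_runMax k)
              fun x y h => runMax_congr h]
        ring
    _ ≤ _ := by gcongr; exact integral_sq_sum_le hi hm hX h0 hv n

/-- The mean of the running maximum is of the order of the square root of the time. -/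
lemma lintegral_runMax_le [IsProbabilityMeasure P] (hi : iIndepFun X P)
    (hm : ∀ i, Measurable (X i)) (hX : ∀ i, MemLp (X i) 2 P) (h0 : ∀ i, ∫ ω, X i ω ∂P = 0)
    (hv : ∀ i, ∫ ω, X i ω ^ 2 ∂P ≤ 1) {n : ℕ} (hn : 1 ≤ n) :
    ∫⁻ ω, ENNReal.ofReal (runMax (fun i => X i ω) n) ∂P ≤ ENNReal.ofReal (5 / 2 * √n) := by
  have hs : 0 < √(n : ℝ) := Real.sqrt_pos.2 (by exact_mod_cast hn)
  have hsq : √(n : ℝ) * √n = n := Real.mul_self_sqrt (Nat.cast_nonneg n)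
  have hL := memLp_runMax hX hm n
  rw [← ofReal_integral_eq_lintegral_ofReal (hL.integrable one_le_two)
    (ae_of_all _ fun ω => runMax_nonneg _ _)]
  refine ENNReal.ofReal_le_ofReal ?_
  have i1 : Integrable (fun ω => 1 / (2 * √(n : ℝ)) * runMax (fun i => X i ω) n ^ 2) P :=
    hL.integrable_sq.const_mul _
  calc ∫ ω, runMax (fun i => X i ω) n ∂P
      ≤ ∫ ω, (1 / (2 * √(n : ℝ)) * runMax (fun i => X i ω) n ^ 2 + √n / 2) ∂P := by
        refine integral_mono (hL.integrable one_le_two) (i1.add (integrable_const _)) fun ω => ?_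
        dsimp only
        set a := runMax (fun i => X i ω) n
        -- Completing the square bounds the mean by the second moment `4 * n`, giving `2 * √n + √n /
        -- 2`.
        have h1 : 0 ≤ (a - √(n : ℝ)) ^ 2 / (2 * √n) := by positivity
        have h2 : (a - √(n : ℝ)) ^ 2 / (2 * √n) = 1 / (2 * √n) * a ^ 2 + √n / 2 - a := by
          field_simp; ring
        linarith
    _ = 1 / (2 * √(n : ℝ)) * ∫ ω, runMax (fun i => X i ω) n ^ 2 ∂P + √n / 2 := by
        rw [integral_add i1 (integrable_const _), integral_const_mul]
        simp
    _ ≤ 1 / (2 * √(n : ℝ)) * (4 * (n * 1)) + √n / 2 := by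
        gcongr; exact integral_sq_runMax_le hi hm hX h0 hv n
    _ = 5 / 2 * √n := by
        rw [mul_one]
        nth_rewrite 2 [← hsq]
        field_simp
        ring

end RunMax


/-! ### Dimension one -/

section Line

/-- The unit interval `[k, k + 1)`. -/
def unitSegment (k : ℕ) : Set (Space 1) := {x | ∀ i, x i ∈ Ico (k : ℝ) (k + 1)}

lemma measurableSet_unitSegment (k : ℕ) : MeasurableSet (unitSegment k) :=
  measurableSet_box fun _ => measurableSet_Ico

lemma volume_unitSegment (k : ℕ) : volume (unitSegment k) = 1 := by
  have := volume_box (d := 1) (I := fun _ => Ico (k : ℝ) (k + 1)) fun _ => measurableSet_Ico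
  rw [unitSegment, this]
  simp

lemma mem_unitSegment_iff {k : ℕ} {x : Space 1} (hx : 0 ≤ x 0) : x ∈ unitSegment k ↔ ⌊x 0⌋₊ = k := by
  rw [Nat.floor_eq_iff hx]
  simp [unitSegment]

lemma pairwise_disjoint_unitSegment : Pairwise fun i j => Disjoint (unitSegment i) (unitSegment j) := by
  intro i j hij
  rw [Set.disjoint_left]
  intro x hi hj
  have h0 : 0 ≤ x 0 := (Nat.cast_nonneg i).trans (hi 0).1
  exact hij (((mem_unitSegment_iff h0).1 hi).symm.trans ((mem_unitSegment_iff h0).1 hj))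

/-- The deviation of the number of points in `[k, k + 1)`. -/
noncomputable def segmentDeviation (π : Measure (Space 1)) (k : ℕ) : ℝ := (π (unitSegment k)).toReal - 1

lemma dist_eq_abs_coord (x y : Space 1) : dist x y = |x 0 - y 0| := by
  rw [EuclideanSpace.dist_eq]
  simp [Real.sqrt_sq_eq_abs, Real.dist_eq]

variable {U V : Set (Space 1)} {m : Set (Space 1 × Space 1)}

/-- No short edge jumps over a red point matched far away. -/
lemma IsStableMatching.not_crosses (h : IsStableMatching U V m) {r : ℝ≥0∞} {a x y : Space 1}
    (ha : a ∈ U) (har : r < redDist m a) (hxy : (x, y) ∈ m) (hr : blueDist m y ≤ r) :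
    (x 0 ≤ a 0 → y 0 < a 0) ∧ (a 0 ≤ x 0 → a 0 < y 0) := by
  have hb := h.partialMatching.blueDist_eq hxy
  have hr' := h.partialMatching.redDist_eq hxy
  have hxa : x 0 ≠ a 0 := by
    intro he
    have : x = a := by ext i; rw [Subsingleton.elim i 0, he]
    rw [this] at hr' hb
    rw [hr', ← hb] at har
    exact absurd har (not_lt.2 hr)
  -- If `y` were closer to `a` than to its partner `x`, then `a`, whose own partner is even farther,
  -- would form an unstable pair with `y`.
  have key : ¬ dist a y < dist x y := fun hlt => by
    rw [← edist_lt_edist_iff] at hlt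
    refine h.stable a ha y (h.partialMatching.subset hxy).2 (lt_min ?_ (hb ▸ hlt))
    exact (hlt.trans_le (hb ▸ hr)).trans har
  rw [dist_eq_abs_coord, dist_eq_abs_coord] at key
  constructor
  · intro h1
    by_contra! h2
    have : x 0 < a 0 := lt_of_le_of_ne h1 hxa
    rw [abs_of_nonpos (by linarith), abs_of_nonpos (by linarith)] at key
    exact key (by linarith)
  · intro h1
    by_contra! h2
    have : a 0 < x 0 := lt_of_le_of_ne h1 hxa.symm
    rw [abs_of_nonneg (by linarith), abs_of_nonneg (by linarith)] at key
    exact key (by linarith)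

/-- The red points matched far away span an interval where they are the red surplus. -/
lemma IsStableMatching.exists_interval (h : IsStableMatching U V m) {L : ℕ}
    (hfin : (U ∩ cube 1 L).Finite)
    (hne : (markedPoints U m (cube 1 L ×ˢ Ioi (L : ℝ≥0∞))).Nonempty) :
    ∃ a ∈ cube 1 L, ∃ b ∈ cube 1 L, a 0 ≤ b 0 ∧
      ((markedPoints U m (cube 1 L ×ˢ Ioi (L : ℝ≥0∞))).encard : ℝ≥0∞) +
        ((V ∩ {x | x 0 ∈ Icc (a 0) (b 0)}).encard : ℝ≥0∞) ≤
          ((U ∩ {x | x 0 ∈ Icc (a 0) (b 0)}).encard : ℝ≥0∞) := by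
  set D := markedPoints U m (cube 1 L ×ˢ Ioi (L : ℝ≥0∞)) with hD
  have hDfin : D.Finite := hfin.subset fun x hx => ⟨hx.1, hx.2.1⟩
  obtain ⟨a, ha, hamin⟩ := exists_min_image D (fun x => x 0) hDfin hne
  obtain ⟨b, hb, hbmax⟩ := exists_max_image D (fun x => x 0) hDfin hne
  refine ⟨a, ha.2.1, b, hb.2.1, hamin b hb, ?_⟩
  set J : Set (Space 1) := {x | x 0 ∈ Icc (a 0) (b 0)} with hJ
  have hJQ : J ⊆ cube 1 L := by
    intro x hx i
    rw [Subsingleton.elim i 0]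
    exact ⟨(ha.2.1 0).1.trans hx.1, hx.2.trans_lt (hb.2.1 0).2⟩
  -- The far red point `a` excludes far blue points from the cube.
  have hshort : ∀ y ∈ V ∩ J, blueDist m y ≤ L := by
    rcases h.red_far_or_blue_far (Q := cube 1 L) (r := L) (fun x hx y hy => by
      simpa using edist_le_of_mem_cube hx hy) with hc | hc
    · exact absurd (hc a ⟨ha.1, ha.2.1⟩) (not_le.2 ha.2.2)
    · exact fun y hy => hc y ⟨hy.1, hJQ hy.2⟩
  -- Taking `ρ = r` empties the intermediate range, and the crossing term vanishes because no short
  -- edge jumps over the far end points `a` and `b`.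
  have key := h.partialMatching.far_add_le (ρ := L) (r := L) (by simp) hshort
  have e1 : markedPoints U m (J ×ˢ Ioi (L : ℝ≥0∞)) = D := by
    ext x
    constructor
    · exact fun hx => ⟨hx.1, hJQ hx.2.1, hx.2.2⟩
    · exact fun hx => ⟨hx.1, ⟨hamin x hx, hbmax x hx⟩, hx.2.2⟩
  have e2 : markedPoints V (Prod.swap ⁻¹' m) (J ×ˢ Ioc (L : ℝ≥0∞) L) = ∅ := by
    ext x; simp [markedPoints]
  have e3 : crossPoints V (Prod.swap ⁻¹' m) J L = ∅ := by
    ext y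
    simp only [crossPoints, mem_ofPred_eq, mem_empty_iff_false, iff_false]
    rintro ⟨hy, hyL, x, hxy, hxJ⟩
    rw [redDist_swap] at hyL
    have ca := h.not_crosses ha.1 ha.2.2 (x := x) (y := y) hxy hyL
    have cb := h.not_crosses hb.1 hb.2.2 (x := x) (y := y) hxy hyL
    refine hxJ ⟨?_, ?_⟩
    · by_contra! hlt
      exact absurd hy.2.1 (not_le.2 (ca.1 hlt.le))
    · by_contra! hlt
      exact absurd hy.2.2 (not_le.2 (cb.2 hlt.le))
  rw [e1, e2, e3] at key
  simpa using key

/-- The number of red points matched far away is bounded by the fluctuations of the numbers of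
points. -/
lemma IsStableMatching.far_le_runMax {π ρ : Measure (Space 1)}
    (hπ : IsCounting π) (hρ : IsCounting ρ) (h : IsStableMatching (support π) (support ρ) m) {L : ℕ}
    (hfin : π (cube 1 L) ≠ ∞) (hfπ : ∀ k, π (unitSegment k) ≠ ∞)
    (hfρ : ∀ k, ρ (unitSegment k) ≠ ∞) :
    ((markedPoints (support π) m (cube 1 L ×ˢ Ioi (L : ℝ≥0∞))).encard : ℝ≥0∞) ≤
      ENNReal.ofReal (runMax (segmentDeviation π) L + runMax (-segmentDeviation π) L +
        3 * (runMax (segmentDeviation ρ) L + runMax (-segmentDeviation ρ) L) + 2) := by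
  set x := segmentDeviation π with hx
  set y := segmentDeviation ρ with hy
  rcases (markedPoints (support π) m (cube 1 L ×ˢ Ioi (L : ℝ≥0∞))).eq_empty_or_nonempty with he | hne
  · rw [he]; simp
  rw [hπ.apply, ENat.toENNReal_ne_top, encard_ne_top_iff] at hfin
  obtain ⟨a, ha, b, hb, hab, key⟩ := h.exists_interval hfin hne
  rw [← hπ.apply, ← hρ.apply] at key
  set far := ((markedPoints (support π) m (cube 1 L ×ˢ Ioi (L : ℝ≥0∞))).encard : ℝ≥0∞)
  set J : Set (Space 1) := {x | x 0 ∈ Icc (a 0) (b 0)} with hJ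
  have ha0 : 0 ≤ a 0 := (ha 0).1
  have hb0 : 0 ≤ b 0 := (hb 0).1
  set i := ⌊a 0⌋₊ with hi
  set j := ⌊b 0⌋₊ with hj
  have hij : i ≤ j := Nat.floor_le_floor hab
  have hjL : j < L := (Nat.floor_lt hb0).2 (hb 0).2
  -- Red counts are rounded up to all unit segments meeting `J`, blue counts down to those strictly
  -- between the segments of the end points.
  have hup : π J ≤ ∑ k ∈ Finset.Ico i (j + 1), π (unitSegment k) := by
    refine (measure_mono fun z hz => ?_).trans (measure_biUnion_finset_le _ _)
    simp only [mem_iUnion]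
    refine ⟨⌊z 0⌋₊, ?_, (mem_unitSegment_iff (ha0.trans hz.1)).2 rfl⟩
    rw [Finset.mem_Ico, Nat.lt_succ_iff]
    exact ⟨Nat.floor_le_floor hz.1, Nat.floor_le_floor hz.2⟩
  have hdown : ∑ k ∈ Finset.Ioo i j, ρ (unitSegment k) ≤ ρ J := by
    rw [← measure_biUnion_finset (fun k _ l _ hkl => pairwise_disjoint_unitSegment hkl)
      fun k _ => measurableSet_unitSegment k]
    refine measure_mono (iUnion₂_subset fun k hk z hz => ?_)
    rw [Finset.mem_Ioo] at hk
    have h1 : a 0 < i + 1 := Nat.lt_floor_add_one _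
    have h2 : (j : ℝ) ≤ b 0 := Nat.floor_le hb0
    have h3 : ((i + 1 : ℕ) : ℝ) ≤ k := by exact_mod_cast hk.1
    have h4 : ((k + 1 : ℕ) : ℝ) ≤ j := by exact_mod_cast hk.2
    push_cast at h3 h4
    exact ⟨by linarith [(hz 0).1], by linarith [(hz 0).2]⟩
  have hsumπ : ∑ k ∈ Finset.Ico i (j + 1), π (unitSegment k) ≠ ∞ :=
    ENNReal.sum_ne_top.2 fun k _ => hfπ k
  have hsumρ : ∑ k ∈ Finset.Ioo i j, ρ (unitSegment k) ≠ ∞ :=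
    ENNReal.sum_ne_top.2 fun k _ => hfρ k
  have hle : far + ∑ k ∈ Finset.Ioo i j, ρ (unitSegment k) ≤
      ∑ k ∈ Finset.Ico i (j + 1), π (unitSegment k) :=
    (by gcongr : far + _ ≤ far + ρ J).trans (key.trans hup)
  have hfar : far ≠ ∞ := ne_top_of_le_ne_top hsumπ (le_self_add.trans hle)
  have hle' := ENNReal.toReal_mono hsumπ hle
  rw [ENNReal.toReal_add hfar hsumρ, ENNReal.toReal_sum fun k _ => hfρ k,
    ENNReal.toReal_sum fun k _ => hfπ k] at hle'
  have eπ : ∀ k, (π (unitSegment k)).toReal = x k + 1 := fun k => by simp [hx, segmentDeviation]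
  have eρ : ∀ k, (ρ (unitSegment k)).toReal = y k + 1 := fun k => by simp [hy, segmentDeviation]
  have hpos : ∀ k, 0 ≤ y k + 1 := fun k => eρ k ▸ ENNReal.toReal_nonneg
  simp_rw [eπ, eρ] at hle'
  have hends : ∑ k ∈ Finset.Ico i (j + 1), (y k + 1) ≤
      (y i + 1) + ((y j + 1) + ∑ k ∈ Finset.Ioo i j, (y k + 1)) := by
    have hs1 : Finset.Ico i (j + 1) ⊆ insert i (insert j (Finset.Ioo i j)) := by
      -- For `i = j` the end segment is counted twice on the right, harmlessly since counts are
      -- nonnegative.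
      intro k; simp only [Finset.mem_Ico, Finset.mem_insert, Finset.mem_Ioo]; lia
    refine (Finset.sum_le_sum_of_subset_of_nonneg hs1 fun k _ _ => hpos k).trans ?_
    have hins : ∀ (s : Finset ℕ) (c : ℕ), ∑ k ∈ insert c s, (y k + 1) ≤
        (y c + 1) + ∑ k ∈ s, (y k + 1) := by
      intro s c
      by_cases hc : c ∈ s
      · rw [Finset.insert_eq_of_mem hc]; linarith [hpos c]
      · rw [Finset.sum_insert hc]
    exact (hins _ _).trans (by gcongr; exact hins _ _)
  have hsplit : ∀ w : ℕ → ℝ, ∑ k ∈ Finset.Ico i (j + 1), (w k + 1) =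
      (∑ k ∈ Finset.range (j + 1), w k - ∑ k ∈ Finset.range i, w k) + (j + 1 - i : ℕ) := by
    intro w
    rw [Finset.sum_add_distrib, Finset.sum_Ico_eq_sub _ (by lia)]
    simp
  rw [hsplit] at hle' hends
  -- A single step is at most the range of the walk. The two blue end segments thus cost two ranges
  -- and the constant `2`, which with the range of the blue increment itself gives the factor `3`.
  have hstep : ∀ k < L, y k ≤ runMax y L + runMax (-y) L := by
    intro k hk
    have h1 := sum_le_runMax y (k := k + 1) (n := L) hk
    have h2 := neg_sum_le_runMax y (k := k) (n := L) hk.le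
    rw [Finset.sum_range_succ] at h1
    linarith
  rw [← ENNReal.ofReal_toReal hfar]
  refine ENNReal.ofReal_le_ofReal ?_
  have b1 := sum_le_runMax x (k := j + 1) (n := L) hjL
  have b2 := neg_sum_le_runMax x (k := i) (n := L) (by lia)
  have b3 := neg_sum_le_runMax y (k := j + 1) (n := L) hjL
  have b4 := sum_le_runMax y (k := i) (n := L) (by lia)
  have b5 := hstep i (by lia)
  have b6 := hstep j hjL
  linarith

end Line

/-! ### The tail with exponent one half -/

section LineTail

variable {Ω : Type*} [MeasurableSpace Ω] {P : Measure Ω} {R B : Ω → Measure (Space 1)}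
  {M : Ω → Set (Space 1 × Space 1)} {ν : Measure ℝ≥0∞}

lemma IsUnitPoissonProcess.measurable_segmentDeviation (h : IsUnitPoissonProcess P R) (k : ℕ) :
    Measurable fun ω => segmentDeviation (R ω) k :=
  (h.measurable_apply (measurableSet_unitSegment k)).ennreal_toReal.sub_const 1

lemma IsUnitPoissonProcess.lintegral_sq_segmentDeviation (h : IsUnitPoissonProcess P R) (k : ℕ) :
    ∫⁻ ω, ENNReal.ofReal (segmentDeviation (R ω) k ^ 2) ∂P = 1 := by
  have := h.lintegral_sq_sub (measurableSet_unitSegment k) (by simp [volume_unitSegment])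
  simpa [volume_unitSegment, segmentDeviation] using this

lemma IsUnitPoissonProcess.memLp_segmentDeviation (h : IsUnitPoissonProcess P R) (k : ℕ) :
    MemLp (fun ω => segmentDeviation (R ω) k) 2 P := by
  rw [memLp_two_iff_integrable_sq (h.measurable_segmentDeviation k).aestronglyMeasurable]
  refine ⟨((h.measurable_segmentDeviation k).pow_const 2).aestronglyMeasurable, ?_⟩
  rw [hasFiniteIntegral_iff_ofReal (ae_of_all _ fun ω => sq_nonneg _),
    h.lintegral_sq_segmentDeviation k]
  exact ENNReal.one_lt_top

lemma IsUnitPoissonProcess.integral_segmentDeviation [IsProbabilityMeasure P]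
    (h : IsUnitPoissonProcess P R) (k : ℕ) : ∫ ω, segmentDeviation (R ω) k ∂P = 0 := by
  have h1 := h.lintegral_apply (measurableSet_unitSegment k) (by simp [volume_unitSegment])
  rw [volume_unitSegment] at h1
  have hm := h.measurable_apply (measurableSet_unitSegment k)
  have h2 : ∫ ω, (R ω (unitSegment k)).toReal ∂P = 1 := by
    rw [integral_toReal hm.aemeasurable (ae_lt_top hm (by simp [h1])), h1, ENNReal.toReal_one]
  have h3 : Integrable (fun ω => (R ω (unitSegment k)).toReal) P :=
    integrable_toReal_of_lintegral_ne_top hm.aemeasurable (by simp [h1])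
  simp only [segmentDeviation]
  rw [integral_sub h3 (integrable_const _), h2]
  simp

lemma IsUnitPoissonProcess.integral_sq_segmentDeviation (h : IsUnitPoissonProcess P R) (k : ℕ) :
    ∫ ω, segmentDeviation (R ω) k ^ 2 ∂P = 1 := by
  rw [integral_eq_lintegral_of_nonneg_ae (ae_of_all _ fun ω => sq_nonneg _)
    ((h.measurable_segmentDeviation k).pow_const 2).aestronglyMeasurable,
    h.lintegral_sq_segmentDeviation k, ENNReal.toReal_one]

lemma IsUnitPoissonProcess.iIndepFun_segmentDeviation (h : IsUnitPoissonProcess P R) :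
    iIndepFun (fun k ω => segmentDeviation (R ω) k) P := by
  have h1 : iIndepFun (fun k ω => R ω (unitSegment k)) P := by
    rw [iIndepFun_iff_finset]
    intro s
    exact h.iIndepFun_of_fintype (fun i : s => measurableSet_unitSegment i)
      fun i j hij => pairwise_disjoint_unitSegment fun he => hij (Subtype.ext he)
  exact h1.comp (fun _ t => t.toReal - 1) fun _ => by fun_prop

lemma IsUnitPoissonProcess.lintegral_runMax_le [IsProbabilityMeasure P]
    (h : IsUnitPoissonProcess P R) {n : ℕ} (hn : 1 ≤ n) :
    ∫⁻ ω, ENNReal.ofReal (runMax (segmentDeviation (R ω)) n + runMax (-segmentDeviation (R ω)) n) ∂P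
      ≤ ENNReal.ofReal (5 * √n) := by
  have h1 := StableMatching.lintegral_runMax_le h.iIndepFun_segmentDeviation
    h.measurable_segmentDeviation h.memLp_segmentDeviation h.integral_segmentDeviation
    (fun k => (h.integral_sq_segmentDeviation k).le) hn
  have h2 := StableMatching.lintegral_runMax_le
    (X := fun k ω => -segmentDeviation (R ω) k)
    (h.iIndepFun_segmentDeviation.comp (fun _ t => -t) fun _ => measurable_neg)
    (fun k => (h.measurable_segmentDeviation k).neg) (fun k => (h.memLp_segmentDeviation k).neg)
    (fun k => by rw [integral_neg, h.integral_segmentDeviation k, neg_zero])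
    (fun k => by simp only [neg_sq]; exact (h.integral_sq_segmentDeviation k).le) hn
  have hm : Measurable fun ω => ENNReal.ofReal (runMax (segmentDeviation (R ω)) n) :=
    ((measurable_runMax n).comp
      (measurable_pi_lambda _ h.measurable_segmentDeviation)).ennreal_ofReal
  calc _ = ∫⁻ ω, (ENNReal.ofReal (runMax (segmentDeviation (R ω)) n) +
        ENNReal.ofReal (runMax (-segmentDeviation (R ω)) n)) ∂P :=
        lintegral_congr fun ω => ENNReal.ofReal_add (runMax_nonneg _ _) (runMax_nonneg _ _)
    _ ≤ ENNReal.ofReal (5 / 2 * √n) + ENNReal.ofReal (5 / 2 * √n) := by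
        rw [lintegral_add_left hm]
        exact add_le_add h1 h2
    _ = _ := by
        rw [← ENNReal.ofReal_add (by positivity) (by positivity)]
        congr 1; ring

/-- The ranges of both walks have mean at most `5 * √L`, so the pathwise bound gives `5 + 3 * 5 + 2
= 22` times `√L`. -/
lemma IsMarkLaw.natCast_mul_tail_le [IsProbabilityMeasure P]
    (hR : IsUnitPoissonProcess P R) (hB : IsUnitPoissonProcess P B)
    (hM : ∀ᵐ ω ∂P, IsStableMatching (support (R ω)) (support (B ω)) (M ω))
    (h : IsMarkLaw P R M ν) {L : ℕ} (hL : 1 ≤ L) :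
    (L : ℝ≥0∞) * ν (Ioi (L : ℝ≥0∞)) ≤ ENNReal.ofReal (22 * √L) := by
  have hs : 1 ≤ √(L : ℝ) := Real.one_le_sqrt.2 (by exact_mod_cast hL)
  have hQ : MeasurableSet (cube 1 L) := measurableSet_cube (L : ℝ)
  have hvQ : volume (cube 1 (L : ℝ)) ≠ ∞ := by rw [volume_cube]; finiteness
  have hseg : ∀ {R' : Ω → Measure (Space 1)}, IsUnitPoissonProcess P R' →
      ∀ᵐ ω ∂P, ∀ k, R' ω (unitSegment k) ≠ ∞ := fun h => ae_all_iff.2 fun k =>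
    h.ae_apply_ne_top (measurableSet_unitSegment k) (by simp [volume_unitSegment])
  set a : (Ω → Measure (Space 1)) → Ω → ℝ := fun R ω =>
    runMax (segmentDeviation (R ω)) L + runMax (-segmentDeviation (R ω)) L with ha
  have ha0 : ∀ R ω, 0 ≤ a R ω := fun R ω => add_nonneg (runMax_nonneg _ _) (runMax_nonneg _ _)
  have hm : Measurable fun ω => ENNReal.ofReal (a R ω) := by
    have h1 := measurable_pi_lambda _ hR.measurable_segmentDeviation
    exact (((measurable_runMax L).comp h1).add ((measurable_runMax L).comp h1.neg)).ennreal_ofReal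
  have hpt : ∀ᵐ ω ∂P, ((markedPoints (support (R ω)) (M ω)
      (cube 1 L ×ˢ Ioi (L : ℝ≥0∞))).encard : ℝ≥0∞) ≤
        ENNReal.ofReal (a R ω) + 3 * ENNReal.ofReal (a B ω) + 2 := by
    filter_upwards [hM, hR.ae_isCounting, hB.ae_isCounting, hR.ae_apply_ne_top hQ hvQ, hseg hR,
      hseg hB] with ω h1 h2 h3 h4 h5 h6
    refine (h1.far_le_runMax h2 h3 h4 h5 h6).trans (le_of_eq ?_)
    rw [ENNReal.ofReal_add (by have := ha0 R ω; have := ha0 B ω; positivity) (by norm_num),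
      ENNReal.ofReal_add (ha0 R ω) (by have := ha0 B ω; positivity),
      ENNReal.ofReal_mul (by norm_num)]
    simp [ha]
  have key := lintegral_mono_ae hpt
  rw [h.lintegral_prod hQ measurableSet_Ioi, volume_cube, pow_one,
    lintegral_add_right _ measurable_const, lintegral_add_left hm, lintegral_const, measure_univ,
    mul_one, lintegral_const_mul' _ _ (by simp)] at key
  refine key.trans ?_
  calc _ ≤ ENNReal.ofReal (5 * √L) + 3 * ENNReal.ofReal (5 * √L) + ENNReal.ofReal (2 * √L) := by
        gcongr
        · exact hR.lintegral_runMax_le hL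
        · exact hB.lintegral_runMax_le hL
        · rw [show (2 : ℝ≥0∞) = ENNReal.ofReal 2 by simp]
          exact ENNReal.ofReal_le_ofReal (by linarith)
    _ = _ := by
        rw [show (3 : ℝ≥0∞) = ENNReal.ofReal 3 by simp, ← ENNReal.ofReal_mul (by norm_num),
          ← ENNReal.ofReal_add (by positivity) (by positivity),
          ← ENNReal.ofReal_add (by positivity) (by positivity)]
        congr 1; ring

/-- The tail of the matching distance in dimension one. -/
theorem IsMarkLaw.tail_le_rpow_neg_half [IsProbabilityMeasure P]
    (hR : IsUnitPoissonProcess P R) (hB : IsUnitPoissonProcess P B)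
    (hM : ∀ᵐ ω ∂P, IsStableMatching (support (R ω)) (support (B ω)) (M ω))
    (h : IsMarkLaw P R M ν) {r : ℝ} (hr : 0 < r) :
    ν (Ioi (ENNReal.ofReal r)) ≤ ENNReal.ofReal (44 * r ^ (-(1 / 2) : ℝ)) := by
  have := h.prob
  rcases lt_or_ge r 1 with h1 | h1
  · refine prob_le_one.trans ?_
    have : 1 ≤ r ^ (-(1 / 2) : ℝ) :=
      Real.one_le_rpow_of_pos_of_le_one_of_nonpos hr h1.le (by norm_num)
    rw [← ENNReal.ofReal_one]
    exact ENNReal.ofReal_le_ofReal (by linarith)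
  · set L := ⌊r⌋₊ with hL
    have hL1 : 1 ≤ L := Nat.one_le_floor_iff _ |>.2 h1
    have hLr : (L : ℝ) ≤ r := Nat.floor_le hr.le
    have hrL : r < L + 1 := Nat.lt_floor_add_one r
    have hL1' : (1 : ℝ) ≤ L := by exact_mod_cast hL1
    have hmono : ν (Ioi (ENNReal.ofReal r)) ≤ ν (Ioi (L : ℝ≥0∞)) := by
      refine measure_mono (Ioi_subset_Ioi ?_)
      rw [← ENNReal.ofReal_natCast]
      exact ENNReal.ofReal_le_ofReal hLr
    have key := ENNReal.toReal_mono ENNReal.ofReal_ne_top (h.natCast_mul_tail_le hR hB hM hL1)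
    rw [ENNReal.toReal_mul, ENNReal.toReal_natCast, ENNReal.toReal_ofReal (by positivity)] at key
    refine hmono.trans ?_
    rw [← ENNReal.ofReal_toReal (measure_ne_top ν (Ioi (L : ℝ≥0∞)))]
    refine ENNReal.ofReal_le_ofReal ?_
    set p := (ν (Ioi (L : ℝ≥0∞))).toReal
    have hsL : √(L : ℝ) * √L = L := Real.mul_self_sqrt (by positivity)
    have hsLpos : 0 < √(L : ℝ) := Real.sqrt_pos.2 (by positivity)
    -- Rounding `r ≥ 1` down to an integer costs at most this factor `2`, whence `44 = 2 * 22`.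
    have hsr : √r ≤ 2 * √L := by
      rw [Real.sqrt_le_left (by positivity), mul_pow, Real.sq_sqrt (by positivity)]
      linarith
    have h2 : √(L : ℝ) * p ≤ 22 := by
      refine le_of_mul_le_mul_left ?_ hsLpos
      rw [← mul_assoc, hsL]
      linarith
    have hp : 0 ≤ p := ENNReal.toReal_nonneg
    rw [Real.rpow_neg hr.le, ← Real.sqrt_eq_rpow, ← div_eq_mul_inv,
      le_div_iff₀ (Real.sqrt_pos.2 hr)]
    nlinarith

end LineTail


/-- The line has its own argument with the better exponent; in the other dimensions the constant `4`
of the iteration is weakened to `44`, which then serves every `d`. -/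
theorem IsMarkLaw.tail_le_tailExponent {d : ℕ} {Ω : Type*} [MeasurableSpace Ω] {P : Measure Ω}
    {R B : Ω → Measure (Space d)} {M : Ω → Set (Space d × Space d)} {ν : Measure ℝ≥0∞}
    [IsProbabilityMeasure P] (hd : 1 ≤ d)
    (hR : IsUnitPoissonProcess P R) (hB : IsUnitPoissonProcess P B) (hind : IndepFun R B P)
    (hM : ∀ᵐ ω ∂P, IsStableMatching (support (R ω)) (support (B ω)) (M ω))
    (h : IsMarkLaw P R M ν) {r : ℝ} (hr : 0 < r) :
    ν (Ioi (ENNReal.ofReal r)) ≤ ENNReal.ofReal (44 * r ^ (-tailExponent d)) := by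
  rcases eq_or_ne d 1 with rfl | hd1
  · rw [tailExponent, if_pos rfl]
    exact h.tail_le_rpow_neg_half hR hB hM hr
  · rw [tailExponent, if_neg hd1]
    refine (h.tail_le hd hR hB hind hM hr).trans (ENNReal.ofReal_le_ofReal ?_)
    gcongr
    norm_num

end StableMatching

theorem mainTheorem1 :
    ∃ s : ℕ → ℝ, s 1 = 1 / 2 ∧ ∀ d : ℕ, 1 ≤ d → (0 < s d ∧ s d < 1) ∧
      ∃ C : ℝ, 0 < C ∧
        ∀ (Ω : Type*) [MeasurableSpace Ω] (P : Measure Ω) [IsProbabilityMeasure P]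
          (R B : Ω → Measure (StableMatching.Space d)),
          StableMatching.IsUnitPoissonProcess P R →
          StableMatching.IsUnitPoissonProcess P B →
          IndepFun R B P →
          (∀ᵐ ω ∂P, ∃! m : Set (StableMatching.Space d × StableMatching.Space d),
            StableMatching.IsStableMatching (StableMatching.support (R ω))
              (StableMatching.support (B ω)) m) ∧
          ∀ M : Ω → Set (StableMatching.Space d × StableMatching.Space d),
            (∀ᵐ ω ∂P, StableMatching.IsStableMatching (StableMatching.support (R ω))
              (StableMatching.support (B ω)) (M ω)) →
            StableMatching.IsMatchingScheme P R B M ∧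
            ∃ ν : Measure ℝ≥0∞, StableMatching.IsTypicalDistanceLaw P R M ν ∧
              ∫⁻ x, x ^ d ∂ν = ∞ ∧
              ∀ r : ℝ, 0 < r → ν (Ioi (ENNReal.ofReal r)) ≤ ENNReal.ofReal (C * r ^ (-s d)) := by
  refine ⟨StableMatching.tailExponent, by simp [StableMatching.tailExponent], fun d hd =>
    ⟨⟨StableMatching.tailExponent_pos hd, StableMatching.tailExponent_lt_one hd⟩, 44, by norm_num,
      fun Ω _ P _ R B hR hB hind =>
        ⟨StableMatching.ae_existsUnique_isStableMatching hd hR hB hind, fun M hM =>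
          ⟨StableMatching.isMatchingScheme hd hR hB hind hM, ?_⟩⟩⟩⟩
  obtain ⟨ν, h⟩ := StableMatching.exists_isMarkLaw hd hR hB hind hM
  exact ⟨ν, h.isTypicalDistanceLaw, h.lintegral_pow_eq_top hd hR hB hind hM,
    fun r hr => h.tail_le_tailExponent hd hR hB hind hM hr⟩
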